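/- **Conventions.** A *matched pair of groups* $(G,\Gamma)$ consists of groups $G,\Gamma$, an action $\rhd_1$ of $G$ on the set $\Gamma$ and an action $\rhd_2$ of $\Gamma$ on the set $G$ with $g\rhd_1 e=e$, $s\rhd_2 e=e$, $g\rhd_1(st)=((t\rhd_2 g)\rhd_1 s)(g\rhd_1 t)$ and $s\rhd_2(gh)=((h\rhd_1 s)\rhd_2 g)(s\rhd_2 h)$. A *$\Gamma$-grading* of an additive monoidal category $\mathcal C$ (with biadditive $\otimes$) is a family of additive replete full subcategories $\mathcal C_s$, $s\in\Gamma$, with $\mathrm{Hom}(\mathcal C_s,\mathcal C_t)=0$ for $s\neq t$, such that every object is a finite direct sum of homogeneous ones, $\mathcal C_s\otimes\mathcal C_t\subset\mathcal C_{st}$ and $\mathbf 1\in\mathcal C_e$. An *action* $\gamma$ of $G$ on an additive category consists of additive endofunctors $\gamma(g)$, $g\in G$, written $X\mapsto{}^gX$, and natural isomorphisms $\chi_{g,h}:\gamma(g)\gamma(h)\cong\gamma(gh)$ and $\iota:\mathrm{id}\cong\gamma(e)$ with $\chi_{gh,k}\,\chi_{g,h}=\chi_{g,hk}\,({}^g\chi_{h,k})$,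 $\chi_{e,g}\,\iota=\mathrm{id}$ and $\chi_{g,e}\,({}^g\iota)=\mathrm{id}$. A *$(G,\Gamma)$-crossed structure* on a $\Gamma$-graded monoidal category $\mathcal C$ (in the sense of Natale) is an action of $G$ on the category $\mathcal C$ with ${}^g\mathcal C_s\subset\mathcal C_{g\rhd_1 s}$, isomorphisms $J^{g}_{\lambda,\mu}:{}^{s\rhd_2 g}\lambda\otimes{}^g\mu\cong{}^g(\lambda\otimes\mu)$ for $\lambda\in\mathcal C$, $\mu\in\mathcal C_s$, natural in $\lambda$ and $\mu$, and isomorphisms $\varphi^g:\mathbf 1\cong{}^g\mathbf 1$ such that, with $a$ the associator and unitors suppressed, $${}^g a_{\lambda,\mu,\nu}\,J^g_{\lambda\mu,\nu}\,(J^{t\rhd_2 g}_{\lambda,\mu}\otimes\mathrm{id})=J^g_{\lambda,\mu\nu}\,(\mathrm{id}\otimes J^g_{\mu,\nu})\,a\quad(\mu\in\mathcal C_s,\ \nu\in\mathcal C_t),$$ $$J^g_{\mathbf 1,\mu}(\varphi^{s\rhd_2 g}\otimes\mathrm{id})=\mathrm{id}_{{}^g\mu}\quad(\mu\in\mathcal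 C_s),\qquad J^g_{\lambda,\mathbf 1}(\mathrm{id}\otimes\varphi^g)=\mathrm{id}_{{}^g\lambda}\quad(\lambda\in\mathcal C),$$ $$(\chi_{g,h})_{\lambda\mu}\,{}^gJ^h_{\lambda,\mu}\,J^g_{{}^{s\rhd_2 h}\lambda,{}^h\mu}=J^{gh}_{\lambda,\mu}\,\big((\chi_{(h\rhd_1 s)\rhd_2 g,\,s\rhd_2 h})_\lambda\otimes(\chi_{g,h})_\mu\big)\quad(\mu\in\mathcal C_s),$$ $$(\chi_{g,h})_{\mathbf 1}\,{}^g\varphi^h\,\varphi^g=\varphi^{gh},\qquad \iota_{\lambda\mu}=J^e_{\lambda,\mu}(\iota_\lambda\otimes\iota_\mu),\qquad \iota_{\mathbf 1}=\varphi^e .$$ A *tensor category* over a field $k$ is a locally finite $k$-linear abelian rigid monoidal category with bilinear $\otimes$ and $\dim_k\mathrm{End}(\mathbf 1)=1$ (locally finite: finite-dimensional $\mathrm{Hom}$ spaces, all objects of finite length). Duals are denoted $\mathrm{ev}_\mu:\mu^\vee\otimes\mu\to\mathbf 1$, $\mathrm{coev}_\mu:\mathbf 1\to\mu\otimes\mu^\vee$.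 A *pivotal structure* is a monoidal natural isomorphism $\delta:\mathrm{id}\cong(-)^{\vee\vee}$; the *dimension* of $\mu$ is $d_\mu=\mathrm{ev}_{\mu^\vee}(\delta_\mu\otimes\mathrm{id})\,\mathrm{coev}_\mu\in\mathrm{End}(\mathbf 1)=k$. A *$(G,\Gamma)$-crossed pivotal tensor category* is a tensor category with a $\Gamma$-grading, a $(G,\Gamma)$-crossed structure with $k$-linear functors $\gamma(g)$, and a pivotal structure $\delta$ such that ${}^g\delta_\mu=\delta_{{}^g\mu}$ for all $g$ and all homogeneous $\mu$, where for $\mu\in\mathcal C_s$ the dual $({}^g\mu)^\vee$ is identified with ${}^{s\rhd_2 g}(\mu^\vee)$ through the evaluation $(\varphi^g)^{-1}\,{}^g\mathrm{ev}_\mu\,J^g_{\mu^\vee,\mu}$. It is *non-singular* if every $\mathcal C_s$, $s\in\Gamma$, contains an object of nonzero dimension. The *crossed center* $\mathrm Z=\mathrm Z^{(G,\Gamma)}(\mathcal C)$ is $\bigoplus_{g\in G}\mathrm Z_g$, where an object of $\mathrm Z_g$ is an object $\lambda$ of $\mathcal C$ with isomorphisms $h^\lambda_\nu:\lambda\otimes\nu\cong{}^g\nu\otimes\lambda$,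 natural in $\nu\in\mathcal C_e$, such that $h^\lambda_{\nu_1\nu_2}=(\mathrm{id}\otimes h^\lambda_{\nu_2})(h^\lambda_{\nu_1}\otimes\mathrm{id})$ (with $J^g$ suppressed), and a morphism of $\mathrm Z_g$ is a morphism of $\mathcal C$ compatible with these isomorphisms. The category $\mathrm Z$ is monoidal by $(\lambda,h^\lambda)\otimes(\mu,h^\mu)=(\lambda\otimes\mu,(h^\lambda\otimes\mathrm{id})(\mathrm{id}\otimes h^\mu))$ on homogeneous objects (with $\chi$ suppressed). For $(g,s)\in G\times\Gamma$ let $\mathrm Z_{(g,s)}$ be the full subcategory of those $(\lambda,h^\lambda)\in\mathrm Z_g$ with $\lambda\in\mathcal C_s$. **Lemma.** Let $(G,\Gamma)$ be a matched pair of groups, and let $\mathcal C$ be a non-singular $(G,\Gamma)$-crossed pivotal tensor category over a field $k$. Let $(\Gamma,G\times\Gamma)$ be the matched pair given by $$s\rhd_1(h,t)=\big(s\rhd_2 h,\,(h\rhd_1 s)\,t\,s^{-1}\big),\qquad (h,t)\rhd_2 s=h\rhd_1 s .$$ 1. The subcategories $\mathrm Z_{(g,s)}$ form a $(G\times\Gamma)$-grading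 of the monoidal category $\mathrm Z$, and $\mathrm Z$ admits a $(\Gamma,G\times\Gamma)$-crossed structure with $k$-linear functors. 2. More precisely, let $\zeta_s\in\mathcal C_s$ ($s\in\Gamma$) be any family of objects with nonzero dimensions $d_s=d_{\zeta_s}$. Then there is such a crossed structure whose functors $\gamma^\Gamma(s)$ are, up to natural isomorphism on each $\mathrm Z_h$, the following ones. For $(\lambda,h^\lambda)\in\mathrm Z_h$ and $\mu=\zeta_s$, let $$e^\mu_\lambda=d_\mu^{-1}\,\big(\mathrm{ev}_{({}^h\mu)^\vee}\otimes\mathrm{id}_{{}^h\mu\,\lambda\,\mu^\vee}\big)\big(\delta_{{}^h\mu}\otimes h^\lambda_{\mu^\vee\mu}\otimes\mathrm{id}_{\mu^\vee}\big)\big(\mathrm{id}_{{}^h\mu\,\lambda\,\mu^\vee}\otimes\mathrm{coev}_\mu\big)\in\mathrm{End}_{\mathcal C}({}^h\mu\otimes\lambda\otimes\mu^\vee),$$ where ${}^{s\rhd_2 h}(\mu^\vee)$ is identified with $({}^h\mu)^\vee$. This is an idempotent, and it splits as $e^\mu_\lambda=i_\lambda r_\lambda$, $r_\lambda i_\lambda=\mathrm{id}$,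 through an object $E_\lambda$ with inclusion $i_\lambda$ and retraction $r_\lambda$. Then $\gamma^\Gamma(s)(\lambda,h^\lambda)=(E_\lambda,h^{E_\lambda})\in\mathrm Z_{s\rhd_2 h}$, where for $\nu\in\mathcal C_e$ $$h^{E_\lambda}_\nu=d_\mu^{-1}\,(\mathrm{id}_{{}^{s\rhd_2 h}\nu}\otimes r_\lambda)\big(\mathrm{ev}_{({}^h\mu)^\vee}\otimes\mathrm{id}\big)\big(\delta_{{}^h\mu}\otimes h^\lambda_{\mu^\vee\nu\mu}\otimes\mathrm{id}_{\mu^\vee}\big)\big(\mathrm{id}\otimes\mathrm{coev}_\mu\big)(i_\lambda\otimes\mathrm{id}_\nu),$$ and $\gamma^\Gamma(s)(f)=r_{\lambda'}\,(\mathrm{id}_{{}^h\mu}\otimes f\otimes\mathrm{id}_{\mu^\vee})\,i_\lambda$ for a morphism $f:(\lambda,h^\lambda)\to(\lambda',h^{\lambda'})$ of $\mathrm Z_h$. -/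

import Mathlib

open CategoryTheory MonoidalCategory Limits

set_option linter.unusedSectionVars false

namespace CrossedCat

/-- A matched pair of groups: an action `act₁` of `G` on the set `Γ` and an action `act₂` of `Γ` on
the set `G` that satisfy the matching relations. -/
structure MatchedPair (G Γ : Type*) [Group G] [Group Γ] where
  act₁ : G → Γ → Γ
  act₂ : Γ → G → G
  one_act₁ : ∀ s, act₁ 1 s = s
  mul_act₁ : ∀ g h s, act₁ (g * h) s = act₁ g (act₁ h s)
  one_act₂ : ∀ g, act₂ 1 g = g
  mul_act₂ : ∀ s t g, act₂ (s * t) g = act₂ s (act₂ t g)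
  act₁_one : ∀ g, act₁ g 1 = 1
  act₂_one : ∀ s, act₂ s 1 = 1
  act₁_mul : ∀ g s t, act₁ g (s * t) = act₁ (act₂ t g) s * act₁ g t
  act₂_mul : ∀ s g h, act₂ s (g * h) = act₂ (act₁ h s) g * act₂ s h

namespace MatchedPair

variable {G Γ : Type*} [Group G] [Group Γ] (P : MatchedPair G Γ)

theorem act₁_inv (g : G) (s : Γ) : P.act₁ g s⁻¹ = (P.act₁ (P.act₂ s⁻¹ g) s)⁻¹ := by
  rw [eq_inv_iff_mul_eq_one, eq_comm]
  have := P.act₁_mul g s s⁻¹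
  rw [mul_inv_cancel, P.act₁_one] at this
  rw [mul_eq_one_comm.1 this.symm]

/-- The matched pair `(Γ, G × Γ)` with `s ▷₁ (h, t) = (s ▷₂ h, (h ▷₁ s) t s⁻¹)` and
`(h, t) ▷₂ s = h ▷₁ s`. -/
def center : MatchedPair Γ (G × Γ) where
  act₁ s x := (P.act₂ s x.1, P.act₁ x.1 s * x.2 * s⁻¹)
  act₂ x s := P.act₁ x.1 s
  one_act₁ x := by simp [P.one_act₂, P.act₁_one]
  mul_act₁ s t x := by
    ext
    · simp [P.mul_act₂]
    · simp [P.act₁_mul, mul_assoc]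
  one_act₂ s := by simp [P.one_act₁]
  mul_act₂ x y s := by simp [P.mul_act₁]
  act₁_one s := by simp [P.act₂_one, P.one_act₁]
  act₂_one x := by simp [P.act₁_one]
  act₁_mul s x y := by
    ext
    · simp [P.act₂_mul]
    · simp [P.mul_act₁, mul_assoc]
  act₂_mul x s t := by simp [P.act₁_mul]

end MatchedPair

namespace FormalSum

noncomputable section

universe v u
variable {D : Type u} [Category.{v} D] [Preadditive D]

/-- The entries of a matrix of morphisms. -/
def entry {M N : Mat_ D} (f : M ⟶ N) (i : M.ι) (j : N.ι) : M.X i ⟶ N.X j := f i j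

/-- The matrix with the given entries. -/
def ofEntries {M N : Mat_ D} (f : ∀ (i : M.ι) (j : N.ι), M.X i ⟶ N.X j) : M ⟶ N := f

@[simp] theorem entry_ofEntries {M N : Mat_ D} (f : ∀ (i : M.ι) (j : N.ι), M.X i ⟶ N.X j) (i j) :
    entry (ofEntries f) i j = f i j := rfl

theorem entry_ext {M N : Mat_ D} {f g : M ⟶ N} (h : ∀ i j, entry f i j = entry g i j) : f = g :=
  Mat_.hom_ext _ _ h

@[simp] theorem entry_add {M N : Mat_ D} (f g : M ⟶ N) (i j) :
    entry (f + g) i j = entry f i j + entry g i j := rfl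

@[simp] theorem entry_zero {M N : Mat_ D} (i j) : entry (0 : M ⟶ N) i j = 0 := rfl

theorem entry_comp {M N K : Mat_ D} (f : M ⟶ N) (g : N ⟶ K) (i k) :
    entry (f ≫ g) i k = ∑ j, entry f i j ≫ entry g j k := rfl

@[simp] theorem entry_id_self {M : Mat_ D} (i) : entry (𝟙 M) i i = 𝟙 (M.X i) :=
  Mat_.id_apply_self M i

theorem entry_id_ne {M : Mat_ D} {i j} (h : i ≠ j) : entry (𝟙 M) i j = 0 :=
  Mat_.id_apply_of_ne M i j h

/-- The matrix with the entries `a i` at `(i, σ i)` and zero elsewhere. -/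
def along {M N : Mat_ D} (σ : M.ι → N.ι) (a : ∀ i, M.X i ⟶ N.X (σ i)) : M ⟶ N :=
  ofEntries fun i j => a i ≫ entry (𝟙 N) (σ i) j

theorem entry_along {M N : Mat_ D} (σ : M.ι → N.ι) (a : ∀ i, M.X i ⟶ N.X (σ i)) (i j) :
    entry (along σ a) i j = a i ≫ entry (𝟙 N) (σ i) j := rfl

theorem entry_along_comp {M N K : Mat_ D} (σ : M.ι → N.ι) (a : ∀ i, M.X i ⟶ N.X (σ i))
    (f : N ⟶ K) (i : M.ι) (k : K.ι) : entry (along σ a ≫ f) i k = a i ≫ entry f (σ i) k := by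
  rw [entry_comp]
  simp only [entry_along, Category.assoc]
  rw [← Preadditive.comp_sum, ← entry_comp, Category.id_comp]

theorem entry_comp_along {M N K : Mat_ D} (σ : N.ι → K.ι) (hσ : Function.Injective σ)
    (a : ∀ i, N.X i ⟶ K.X (σ i)) (f : M ⟶ N) (i : M.ι) (j : N.ι) :
    entry (f ≫ along σ a) i (σ j) = entry f i j ≫ a j := by
  rw [entry_comp, Finset.sum_eq_single j]
  · rw [entry_along, entry_id_self, Category.comp_id]
  · intro j' _ hj
    rw [entry_along, entry_id_ne (fun h => hj (hσ h)), comp_zero, comp_zero]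
  · simp

theorem along_comp_along {M N K : Mat_ D} (σ : M.ι → N.ι) (a : ∀ i, M.X i ⟶ N.X (σ i))
    (τ : N.ι → K.ι) (b : ∀ i, N.X i ⟶ K.X (τ i)) :
    along σ a ≫ along τ b = along (fun i => τ (σ i)) (fun i => a i ≫ b (σ i)) := by
  refine entry_ext fun i k => ?_
  rw [entry_along_comp, entry_along, entry_along, Category.assoc]

theorem along_id {M : Mat_ D} (a : ∀ i, M.X i ⟶ M.X i) (ha : ∀ i, a i = 𝟙 _) :
    along (fun i => i) a = 𝟙 M := by
  refine entry_ext fun i k => ?_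
  rw [entry_along, ha, Category.id_comp]

variable [MonoidalCategory D] 

/-- The tensor product of finite families. -/
abbrev tObj (M N : Mat_ D) : Mat_ D := ⟨M.ι × N.ι, fun p => M.X p.1 ⊗ N.X p.2⟩

/-- The tensor product of matrices. -/
def tHom {M M' N N' : Mat_ D} (f : M ⟶ M') (g : N ⟶ N') : tObj M N ⟶ tObj M' N' :=
  ofEntries fun p q => entry f p.1 q.1 ⊗ₘ entry g p.2 q.2

theorem entry_tHom {M M' N N' : Mat_ D} (f : M ⟶ M') (g : N ⟶ N') (p q) : 
    entry (tHom f g) p q = entry f p.1 q.1 ⊗ₘ entry g p.2 q.2 := rfl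

/-- The tensor unit, a family with a single member. -/
abbrev tUnit : Mat_ D := ⟨PUnit, fun _ => 𝟙_ D⟩

/-- The associator. -/
def tAssoc (M N K : Mat_ D) : tObj (tObj M N) K ≅ tObj M (tObj N K) where
  hom := along (fun p => (p.1.1, (p.1.2, p.2))) fun p => (α_ (M.X p.1.1) (N.X p.1.2) (K.X p.2)).hom
  inv := along (fun p => ((p.1, p.2.1), p.2.2)) fun p => (α_ (M.X p.1) (N.X p.2.1) (K.X p.2.2)).inv
  hom_inv_id := (along_comp_along _ _ _ _).trans (along_id _ fun _ => Iso.hom_inv_id _)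
  inv_hom_id := (along_comp_along _ _ _ _).trans (along_id _ fun _ => Iso.inv_hom_id _)

/-- The left unitor. -/
def tLeft (M : Mat_ D) : tObj tUnit M ≅ M where
  hom := along (fun p => p.2) fun p => (λ_ (M.X p.2)).hom
  inv := along (fun i => (PUnit.unit, i)) fun i => (λ_ (M.X i)).inv
  hom_inv_id := (along_comp_along _ _ _ _).trans (along_id _ fun _ => Iso.hom_inv_id _)
  inv_hom_id := (along_comp_along _ _ _ _).trans (along_id _ fun _ => Iso.inv_hom_id _)

/-- The right unitor. -/
def tRight (M : Mat_ D) : tObj M tUnit ≅ M where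
  hom := along (fun p => p.1) fun p => (ρ_ (M.X p.1)).hom
  inv := along (fun i => (i, PUnit.unit)) fun i => (ρ_ (M.X i)).inv
  hom_inv_id := (along_comp_along _ _ _ _).trans (along_id _ fun _ => Iso.hom_inv_id _)
  inv_hom_id := (along_comp_along _ _ _ _).trans (along_id _ fun _ => Iso.inv_hom_id _)

theorem tAssoc_hom (M N K : Mat_ D) : (tAssoc M N K).hom =
    along (M := tObj (tObj M N) K) (N := tObj M (tObj N K)) (fun p => (p.1.1, (p.1.2, p.2)))
      (fun p => (α_ (M.X p.1.1) (N.X p.1.2) (K.X p.2)).hom) := rfl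

theorem tLeft_hom (M : Mat_ D) : (tLeft M).hom =
    along (M := tObj tUnit M) (N := M) (fun p => p.2) (fun p => (λ_ (M.X p.2)).hom) := rfl

theorem tRight_hom (M : Mat_ D) : (tRight M).hom =
    along (M := tObj M tUnit) (N := M) (fun p => p.1) (fun p => (ρ_ (M.X p.1)).hom) := rfl

variable [MonoidalPreadditive D]

theorem tHom_id (M N : Mat_ D) : tHom (𝟙 M) (𝟙 N) = 𝟙 (tObj M N) := by
  refine entry_ext ?_
  rintro ⟨i, j⟩ ⟨i', j'⟩
  rw [entry_tHom]
  by_cases h : i = i'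
  · subst h
    by_cases h' : j = j'
    · subst h'; simp
    · rw [entry_id_ne (M := tObj M N) (fun e => h' (Prod.mk.inj e).2), entry_id_ne h']; simp
  · rw [entry_id_ne (M := tObj M N) (fun e => h (Prod.mk.inj e).1), entry_id_ne h]; simp

theorem tHom_comp {M M' M'' N N' N'' : Mat_ D} (f : M ⟶ M') (g : N ⟶ N') (f' : M' ⟶ M'') 
    (g' : N' ⟶ N'') : tHom f g ≫ tHom f' g' = tHom (f ≫ f') (g ≫ g') := by
  refine entry_ext ?_
  rintro ⟨i, j⟩ ⟨i', j'⟩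
  rw [entry_comp, Fintype.sum_prod_type]
  simp only [entry_tHom, entry_comp, sum_tensor, tensor_sum, tensorHom_comp_tensorHom]
  exact Finset.sum_comm

theorem tHom_id_along (K : Mat_ D) {M N : Mat_ D} (σ : M.ι → N.ι) (a : ∀ i, M.X i ⟶ N.X (σ i)) :
    tHom (𝟙 K) (along σ a) = along (M := tObj K M) (N := tObj K N)
      (fun p => (p.1, σ p.2)) (fun p => K.X p.1 ◁ a p.2) := by
  refine entry_ext fun p q => ?_
  rw [entry_along, ← tHom_id, entry_tHom, entry_tHom, entry_along, whiskerLeft_comp_tensorHom]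

theorem tHom_along_id (K : Mat_ D) {M N : Mat_ D} (σ : M.ι → N.ι) (a : ∀ i, M.X i ⟶ N.X (σ i)) :
    tHom (along σ a) (𝟙 K) = along (M := tObj M K) (N := tObj N K)
      (fun p => (σ p.1, p.2)) (fun p => a p.1 ▷ K.X p.2) := by
  refine entry_ext fun p q => ?_
  rw [entry_along, ← tHom_id, entry_tHom, entry_tHom, entry_along, whiskerRight_comp_tensorHom]

theorem tAssoc_naturality {M₁ M₂ M₃ N₁ N₂ N₃ : Mat_ D} (f : M₁ ⟶ N₁) (g : M₂ ⟶ N₂) (h : M₃ ⟶ N₃) :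
    tHom (tHom f g) h ≫ (tAssoc N₁ N₂ N₃).hom = (tAssoc M₁ M₂ M₃).hom ≫ tHom f (tHom g h) := by
  refine entry_ext ?_
  rintro p ⟨i', j', k'⟩
  refine (entry_comp_along (N := tObj (tObj N₁ N₂) N₃) (K := tObj N₁ (tObj N₂ N₃))
    (fun p => (p.1.1, (p.1.2, p.2))) ?_
    (fun p => (α_ (N₁.X p.1.1) (N₂.X p.1.2) (N₃.X p.2)).hom) _ p ((i', j'), k')).trans
    (Eq.trans ?_ (entry_along_comp (M := tObj (tObj M₁ M₂) M₃) (N := tObj M₁ (tObj M₂ M₃))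
      (fun p => (p.1.1, (p.1.2, p.2))) (fun p => (α_ (M₁.X p.1.1) (M₂.X p.1.2) (M₃.X p.2)).hom)
      (tHom f (tHom g h)) p (i', j', k')).symm)
  · rintro ⟨⟨a, b⟩, c⟩ ⟨⟨a', b'⟩, c'⟩ e
    cases e; rfl
  · exact associator_naturality _ _ _

theorem tLeft_naturality {M N : Mat_ D} (f : M ⟶ N) :
    tHom (𝟙 tUnit) f ≫ (tLeft N).hom = (tLeft M).hom ≫ f := by
  refine entry_ext fun p j => ?_
  refine (entry_comp_along (N := tObj tUnit N) _ ?_ _ _ p (PUnit.unit, j)).trans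
    (Eq.trans ?_ (entry_along_comp _ _ _ _ _).symm)
  · rintro ⟨a, b⟩ ⟨a', b'⟩ e
    exact Prod.ext rfl e
  · obtain ⟨⟨⟩, i⟩ := p
    rw [entry_tHom]
    refine Eq.trans ?_ (leftUnitor_naturality (entry f i j))
    rw [← id_tensorHom]
    exact congrArg (fun z => (z ⊗ₘ entry f i j) ≫ _) (entry_id_self _)

theorem tRight_naturality {M N : Mat_ D} (f : M ⟶ N) :
    tHom f (𝟙 tUnit) ≫ (tRight N).hom = (tRight M).hom ≫ f := by
  refine entry_ext fun p j => ?_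
  refine (entry_comp_along (N := tObj N tUnit) _ ?_ _ _ p (j, PUnit.unit)).trans
    (Eq.trans ?_ (entry_along_comp _ _ _ _ _).symm)
  · rintro ⟨a, b⟩ ⟨a', b'⟩ e
    exact Prod.ext e rfl
  · obtain ⟨i, ⟨⟩⟩ := p
    rw [entry_tHom]
    refine Eq.trans ?_ (rightUnitor_naturality (entry f i j))
    rw [← tensorHom_id]
    exact congrArg (fun z => (entry f i j ⊗ₘ z) ≫ _) (entry_id_self _)

theorem tPentagon (M N K L : Mat_ D) :
    tHom (tAssoc M N K).hom (𝟙 L) ≫ (tAssoc M (tObj N K) L).hom ≫ tHom (𝟙 M) (tAssoc N K L).hom =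
      (tAssoc (tObj M N) K L).hom ≫ (tAssoc M N (tObj K L)).hom := by
  simp only [tAssoc_hom]
  rw [tHom_along_id L (M := tObj (tObj M N) K) (N := tObj M (tObj N K)),
    tHom_id_along M (M := tObj (tObj N K) L) (N := tObj N (tObj K L))]
  have h₁ := along_comp_along
    (M := tObj (tObj M (tObj N K)) L) (N := tObj M (tObj (tObj N K) L))
    (K := tObj M (tObj N (tObj K L)))
    (fun p => (p.1.1, (p.1.2, p.2)))
    (fun p => (α_ (M.X p.1.1) ((tObj N K).X p.1.2) (L.X p.2)).hom)
    (fun p => (p.1, (p.2.1.1, (p.2.1.2, p.2.2))))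
    (fun p => M.X p.1 ◁ (α_ (N.X p.2.1.1) (K.X p.2.1.2) (L.X p.2.2)).hom)
  have h₂ := along_comp_along
    (M := tObj (tObj (tObj M N) K) L) (N := tObj (tObj M (tObj N K)) L)
    (K := tObj M (tObj N (tObj K L)))
    (fun p => ((p.1.1.1, (p.1.1.2, p.1.2)), p.2))
    (fun p => (α_ (M.X p.1.1.1) (N.X p.1.1.2) (K.X p.1.2)).hom ▷ L.X p.2)
    (fun p => (p.1.1, (p.1.2.1, (p.1.2.2, p.2))))
    (fun p => (α_ (M.X p.1.1) ((tObj N K).X p.1.2) (L.X p.2)).hom ≫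
      M.X p.1.1 ◁ (α_ (N.X p.1.2.1) (K.X p.1.2.2) (L.X p.2)).hom)
  have h₃ := along_comp_along
    (M := tObj (tObj (tObj M N) K) L) (N := tObj (tObj M N) (tObj K L))
    (K := tObj M (tObj N (tObj K L)))
    (fun p => (p.1.1, (p.1.2, p.2)))
    (fun p => (α_ ((tObj M N).X p.1.1) (K.X p.1.2) (L.X p.2)).hom)
    (fun p => (p.1.1, (p.1.2, p.2)))
    (fun p => (α_ (M.X p.1.1) (N.X p.1.2) ((tObj K L).X p.2)).hom)
  refine (congrArg (_ ≫ ·) h₁).trans (h₂.trans (Eq.trans ?_ h₃.symm))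
  exact congrArg (along _) (funext fun p => pentagon _ _ _ _)

theorem tTriangle (M N : Mat_ D) :
    (tAssoc M tUnit N).hom ≫ tHom (𝟙 M) (tLeft N).hom = tHom (tRight M).hom (𝟙 N) := by
  rw [tAssoc_hom, tLeft_hom, tRight_hom, tHom_along_id N (M := tObj M tUnit) (N := M),
    tHom_id_along M (M := tObj tUnit N) (N := N)]
  refine (along_comp_along (M := tObj (tObj M tUnit) N) (N := tObj M (tObj tUnit N))
    (K := tObj M N) (fun p => (p.1.1, (p.1.2, p.2)))
    (fun p => (α_ (M.X p.1.1) (𝟙_ D) (N.X p.2)).hom)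
    (fun p => (p.1, p.2.2)) (fun p => M.X p.1 ◁ (λ_ (N.X p.2.2)).hom)).trans ?_
  exact congrArg (along _) (funext fun p => triangle _ _)

/-- The monoidal structure on the additive envelope that extends the one of `D` biadditively. -/
instance : MonoidalCategory (Mat_ D) where
  tensorObj := tObj
  tensorHom := tHom
  whiskerLeft M _ _ f := tHom (𝟙 M) f
  whiskerRight f M := tHom f (𝟙 M)
  tensorUnit := tUnit
  associator := tAssoc
  leftUnitor := tLeft
  rightUnitor := tRight
  id_tensorHom_id := tHom_id
  tensorHom_def f g := by
    exact (by rw [tHom_comp, Category.id_comp, Category.comp_id] :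
      tHom f g = tHom f (𝟙 _) ≫ tHom (𝟙 _) g)
  tensorHom_comp_tensorHom := tHom_comp
  whiskerLeft_id := tHom_id
  id_whiskerRight := tHom_id
  associator_naturality := tAssoc_naturality
  leftUnitor_naturality := tLeft_naturality
  rightUnitor_naturality := tRight_naturality
  pentagon := tPentagon
  triangle := tTriangle

theorem tHom_def {M M' N N' : Mat_ D} (f : M ⟶ M') (g : N ⟶ N') : f ⊗ₘ g = tHom f g := rfl

theorem entry_whiskerLeft (K : Mat_ D) {M N : Mat_ D} (f : M ⟶ N) (p q) :
    entry (K ◁ f) p q = entry (𝟙 K) p.1 q.1 ⊗ₘ entry f p.2 q.2 := rfl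

theorem entry_whiskerRight (K : Mat_ D) {M N : Mat_ D} (f : M ⟶ N) (p q) :
    entry (f ▷ K) p q = entry f p.1 q.1 ⊗ₘ entry (𝟙 K) p.2 q.2 := rfl

instance : MonoidalPreadditive (Mat_ D) where
  whiskerLeft_zero := entry_ext fun p q => by rw [entry_whiskerLeft]; simp
  zero_whiskerRight := entry_ext fun p q => by rw [entry_whiskerRight]; simp
  whiskerLeft_add f g := entry_ext fun p q => by
    rw [entry_add, entry_whiskerLeft, entry_whiskerLeft, entry_whiskerLeft, entry_add,
      MonoidalPreadditive.tensor_add]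
  add_whiskerRight f g := entry_ext fun p q => by
    rw [entry_add, entry_whiskerRight, entry_whiskerRight, entry_whiskerRight, entry_add,
      MonoidalPreadditive.add_tensor]

section Linear

variable {k : Type*} [Semiring k] [Linear k D]

instance (M N : Mat_ D) : Module k (M ⟶ N) :=
  inferInstanceAs (Module k (∀ (i : M.ι) (j : N.ι), M.X i ⟶ N.X j))

theorem entry_smul {M N : Mat_ D} (r : k) (f : M ⟶ N) (i j) :
    entry (r • f) i j = r • entry f i j := rfl

instance : Linear k (Mat_ D) where
  smul_comp _ _ _ r f g := entry_ext fun i j => by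
    simp [entry_smul, entry_comp, Finset.smul_sum]
  comp_smul _ _ _ f r g := entry_ext fun i j => by
    simp [entry_smul, entry_comp, Finset.smul_sum]

end Linear

end
end FormalSum

noncomputable section

universe v u w₁ w₂

/-- A `Γ`-grading on an additive monoidal category: the family of the full replete additive
subcategories of homogeneous objects, such that there are no nonzero morphisms between different
degrees, every object is a finite direct sum of homogeneous ones, and the tensor product multiplies
degrees. (That the unit has degree `1` is automatic.) -/
structure IsMonoidalGrading {Γ : Type w₂} [Group Γ] {C : Type u} [Category.{v} C] [Preadditive C]
    [HasFiniteBiproducts C] [MonoidalCategory C] [MonoidalPreadditive C]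
    (gr : Γ → ObjectProperty C) : Prop where
  of_iso : ∀ {s : Γ} {X Y : C}, (X ≅ Y) → gr s X → gr s Y
  biproduct : ∀ {s : Γ} {n : ℕ} (X : Fin n → C), (∀ i, gr s (X i)) → gr s (⨁ X)
  hom_eq_zero : ∀ {s t : Γ} {X Y : C}, s ≠ t → gr s X → gr t Y → ∀ f : X ⟶ Y, f = 0
  decomposition : ∀ X : C, ∃ (n : ℕ) (d : Fin n → Γ) (Y : Fin n → C),
    (∀ i, gr (d i) (Y i)) ∧ Nonempty (X ≅ ⨁ Y)
  tensor : ∀ {s t : Γ} {X Y : C}, gr s X → gr t Y → gr (s * t) (X ⊗ Y)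
  unit : gr 1 (𝟙_ C)

/-- An action of a group on a category, i.e. a monoidal functor from the discrete monoidal category
of the group to the category of endofunctors, in components. To avoid transports along equations
between group elements, `χ` (of type `γ(g) γ(h) ≅ γ(gh)`) and `ι` (of type `id ≅ γ(1)`) are
indexed by group elements together with an equation. -/
structure GroupAction (G : Type w₁) [Group G] (C : Type u) [Category.{v} C] where
  act : G → C ⥤ C
  χ : ∀ {g h k : G}, g * h = k → (act h ⋙ act g ≅ act k)
  ι : ∀ {e : G}, e = 1 → (𝟭 C ≅ act e)
  χ_assoc : ∀ {g h k gh hk ghk : G} (e₁ : g * h = gh) (e₂ : h * k = hk) (e₃ : gh * k = ghk)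
    (e₄ : g * hk = ghk) (X : C),
    (χ e₁).hom.app ((act k).obj X) ≫ (χ e₃).hom.app X =
      (act g).map ((χ e₂).hom.app X) ≫ (χ e₄).hom.app X
  ι_χ : ∀ {e g : G} (he : e = 1) (h : e * g = g) (X : C),
    (ι he).hom.app ((act g).obj X) ≫ (χ h).hom.app X = 𝟙 ((act g).obj X)
  χ_ι : ∀ {e g : G} (he : e = 1) (h : g * e = g) (X : C),
    (act g).map ((ι he).hom.app X) ≫ (χ h).hom.app X = 𝟙 ((act g).obj X)

/-- A `(G, Γ)`-crossed monoidal category structure (in the sense of Natale) with the grading `gr`.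
The isomorphism `J e hμ X` for `e : s ▷₂ g = g'` and `μ` of degree `s` is
`J^{γ(g)}_{X,μ} : ^{s ▷₂ g} X ⊗ ^g μ ≅ ^g (X ⊗ μ)`. -/
structure CrossedStructure {G : Type w₁} {Γ : Type w₂} [Group G] [Group Γ] (P : MatchedPair G Γ)
    {C : Type u} [Category.{v} C] [Preadditive C] [HasFiniteBiproducts C] [MonoidalCategory C]
    [MonoidalPreadditive C] (gr : Γ → ObjectProperty C) extends GroupAction G C where
  grading : IsMonoidalGrading gr
  additive : ∀ g, (act g).Additive
  act_mem : ∀ (g : G) {s : Γ} {X : C}, gr s X → gr (P.act₁ g s) ((act g).obj X)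
  J : ∀ {g g' : G} {s : Γ}, P.act₂ s g = g' → ∀ {μ : C}, gr s μ → ∀ X : C,
    ((act g').obj X ⊗ (act g).obj μ ≅ (act g).obj (X ⊗ μ))
  J_natural : ∀ {g g' : G} {s : Γ} (e : P.act₂ s g = g') {μ ν : C} (hμ : gr s μ) (hν : gr s ν)
    (m : μ ⟶ ν) {X Y : C} (f : X ⟶ Y),
    ((act g').map f ⊗ₘ (act g).map m) ≫ (J e hν Y).hom = (J e hμ X).hom ≫ (act g).map (f ⊗ₘ m)
  φ : ∀ g : G, 𝟙_ C ≅ (act g).obj (𝟙_ C)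
  J_assoc : ∀ {g g' g'' : G} {s t : Γ} (e : P.act₂ t g = g') (e' : P.act₂ s g' = g'')
    (e'' : P.act₂ (s * t) g = g'') {μ ν : C} (hμ : gr s μ) (hν : gr t ν)
    (hμν : gr (s * t) (μ ⊗ ν)) (X : C),
    (J e' hμ X).hom ▷ (act g).obj ν ≫ (J e hν (X ⊗ μ)).hom ≫ (act g).map (α_ X μ ν).hom =
      (α_ ((act g'').obj X) ((act g').obj μ) ((act g).obj ν)).hom ≫
        (act g'').obj X ◁ (J e hν μ).hom ≫ (J e'' hμν X).hom
  J_unit_left : ∀ {g g' : G} {s : Γ} (e : P.act₂ s g = g') {μ : C} (hμ : gr s μ),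
    (φ g').hom ▷ (act g).obj μ ≫ (J e hμ (𝟙_ C)).hom ≫ (act g).map (λ_ μ).hom =
      (λ_ ((act g).obj μ)).hom
  J_unit_right : ∀ {g : G} (e : P.act₂ 1 g = g) (h₁ : gr 1 (𝟙_ C)) (X : C),
    (act g).obj X ◁ (φ g).hom ≫ (J e h₁ X).hom ≫ (act g).map (ρ_ X).hom =
      (ρ_ ((act g).obj X)).hom
  J_χ : ∀ {g h k g' h' k' : G} {s : Γ} (e : g * h = k) (e' : g' * h' = k')
    (eh : P.act₂ s h = h') (eg : P.act₂ (P.act₁ h s) g = g') (ek : P.act₂ s k = k')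
    {μ : C} (hμ : gr s μ) (X : C),
    (J eg (act_mem h hμ) ((act h').obj X)).hom ≫ (act g).map (J eh hμ X).hom ≫
        (χ e).hom.app (X ⊗ μ) =
      ((χ e').hom.app X ⊗ₘ (χ e).hom.app μ) ≫ (J ek hμ X).hom
  φ_χ : ∀ {g h k : G} (e : g * h = k),
    (φ g).hom ≫ (act g).map (φ h).hom ≫ (χ e).hom.app (𝟙_ C) = (φ k).hom
  ι_J : ∀ {e : G} (he : e = 1) {s : Γ} (e' : P.act₂ s e = e) {μ : C} (hμ : gr s μ) (X : C),
    ((ι he).hom.app X ⊗ₘ (ι he).hom.app μ) ≫ (J e' hμ X).hom = (ι he).hom.app (X ⊗ μ)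
  ι_φ : ∀ {e : G} (he : e = 1), (ι he).hom.app (𝟙_ C) = (φ e).hom

namespace CrossedStructure

variable {G : Type w₁} {Γ : Type w₂} [Group G] [Group Γ] {P : MatchedPair G Γ}
  {C : Type u} [Category.{v} C] [Preadditive C] [HasFiniteBiproducts C] [MonoidalCategory C]
  [MonoidalPreadditive C] {gr : Γ → ObjectProperty C} (S : CrossedStructure P gr)

theorem mem_one (g : G) {ν : C} (hν : gr 1 ν) : gr 1 ((S.act g).obj ν) := by
  have := S.act_mem g hν
  rwa [P.act₁_one] at this

/-- The isomorphism `^g ν₁ ⊗ ^g ν₂ ≅ ^g (ν₁ ⊗ ν₂)` for `ν₂` of degree `1`. -/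
def J₁ (g : G) {ν₂ : C} (h₂ : gr 1 ν₂) (ν₁ : C) :
    (S.act g).obj ν₁ ⊗ (S.act g).obj ν₂ ≅ (S.act g).obj (ν₁ ⊗ ν₂) :=
  S.J (P.one_act₂ g) h₂ ν₁

theorem J_congr {g g' : G} {s t : Γ} (h : s = t) (e : P.act₂ s g = g') (e' : P.act₂ t g = g')
    {μ : C} (hμ : gr s μ) (hμ' : gr t μ) (X : C) : S.J e hμ X = S.J e' hμ' X := by
  subst h; rfl

theorem J₁_χ {g h k : G} (e : g * h = k) {ν₂ : C} (h₂ : gr 1 ν₂) (ν₁ : C) :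
    (S.J₁ g (S.mem_one h h₂) ((S.act h).obj ν₁)).hom ≫ (S.act g).map (S.J₁ h h₂ ν₁).hom ≫
        (S.χ e).hom.app (ν₁ ⊗ ν₂) =
      ((S.χ e).hom.app ν₁ ⊗ₘ (S.χ e).hom.app ν₂) ≫ (S.J₁ k h₂ ν₁).hom := by
  have hg : P.act₂ (P.act₁ h 1) g = g := by rw [P.act₁_one, P.one_act₂]
  rw [J₁, S.J_congr (P.act₁_one h).symm (P.one_act₂ g) hg _ (S.act_mem h h₂)]
  exact S.J_χ e e (P.one_act₂ h) hg (P.one_act₂ k) h₂ ν₁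

/-- An object of the component of degree `g = deg` of the crossed center: an object with a natural
family of isomorphisms `β_ν : obj ⊗ ν ≅ ^g ν ⊗ obj` for `ν` of degree `1` that is compatible with
tensor products. (The index `g` with the equation `deg = g` avoids transports.) -/
structure CenterObj where
  deg : G
  obj : C
  β : ∀ {g : G}, deg = g → ∀ {ν : C}, gr 1 ν → (obj ⊗ ν ≅ (S.act g).obj ν ⊗ obj)
  β_natural : ∀ {g : G} (e : deg = g) {ν ν' : C} (hν : gr 1 ν) (hν' : gr 1 ν') (f : ν ⟶ ν'),
    obj ◁ f ≫ (β e hν').hom = (β e hν).hom ≫ (S.act g).map f ▷ obj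
  β_tensor : ∀ {g : G} (e : deg = g) {ν₁ ν₂ : C} (h₁ : gr 1 ν₁) (h₂ : gr 1 ν₂)
    (h₁₂ : gr 1 (ν₁ ⊗ ν₂)),
    (β e h₁₂).hom = (α_ obj ν₁ ν₂).inv ≫ (β e h₁).hom ▷ ν₂ ≫
      (α_ ((S.act g).obj ν₁) obj ν₂).hom ≫ (S.act g).obj ν₁ ◁ (β e h₂).hom ≫
        (α_ ((S.act g).obj ν₁) ((S.act g).obj ν₂) obj).inv ≫ (S.J₁ g h₂ ν₁).hom ▷ obj

namespace CenterObj

variable {S}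

/-- The morphisms between homogeneous objects of the crossed center: those of `C` that are
compatible with the half-braidings for objects of the same degree, zero for different degrees. -/
def homSubgroup (X Y : S.CenterObj) : AddSubgroup (X.obj ⟶ Y.obj) where
  carrier := {f | (X.deg ≠ Y.deg → f = 0) ∧
    ∀ {g : G} (eX : X.deg = g) (eY : Y.deg = g) {ν : C} (hν : gr 1 ν),
      f ▷ ν ≫ (Y.β eY hν).hom = (X.β eX hν).hom ≫ (S.act g).obj ν ◁ f}
  add_mem' {f f'} hf hf' := by
    refine ⟨fun h => by rw [hf.1 h, hf'.1 h, add_zero], fun eX eY ν hν => ?_⟩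
    rw [MonoidalPreadditive.add_whiskerRight, MonoidalPreadditive.whiskerLeft_add,
      Preadditive.add_comp, Preadditive.comp_add, hf.2 eX eY hν, hf'.2 eX eY hν]
  zero_mem' := ⟨fun _ => rfl, fun _ _ _ _ => by simp⟩
  neg_mem' {f} hf := by
    refine ⟨fun h => by rw [hf.1 h, neg_zero], fun {g} eX eY ν hν => ?_⟩
    have h₁ : (-f) ▷ ν = -(f ▷ ν) := ((tensorRight ν).map_neg : _)
    have h₂ : (S.act g).obj ν ◁ (-f) = -((S.act g).obj ν ◁ f) :=
      ((tensorLeft ((S.act g).obj ν)).map_neg : _)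
    rw [h₁, h₂, Preadditive.neg_comp, Preadditive.comp_neg, hf.2 eX eY hν]

/-- The morphisms of the full subcategory of homogeneous objects of the crossed center. -/
@[ext] structure Hom (X Y : S.CenterObj) where
  hom : X.obj ⟶ Y.obj
  mem : hom ∈ homSubgroup X Y

instance : Category S.CenterObj where
  Hom := Hom
  id X := ⟨𝟙 X.obj, fun h => (h rfl).elim, fun _ _ _ _ => by simp⟩
  comp {X Y Z} f g := ⟨f.hom ≫ g.hom, by
    refine ⟨fun h => ?_, fun {a} eX eZ ν hν => ?_⟩
    · by_cases h₁ : X.deg = Y.deg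
      · rw [g.mem.1 (fun e => h (h₁.trans e)), comp_zero]
      · rw [f.mem.1 h₁, zero_comp]
    · by_cases h₁ : Y.deg = a
      · rw [comp_whiskerRight, Category.assoc, g.mem.2 h₁ eZ hν, ← Category.assoc,
          f.mem.2 eX h₁ hν, Category.assoc, whiskerLeft_comp]
      · rw [f.mem.1 (fun e => h₁ (e.symm.trans eX))]; simp⟩
  id_comp f := Hom.ext (Category.id_comp _)
  comp_id f := Hom.ext (Category.comp_id _)
  assoc f g h := Hom.ext (Category.assoc _ _ _)

@[ext] theorem hom_ext {X Y : S.CenterObj} {f g : X ⟶ Y} (h : f.hom = g.hom) : f = g := Hom.ext h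

@[simp] theorem id_hom (X : S.CenterObj) : Hom.hom (𝟙 X) = 𝟙 X.obj := rfl

@[simp] theorem comp_hom {X Y Z : S.CenterObj} (f : X ⟶ Y) (g : Y ⟶ Z) :
    Hom.hom (f ≫ g) = f.hom ≫ g.hom := rfl

instance (X Y : S.CenterObj) : AddCommGroup (X ⟶ Y) :=
  letI e : (X ⟶ Y) ≃ homSubgroup X Y := ⟨fun f => ⟨f.hom, f.mem⟩, fun f => ⟨f.1, f.2⟩,
    fun _ => rfl, fun _ => rfl⟩
  e.addCommGroup

@[simp] theorem add_hom {X Y : S.CenterObj} (f g : X ⟶ Y) :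
    Hom.hom (f + g) = f.hom + g.hom := rfl

@[simp] theorem zero_hom (X Y : S.CenterObj) : Hom.hom (0 : X ⟶ Y) = 0 := rfl

instance : Preadditive S.CenterObj where
  add_comp _ _ _ _ _ _ := hom_ext (Preadditive.add_comp _ _ _ _ _ _)
  comp_add _ _ _ _ _ _ := hom_ext (Preadditive.comp_add _ _ _ _ _ _)

section Linear

variable {k : Type*} [CommRing k] [Linear k C] [MonoidalLinear k C]

instance (X Y : S.CenterObj) : SMul k (X ⟶ Y) where
  smul r f := ⟨r • f.hom, by
    refine ⟨fun h => by rw [f.mem.1 h, smul_zero], fun eX eY ν hν => ?_⟩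
    rw [MonoidalLinear.smul_whiskerRight, MonoidalLinear.whiskerLeft_smul, Linear.smul_comp,
      Linear.comp_smul, f.mem.2 eX eY hν]⟩

@[simp] theorem smul_hom {X Y : S.CenterObj} (r : k) (f : X ⟶ Y) :
    Hom.hom (r • f) = r • f.hom := rfl

instance (X Y : S.CenterObj) : Module k (X ⟶ Y) :=
  Function.Injective.module k
    (⟨⟨Hom.hom, rfl⟩, fun _ _ => rfl⟩ : (X ⟶ Y) →+ (X.obj ⟶ Y.obj))
    (fun _ _ h => hom_ext h) (fun _ _ => rfl)

instance : Linear k S.CenterObj where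
  smul_comp _ _ _ _ _ _ := hom_ext (Linear.smul_comp _ _ _ _ _ _)
  comp_smul _ _ _ _ _ _ := hom_ext (Linear.comp_smul _ _ _ _ _ _)

end Linear

theorem tensor_aux {X Y A₁ A₂ B₁ B₂ C₁ C₂ D₁ D₂ : C}
    (y₁ : Y ⊗ A₁ ⟶ B₁ ⊗ Y) (y₂ : Y ⊗ A₂ ⟶ B₂ ⊗ Y) (x₁ : X ⊗ B₁ ⟶ C₁ ⊗ X) (x₂ : X ⊗ B₂ ⟶ C₂ ⊗ X)
    (c₁ : C₁ ⟶ D₁) (c₂ : C₂ ⟶ D₂) :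
    (α_ X Y (A₁ ⊗ A₂)).hom ≫ X ◁ ((α_ Y A₁ A₂).inv ≫ y₁ ▷ A₂ ≫ (α_ B₁ Y A₂).hom ≫ B₁ ◁ y₂ ≫
        (α_ B₁ B₂ Y).inv) ≫ (α_ X (B₁ ⊗ B₂) Y).inv ≫
      ((α_ X B₁ B₂).inv ≫ x₁ ▷ B₂ ≫ (α_ C₁ X B₂).hom ≫ C₁ ◁ x₂ ≫ (α_ C₁ C₂ X).inv) ▷ Y ≫
        (α_ (C₁ ⊗ C₂) X Y).hom ≫ (c₁ ⊗ₘ c₂) ▷ (X ⊗ Y) =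
    (α_ (X ⊗ Y) A₁ A₂).inv ≫
      ((α_ X Y A₁).hom ≫ X ◁ y₁ ≫ (α_ X B₁ Y).inv ≫ x₁ ▷ Y ≫ (α_ C₁ X Y).hom ≫ c₁ ▷ (X ⊗ Y)) ▷ A₂ ≫
      (α_ D₁ (X ⊗ Y) A₂).hom ≫
      D₁ ◁ ((α_ X Y A₂).hom ≫ X ◁ y₂ ≫ (α_ X B₂ Y).inv ≫ x₂ ▷ Y ≫ (α_ C₂ X Y).hom ≫
        c₂ ▷ (X ⊗ Y)) ≫ (α_ D₁ D₂ (X ⊗ Y)).inv := by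
  calc
    _ = 𝟙 _ ⊗≫ X ◁ y₁ ▷ A₂ ⊗≫ ((X ⊗ B₁) ◁ y₂ ≫ x₁ ▷ (B₂ ⊗ Y)) ⊗≫ C₁ ◁ x₂ ▷ Y ⊗≫
        c₁ ▷ (C₂ ⊗ X ⊗ Y) ⊗≫ D₁ ◁ c₂ ▷ (X ⊗ Y) ⊗≫ 𝟙 _ := by
      rw [MonoidalCategory.tensorHom_def]; monoidal
    _ = 𝟙 _ ⊗≫ X ◁ y₁ ▷ A₂ ⊗≫ x₁ ▷ (Y ⊗ A₂) ⊗≫ ((C₁ ◁ (X ◁ y₂ ⊗≫ x₂ ▷ Y ⊗≫ 𝟙 (C₂ ⊗ X ⊗ Y))) ≫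
        c₁ ▷ (C₂ ⊗ X ⊗ Y)) ⊗≫ D₁ ◁ c₂ ▷ (X ⊗ Y) ⊗≫ 𝟙 _ := by
      rw [whisker_exchange]; monoidal
    _ = _ := by
      rw [whisker_exchange]; monoidal

/-- The tensor product of homogeneous objects of the crossed center: the half-braiding is the
composite `X ⊗ Y ⊗ ν ≅ X ⊗ ^h ν ⊗ Y ≅ ^g (^h ν) ⊗ X ⊗ Y ≅ ^{gh} ν ⊗ X ⊗ Y`. -/
def tensor (X Y : S.CenterObj) : S.CenterObj where
  deg := X.deg * Y.deg
  obj := X.obj ⊗ Y.obj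
  β {g} e {ν} hν :=
    α_ X.obj Y.obj ν ≪≫ whiskerLeftIso X.obj (Y.β rfl hν) ≪≫
      (α_ X.obj ((S.act Y.deg).obj ν) Y.obj).symm ≪≫
      whiskerRightIso (X.β rfl (S.mem_one Y.deg hν)) Y.obj ≪≫
      α_ ((S.act X.deg).obj ((S.act Y.deg).obj ν)) X.obj Y.obj ≪≫
      whiskerRightIso ((S.χ e).app ν) (X.obj ⊗ Y.obj)
  β_natural {g} e {ν ν'} hν hν' f := by
    have h₁ := Y.β_natural rfl hν hν' f
    have h₂ := X.β_natural rfl (S.mem_one Y.deg hν) (S.mem_one Y.deg hν') ((S.act Y.deg).map f)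
    have h₃ := (S.χ e).hom.naturality f
    simp only [Functor.comp_map] at h₃
    simp only [Iso.trans_hom, whiskerLeftIso_hom, Iso.symm_hom, whiskerRightIso_hom, Iso.app_hom,
      Category.assoc]
    simp only [tensor_whiskerLeft, Category.assoc, Iso.inv_hom_id_assoc]
    rw [← whiskerLeft_comp_assoc, h₁, whiskerLeft_comp_assoc, ← comp_whiskerRight, ← h₃,
      comp_whiskerRight, associator_inv_naturality_middle_assoc, ← comp_whiskerRight_assoc, h₂,
      comp_whiskerRight_assoc, associator_naturality_left_assoc]
  β_tensor {g} e {ν₁ ν₂} k₁ k₂ k₁₂ := by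
    have h₀ : gr 1 ((S.act Y.deg).obj ν₁ ⊗ (S.act Y.deg).obj ν₂) := by
      simpa using S.grading.tensor (S.mem_one Y.deg k₁) (S.mem_one Y.deg k₂)
    have hβ := X.β_natural rfl h₀ (S.mem_one Y.deg k₁₂) (S.J₁ Y.deg k₂ ν₁).hom
    have hχ := S.J₁_χ e k₂ ν₁
    have h := tensor_aux (Y.β rfl k₁).hom (Y.β rfl k₂).hom (X.β rfl (S.mem_one Y.deg k₁)).hom
      (X.β rfl (S.mem_one Y.deg k₂)).hom ((S.χ e).hom.app ν₁) ((S.χ e).hom.app ν₂)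
    have h' := congrArg (· ≫ (S.J₁ g k₂ ν₁).hom ▷ (X.obj ⊗ Y.obj)) h
    simp only [Category.assoc] at h'
    simp only [Iso.trans_hom, whiskerLeftIso_hom, Iso.symm_hom, whiskerRightIso_hom, Iso.app_hom]
    refine Eq.trans ?_ h'
    rw [← comp_whiskerRight, ← hχ, Y.β_tensor rfl k₁ k₂ k₁₂]
    generalize X.β rfl (S.mem_one Y.deg k₁₂) = b at *
    rw [X.β_tensor rfl (S.mem_one Y.deg k₁) (S.mem_one Y.deg k₂) h₀] at hβ
    have h₃ : (α_ X.obj ((S.act Y.deg).obj ν₁ ⊗ (S.act Y.deg).obj ν₂) Y.obj).inv ≫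
        (X.obj ◁ (S.J₁ Y.deg k₂ ν₁).hom ≫ b.hom) ▷ Y.obj =
        X.obj ◁ (S.J₁ Y.deg k₂ ν₁).hom ▷ Y.obj ≫
          (α_ X.obj ((S.act Y.deg).obj (ν₁ ⊗ ν₂)) Y.obj).inv ≫ b.hom ▷ Y.obj := by
      simp
    simp only [whiskerLeft_comp, Category.assoc]
    rw [← reassoc_of% h₃, hβ]
    simp

theorem assoc_aux {X Y Z N A B B' D D' E F : C} (z : Z ⊗ N ⟶ A ⊗ Z) (y : Y ⊗ A ⟶ B ⊗ Y)
    (x : X ⊗ B ⟶ D ⊗ X) (x' : X ⊗ B' ⟶ D' ⊗ X) (c : B ⟶ B') (gc : D ⟶ D') (e : D' ⟶ F)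
    (p : D ⟶ E) (q : E ⟶ F) (hx : X ◁ c ≫ x' = x ≫ gc ▷ X) (hp : p ≫ q = gc ≫ e) :
    (α_ X Y Z).hom ▷ N ≫ (α_ X (Y ⊗ Z) N).hom ≫
      X ◁ ((α_ Y Z N).hom ≫ Y ◁ z ≫ (α_ Y A Z).inv ≫ y ▷ Z ≫ (α_ B Y Z).hom ≫ c ▷ (Y ⊗ Z)) ≫
      (α_ X B' (Y ⊗ Z)).inv ≫ x' ▷ (Y ⊗ Z) ≫ (α_ D' X (Y ⊗ Z)).hom ≫ e ▷ (X ⊗ (Y ⊗ Z)) =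
    ((α_ (X ⊗ Y) Z N).hom ≫ (X ⊗ Y) ◁ z ≫ (α_ (X ⊗ Y) A Z).inv ≫
      ((α_ X Y A).hom ≫ X ◁ y ≫ (α_ X B Y).inv ≫ x ▷ Y ≫ (α_ D X Y).hom ≫ p ▷ (X ⊗ Y)) ▷ Z ≫
      (α_ E (X ⊗ Y) Z).hom ≫ q ▷ ((X ⊗ Y) ⊗ Z)) ≫ F ◁ (α_ X Y Z).hom := by
  calc
    _ = 𝟙 _ ⊗≫ (X ⊗ Y) ◁ z ⊗≫ X ◁ y ▷ Z ⊗≫ (X ◁ c ≫ x') ▷ (Y ⊗ Z) ⊗≫ e ▷ (X ⊗ Y ⊗ Z) := by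
      monoidal
    _ = 𝟙 _ ⊗≫ (X ⊗ Y) ◁ z ⊗≫ X ◁ y ▷ Z ⊗≫ x ▷ (Y ⊗ Z) ⊗≫ (gc ≫ e) ▷ (X ⊗ Y ⊗ Z) := by
      rw [hx]; monoidal
    _ = _ := by
      rw [← hp]; monoidal

theorem tensorHom_aux {X X' Y Y' N A B D : C} (f : X ⟶ X') (f' : Y ⟶ Y') (y : Y ⊗ N ⟶ A ⊗ Y)
    (y' : Y' ⊗ N ⟶ A ⊗ Y') (x : X ⊗ A ⟶ B ⊗ X) (x' : X' ⊗ A ⟶ B ⊗ X') (c : B ⟶ D)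
    (hy : f' ▷ N ≫ y' = y ≫ A ◁ f') (hx : f ▷ A ≫ x' = x ≫ B ◁ f) :
    (f ⊗ₘ f') ▷ N ≫ (α_ X' Y' N).hom ≫ X' ◁ y' ≫ (α_ X' A Y').inv ≫ x' ▷ Y' ≫ (α_ B X' Y').hom ≫
        c ▷ (X' ⊗ Y') =
      ((α_ X Y N).hom ≫ X ◁ y ≫ (α_ X A Y).inv ≫ x ▷ Y ≫ (α_ B X Y).hom ≫ c ▷ (X ⊗ Y)) ≫
        D ◁ (f ⊗ₘ f') := by
  calc
    _ = 𝟙 _ ⊗≫ f ▷ (Y ⊗ N) ⊗≫ X' ◁ (f' ▷ N ≫ y') ⊗≫ x' ▷ Y' ⊗≫ c ▷ (X' ⊗ Y') := by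
      rw [MonoidalCategory.tensorHom_def]; monoidal
    _ = 𝟙 _ ⊗≫ (f ▷ (Y ⊗ N) ≫ X' ◁ (y ≫ A ◁ f')) ⊗≫ x' ▷ Y' ⊗≫ c ▷ (X' ⊗ Y') := by
      rw [hy]; monoidal
    _ = 𝟙 _ ⊗≫ X ◁ y ⊗≫ (f ▷ (A ⊗ Y) ≫ X' ◁ A ◁ f') ⊗≫ x' ▷ Y' ⊗≫ c ▷ (X' ⊗ Y') := by
      rw [whiskerLeft_comp, ← whisker_exchange_assoc]; monoidal
    _ = 𝟙 _ ⊗≫ X ◁ y ⊗≫ (f ▷ A) ▷ Y ⊗≫ ((X' ⊗ A) ◁ f' ≫ x' ▷ Y') ⊗≫ c ▷ (X' ⊗ Y') := by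
      monoidal
    _ = 𝟙 _ ⊗≫ X ◁ y ⊗≫ (f ▷ A ≫ x') ▷ Y ⊗≫ B ◁ X' ◁ f' ⊗≫ c ▷ (X' ⊗ Y') := by
      rw [whisker_exchange]; monoidal
    _ = 𝟙 _ ⊗≫ X ◁ y ⊗≫ x ▷ Y ⊗≫ (B ◁ (f ▷ Y ≫ X' ◁ f') ≫ c ▷ (X' ⊗ Y')) := by
      rw [hx]; monoidal
    _ = _ := by
      rw [← MonoidalCategory.tensorHom_def, whisker_exchange]
      generalize f ⊗ₘ f' = F
      monoidal

theorem leftUnitor_aux {X N A B : C} (x : X ⊗ N ⟶ A ⊗ X) (i : A ⟶ B) (c : B ⟶ A)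
    (h : i ≫ c = 𝟙 A) :
    (λ_ X).hom ▷ N ≫ x = ((α_ (𝟙_ C) X N).hom ≫ 𝟙_ C ◁ x ≫ (α_ (𝟙_ C) A X).inv ≫
      ((λ_ A).hom ≫ i ≫ (ρ_ B).inv) ▷ X ≫ (α_ B (𝟙_ C) X).hom ≫ c ▷ (𝟙_ C ⊗ X)) ≫
        A ◁ (λ_ X).hom := by
  calc
    _ = 𝟙 _ ⊗≫ x ⊗≫ (𝟙 A) ▷ X ⊗≫ 𝟙 _ := by monoidal
    _ = _ := by rw [← h]; monoidal

theorem rightUnitor_aux {X N A B D : C} (n : N ⟶ A) (x : X ⊗ N ⟶ B ⊗ X) (x' : X ⊗ A ⟶ D ⊗ X)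
    (m : B ⟶ D) (c : D ⟶ B) (hx : X ◁ n ≫ x' = x ≫ m ▷ X) (h : m ≫ c = 𝟙 B) :
    (ρ_ X).hom ▷ N ≫ x = ((α_ X (𝟙_ C) N).hom ≫ X ◁ ((λ_ N).hom ≫ n ≫ (ρ_ A).inv) ≫
      (α_ X A (𝟙_ C)).inv ≫ x' ▷ 𝟙_ C ≫ (α_ D X (𝟙_ C)).hom ≫ c ▷ (X ⊗ 𝟙_ C)) ≫
        B ◁ (ρ_ X).hom := by
  calc
    _ = 𝟙 _ ⊗≫ x ⊗≫ (𝟙 B) ▷ X ⊗≫ 𝟙 _ := by monoidal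
    _ = 𝟙 _ ⊗≫ (x ≫ m ▷ X) ⊗≫ c ▷ X ⊗≫ 𝟙 _ := by rw [← h]; monoidal
    _ = _ := by rw [← hx]; monoidal

/-- The unit of the crossed center. -/
def unit : S.CenterObj where
  deg := 1
  obj := 𝟙_ C
  β {g} e {ν} hν := λ_ ν ≪≫ (S.ι e.symm).app ν ≪≫ (ρ_ ((S.act g).obj ν)).symm
  β_natural {g} e {ν ν'} hν hν' f := by
    have := (S.ι e.symm).hom.naturality f
    simp only [Functor.id_map, Functor.id_obj] at this
    simp [← reassoc_of% this]
  β_tensor {g} e {ν₁ ν₂} k₁ k₂ k₁₂ := by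
    have := S.ι_J e.symm (P.one_act₂ g) k₂ ν₁
    simp only [Functor.id_obj] at this
    simp only [Iso.trans_hom, Iso.app_hom, Iso.symm_hom, ← this, J₁, MonoidalCategory.tensorHom_def]
    monoidal

@[simp] theorem tensor_β_hom (X Y : S.CenterObj) {g : G} (e : X.deg * Y.deg = g) {ν : C}
    (hν : gr 1 ν) : ((tensor X Y).β e hν).hom =
      (α_ X.obj Y.obj ν).hom ≫ X.obj ◁ (Y.β rfl hν).hom ≫
      (α_ X.obj ((S.act Y.deg).obj ν) Y.obj).inv ≫
      (X.β rfl (S.mem_one Y.deg hν)).hom ▷ Y.obj ≫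
      (α_ ((S.act X.deg).obj ((S.act Y.deg).obj ν)) X.obj Y.obj).hom ≫
      (S.χ e).hom.app ν ▷ (X.obj ⊗ Y.obj) := rfl

theorem tensor_β_hom' (X Y : S.CenterObj) {a b g : G} (ha : X.deg = a) (hb : Y.deg = b)
    (e : a * b = g) {ν : C} (hν : gr 1 ν) (e' : X.deg * Y.deg = g) :
    ((tensor X Y).β e' hν).hom =
      (α_ X.obj Y.obj ν).hom ≫ X.obj ◁ (Y.β hb hν).hom ≫
      (α_ X.obj ((S.act b).obj ν) Y.obj).inv ≫ (X.β ha (S.mem_one b hν)).hom ▷ Y.obj ≫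
      (α_ ((S.act a).obj ((S.act b).obj ν)) X.obj Y.obj).hom ≫
      (S.χ e).hom.app ν ▷ (X.obj ⊗ Y.obj) := by
  subst ha hb; rfl

@[simp] theorem unit_β_hom {g : G} (e : 1 = g) {ν : C} (hν : gr 1 ν) :
    ((unit : S.CenterObj).β e hν).hom =
      (λ_ ν).hom ≫ (S.ι e.symm).hom.app ν ≫ (ρ_ ((S.act g).obj ν)).inv := rfl

/-- Isomorphisms between homogeneous objects of the crossed center of the same degree. -/
def mkIso {X Y : S.CenterObj} (h : X.deg = Y.deg) (f : X.obj ≅ Y.obj)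
    (hf : ∀ {g : G} (eX : X.deg = g) (eY : Y.deg = g) {ν : C} (hν : gr 1 ν),
      f.hom ▷ ν ≫ (Y.β eY hν).hom = (X.β eX hν).hom ≫ (S.act g).obj ν ◁ f.hom) : X ≅ Y where
  hom := ⟨f.hom, fun h' => (h' h).elim, hf⟩
  inv := ⟨f.inv, fun h' => (h' h.symm).elim, fun {g} eX eY ν hν => by
    rw [← cancel_epi (f.hom ▷ ν), ← Category.assoc, ← comp_whiskerRight, Iso.hom_inv_id,
      id_whiskerRight, Category.id_comp, ← Category.assoc, hf eY eX hν, Category.assoc,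
      ← whiskerLeft_comp, Iso.hom_inv_id, whiskerLeft_id, Category.comp_id]⟩
  hom_inv_id := hom_ext f.hom_inv_id
  inv_hom_id := hom_ext f.inv_hom_id

@[simp] theorem mkIso_hom_hom {X Y : S.CenterObj} (h : X.deg = Y.deg) (f : X.obj ≅ Y.obj) (hf) :
    Hom.hom (mkIso h f hf).hom = f.hom := rfl

/-- The tensor product of morphisms. -/
def tensorHom {X X' Y Y' : S.CenterObj} (f : X ⟶ X') (f' : Y ⟶ Y') :
    tensor X Y ⟶ tensor X' Y' where
  hom := f.hom ⊗ₘ f'.hom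
  mem := by
    by_cases h : X.deg = X'.deg
    · by_cases h' : Y.deg = Y'.deg
      · refine ⟨fun h'' => (h'' (congrArg₂ (· * ·) h h')).elim, fun {g} e e' ν hν => ?_⟩
        rw [tensor_β_hom X' Y' e', tensor_β_hom' X Y h h' e' hν e]
        exact tensorHom_aux f.hom f'.hom (Y.β h' hν).hom (Y'.β rfl hν).hom
          (X.β h (S.mem_one _ hν)).hom (X'.β rfl (S.mem_one _ hν)).hom ((S.χ e').hom.app ν)
          (f'.mem.2 h' rfl hν) (f.mem.2 h rfl (S.mem_one _ hν))
      · rw [f'.mem.1 h', MonoidalPreadditive.tensor_zero]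
        exact zero_mem _
    · rw [f.mem.1 h, MonoidalPreadditive.zero_tensor]
      exact zero_mem _

@[simp] theorem tensorHom_hom {X X' Y Y' : S.CenterObj} (f : X ⟶ X') (f' : Y ⟶ Y') :
    (tensorHom f f').hom = f.hom ⊗ₘ f'.hom := rfl

/-- The associator. -/
def assoc (X Y Z : S.CenterObj) : tensor (tensor X Y) Z ≅ tensor X (tensor Y Z) :=
  mkIso (mul_assoc _ _ _) (α_ X.obj Y.obj Z.obj) fun {g} e e' ν hν => by
    have h := assoc_aux (Z.β rfl hν).hom (Y.β rfl (S.mem_one _ hν)).hom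
      (X.β rfl (S.mem_one _ (S.mem_one _ hν))).hom
      (X.β rfl (S.mem_one (Y.deg * Z.deg) hν)).hom _ _ ((S.χ e').hom.app ν)
      ((S.χ (rfl : X.deg * Y.deg = _)).hom.app ((S.act Z.deg).obj ν)) ((S.χ e).hom.app ν)
      (X.β_natural rfl _ _ ((S.χ (rfl : Y.deg * Z.deg = _)).hom.app ν))
      (S.χ_assoc rfl rfl e e' ν)
    exact h

/-- The left unitor. -/
def leftUnitor (X : S.CenterObj) : tensor unit X ≅ X :=
  mkIso (one_mul _) (λ_ X.obj) fun {g} e e' ν hν => by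
    subst e'
    exact leftUnitor_aux (X.β rfl hν).hom ((S.ι rfl).hom.app ((S.act X.deg).obj ν))
      ((S.χ e).hom.app ν) (S.ι_χ rfl e ν)

/-- The right unitor. -/
def rightUnitor (X : S.CenterObj) : tensor X unit ≅ X :=
  mkIso (mul_one _) (ρ_ X.obj) fun {g} e e' ν hν => by
    subst e'
    exact rightUnitor_aux ((S.ι rfl).hom.app ν) (X.β rfl hν).hom (X.β rfl (S.mem_one 1 hν)).hom
      ((S.act X.deg).map ((S.ι rfl).hom.app ν)) ((S.χ e).hom.app ν)
      (X.β_natural rfl hν (S.mem_one 1 hν) ((S.ι rfl).hom.app ν)) (S.χ_ι rfl e ν)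

/-- The monoidal structure on the homogeneous objects of the crossed center. -/
instance : MonoidalCategory S.CenterObj where
  tensorObj := tensor
  tensorHom := tensorHom
  whiskerLeft X _ _ f := tensorHom (𝟙 X) f
  whiskerRight f X := tensorHom f (𝟙 X)
  tensorUnit := unit
  associator := assoc
  leftUnitor := leftUnitor
  rightUnitor := rightUnitor
  id_tensorHom_id _ _ := hom_ext (id_tensorHom_id _ _)
  tensorHom_def f g := hom_ext (by
    change _ = (f.hom ⊗ₘ 𝟙 _) ≫ (𝟙 _ ⊗ₘ g.hom)
    rw [tensorHom_comp_tensorHom, Category.comp_id, Category.id_comp]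
    rfl)
  tensorHom_comp_tensorHom _ _ _ _ := hom_ext (tensorHom_comp_tensorHom _ _ _ _)
  whiskerLeft_id _ _ := hom_ext (id_tensorHom_id _ _)
  id_whiskerRight _ _ := hom_ext (id_tensorHom_id _ _)
  associator_naturality _ _ _ := hom_ext (associator_naturality _ _ _)
  leftUnitor_naturality f := hom_ext (by
    change (𝟙 _ ⊗ₘ f.hom) ≫ _ = _
    rw [id_tensorHom]
    exact leftUnitor_naturality _)
  rightUnitor_naturality f := hom_ext (by
    change (f.hom ⊗ₘ 𝟙 _) ≫ _ = _
    rw [tensorHom_id]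
    exact rightUnitor_naturality _)
  pentagon W X Y Z := hom_ext (by
    change ((α_ W.obj X.obj Y.obj).hom ⊗ₘ 𝟙 Z.obj) ≫
      (α_ W.obj (X.obj ⊗ Y.obj) Z.obj).hom ≫ (𝟙 W.obj ⊗ₘ (α_ X.obj Y.obj Z.obj).hom) =
      (α_ (W.obj ⊗ X.obj) Y.obj Z.obj).hom ≫ (α_ W.obj X.obj (Y.obj ⊗ Z.obj)).hom
    rw [tensorHom_id, id_tensorHom]
    exact MonoidalCategory.pentagon _ _ _ _)
  triangle X Y := hom_ext (by
    change (α_ X.obj (𝟙_ C) Y.obj).hom ≫ (𝟙 X.obj ⊗ₘ (λ_ Y.obj).hom) =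
      (ρ_ X.obj).hom ⊗ₘ 𝟙 Y.obj
    rw [tensorHom_id, id_tensorHom]
    exact MonoidalCategory.triangle _ _)

instance : MonoidalPreadditive S.CenterObj where
  whiskerLeft_zero := hom_ext (MonoidalPreadditive.tensor_zero _)
  zero_whiskerRight := hom_ext (MonoidalPreadditive.zero_tensor _)
  whiskerLeft_add _ _ := hom_ext (MonoidalPreadditive.tensor_add _ _ _)
  add_whiskerRight _ _ := hom_ext (MonoidalPreadditive.add_tensor _ _ _)

end CenterObj
end CrossedStructure
end

noncomputable section

universe v u w₁ w₂ w₃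

instance hasFiniteBiproducts_of_abelian (C : Type u) [Category.{v} C] [Abelian C] :
    HasFiniteBiproducts C := Abelian.hasFiniteBiproducts

/-- A `k`-linear abelian rigid monoidal category with bilinear tensor product is a tensor category
if it is locally finite (finite-dimensional morphism spaces, objects of finite length) and the
endomorphism space of the unit is one-dimensional. -/
class IsTensorCategory (k : Type w₃) [Field k] (C : Type u) [Category.{v} C] [Abelian C]
    [Linear k C] [MonoidalCategory C] [MonoidalPreadditive C] [MonoidalLinear k C]
    [RigidCategory C] : Prop where
  finite_hom : ∀ X Y : C, Module.Finite k (X ⟶ Y)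
  noetherian : ∀ X : C, IsNoetherianObject X
  artinian : ∀ X : C, IsArtinianObject X
  finrank_end_unit : Module.finrank k (𝟙_ C ⟶ 𝟙_ C) = 1

section Pivotal

variable {C : Type u} [Category.{v} C] [MonoidalCategory C] [RightRigidCategory C]

/-- The morphism into the dual `Xᘁ` (with `ε_ X Xᘁ : Xᘁ ⊗ X ⟶ 𝟙` and `η_ X Xᘁ : 𝟙 ⟶ X ⊗ Xᘁ`)
that corresponds to a pairing `Y ⊗ X ⟶ 𝟙`. -/
def dualMate {X Y : C} (p : Y ⊗ X ⟶ 𝟙_ C) : Y ⟶ Xᘁ :=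
  (ρ_ Y).inv ≫ Y ◁ η_ X Xᘁ ≫ (α_ Y X Xᘁ).inv ≫ p ▷ Xᘁ ≫ (λ_ Xᘁ).hom

/-- The canonical morphism `Yᘁ ⊗ Xᘁ ⟶ (X ⊗ Y)ᘁ`. -/
def dualTensor (X Y : C) : Yᘁ ⊗ Xᘁ ⟶ (X ⊗ Y)ᘁ :=
  dualMate (𝟙 _ ⊗≫ Yᘁ ◁ ε_ X Xᘁ ▷ Y ⊗≫ ε_ Y Yᘁ)

variable (C) in
/-- A pivotal structure: a monoidal natural isomorphism from the identity to the double dual.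
(Compatibility with the units is automatic.) -/
structure PivotalStructure where
  δ : ∀ X : C, X ≅ (Xᘁ)ᘁ
  natural : ∀ {X Y : C} (f : X ⟶ Y), f ≫ (δ Y).hom = (δ X).hom ≫ (fᘁ)ᘁ
  tensor : ∀ X Y : C, (δ (X ⊗ Y)).hom ≫ (dualTensor X Y)ᘁ =
    ((δ X).hom ⊗ₘ (δ Y).hom) ≫ dualTensor (Yᘁ) (Xᘁ)

/-- The dimension `ev_{Xᘁ} ∘ (δ_X ⊗ id) ∘ coev_X` of an object of a pivotal category, as an
endomorphism of the unit. -/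
def PivotalStructure.dim (p : PivotalStructure C) (X : C) : 𝟙_ C ⟶ 𝟙_ C :=
  η_ X Xᘁ ≫ (p.δ X).hom ▷ Xᘁ ≫ ε_ (Xᘁ) ((Xᘁ)ᘁ)

end Pivotal

variable {G : Type w₁} {Γ : Type w₂} [Group G] [Group Γ] {P : MatchedPair G Γ}
  {C : Type u} [Category.{v} C] [Preadditive C] [HasFiniteBiproducts C] [MonoidalCategory C]
  [MonoidalPreadditive C] {gr : Γ → ObjectProperty C}

/-- The dual of an object of degree `s` has degree `s⁻¹`. -/
theorem IsMonoidalGrading.mem_dual (hg : IsMonoidalGrading gr) {s : Γ} {X : C} [HasRightDual X]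
    (hX : gr s X) : gr s⁻¹ Xᘁ := by
  obtain ⟨n, d, Y, hY, ⟨i⟩⟩ := hg.decomposition Xᘁ
  refine hg.of_iso i.symm (hg.biproduct Y fun a => ?_)
  by_cases h : d a = s⁻¹
  · rw [← h]; exact hY a
  · have h₁ : ((biproduct.ι Y a ≫ i.inv) ▷ X ≫ ε_ X Xᘁ) = 0 :=
      hg.hom_eq_zero (fun e => h (eq_inv_of_mul_eq_one_left e)) (hg.tensor (hY a) hX) hg.unit _
    have h₂ : biproduct.ι Y a ≫ i.inv = 0 := by
      calc biproduct.ι Y a ≫ i.inv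
          = (biproduct.ι Y a ≫ i.inv) ≫ (ρ_ Xᘁ).inv ≫ (Xᘁ ◁ η_ X Xᘁ ≫ (α_ _ _ _).inv ≫
              ε_ X Xᘁ ▷ Xᘁ) ≫ (λ_ Xᘁ).hom := by
            rw [ExactPairing.coevaluation_evaluation]; simp
        _ = (ρ_ _).inv ≫ Y a ◁ η_ X Xᘁ ≫ (α_ _ _ _).inv ≫
              ((biproduct.ι Y a ≫ i.inv) ▷ X ≫ ε_ X Xᘁ) ▷ Xᘁ ≫ (λ_ Xᘁ).hom := by
            generalize biproduct.ι Y a ≫ i.inv = j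
            rw [comp_whiskerRight_assoc, ← associator_inv_naturality_left_assoc,
              whisker_exchange_assoc]
            simp
        _ = 0 := by rw [h₁]; simp
    have h₃ : IsZero (Y a) := by
      rw [IsZero.iff_id_eq_zero]
      calc 𝟙 (Y a) = (biproduct.ι Y a ≫ i.inv) ≫ i.hom ≫ biproduct.π Y a := by simp
        _ = 0 := by rw [h₂, zero_comp]
    have h₄ : IsZero (⨁ (Fin.elim0 : Fin 0 → C)) := by
      rw [IsZero.iff_id_eq_zero]
      exact biproduct.hom_ext _ _ fun j => j.elim0
    exact hg.of_iso (h₄.iso h₃) (hg.biproduct _ fun j => j.elim0)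

namespace CrossedStructure

variable (S : CrossedStructure P gr)

/-- The crossed center: the direct sum over `g : G` of its components of degree `g`, realized as the
category of formal finite direct sums of homogeneous objects. -/
abbrev Center := Mat_ S.CenterObj

/-- The homogeneous objects of degree `(g, s)` of the crossed center: up to isomorphism, those of
the component of degree `g` whose underlying object has degree `s`. -/
def centerGrading : G × Γ → ObjectProperty S.Center := fun x M =>
  ∃ X : S.CenterObj, X.deg = x.1 ∧ gr x.2 X.obj ∧ Nonempty (M ≅ (Mat_.embedding S.CenterObj).obj X)

variable [RightRigidCategory C]

/-- The canonical identification `^{s ▷₂ g} (μᘁ) ⟶ (^g μ)ᘁ` for `μ` of degree `s`. -/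
def dualAct {g g' : G} {s : Γ} (e : P.act₂ s g = g') {μ : C} (hμ : gr s μ) :
    (S.act g').obj (μᘁ) ⟶ ((S.act g).obj μ)ᘁ :=
  dualMate ((S.J e hμ μᘁ).hom ≫ (S.act g).map (ε_ μ μᘁ) ≫ (S.φ g).inv)

/-- The crossed structure is pivotal if `^g δ_μ = δ_{^g μ}` under the canonical identification
`^g (μᘁᘁ) = (^{s ▷₂ g} (μᘁ))ᘁ = (^g μ)ᘁᘁ`, for `μ` of degree `s`. -/
def IsPivotal (p : PivotalStructure C) : Prop :=
  ∀ {g g' : G} {s : Γ} (e : P.act₂ s g = g') (e' : P.act₂ s⁻¹ g' = g) {μ : C} (hμ : gr s μ)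
    (hμ' : gr s⁻¹ μᘁ),
    (S.act g).map (p.δ μ).hom ≫ S.dualAct e' hμ' = (p.δ ((S.act g).obj μ)).hom ≫ (S.dualAct e hμ)ᘁ

variable (p : PivotalStructure C)

/-- The pairing `^h μ ⊗ ^{s ▷₂ h} (μᘁ) ⟶ 𝟙` given by the pivotal structure and the evaluation. -/
def cap {h h' : G} {s : Γ} (e : P.act₂ s h = h') {μ : C} (hμ : gr s μ) :
    (S.act h).obj μ ⊗ (S.act h').obj μᘁ ⟶ 𝟙_ C :=
  ((p.δ ((S.act h).obj μ)).hom ⊗ₘ S.dualAct e hμ) ≫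
    ε_ (((S.act h).obj μ)ᘁ) ((((S.act h).obj μ)ᘁ)ᘁ)

/-- The object `^h μ ⊗ X ⊗ μᘁ`. -/
abbrev conj (h : G) (μ X : C) : C := ((S.act h).obj μ ⊗ X) ⊗ μᘁ

/-- The endomorphism `(ev ⊗ id) ∘ (δ ⊗ h^X_{μᘁ μ} ⊗ id) ∘ (id ⊗ coev)` of `^h μ ⊗ X ⊗ μᘁ` for
`X` of degree `h` in the crossed center and `μ` of degree `s`; it is `dim μ` times the idempotent
`e^μ_X`. -/
def idem (X : S.CenterObj) {h h' : G} (eX : X.deg = h) {s : Γ} (e : P.act₂ s h = h') {μ : C}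
    (hμ : gr s μ) : S.conj h μ X.obj ⟶ S.conj h μ X.obj :=
  have hμμ : gr 1 (μᘁ ⊗ μ) := by simpa using S.grading.tensor (S.grading.mem_dual hμ) hμ
  (ρ_ _).inv ≫ S.conj h μ X.obj ◁ η_ μ μᘁ ⊗≫
    (S.act h).obj μ ◁ ((X.β eX hμμ).hom ≫ (S.J e hμ μᘁ).inv ▷ X.obj) ▷ μᘁ ⊗≫
    S.cap p e hμ ▷ S.conj h μ X.obj ≫ (λ_ _).hom

/-- The morphism `(ev ⊗ id) ∘ (δ ⊗ h^X_{μᘁ ν μ} ⊗ id) ∘ (id ⊗ coev)` from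
`(^h μ ⊗ X ⊗ μᘁ) ⊗ ν` to `^{s ▷₂ h} ν ⊗ (^h μ ⊗ X ⊗ μᘁ)` for `ν` of degree `1`. -/
def crossing (X : S.CenterObj) {h h' : G} (eX : X.deg = h) {s : Γ} (e : P.act₂ s h = h') {μ : C}
    (hμ : gr s μ) {ν : C} (hν : gr 1 ν) :
    S.conj h μ X.obj ⊗ ν ⟶ (S.act h').obj ν ⊗ S.conj h μ X.obj :=
  have hμν : gr 1 ((μᘁ ⊗ ν) ⊗ μ) := by
    simpa using S.grading.tensor (S.grading.tensor (S.grading.mem_dual hμ) hν) hμ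
  (ρ_ _).inv ≫ (S.conj h μ X.obj ⊗ ν) ◁ η_ μ μᘁ ⊗≫
    (S.act h).obj μ ◁ ((X.β eX hμν).hom ≫
      ((S.J e hμ (μᘁ ⊗ ν)).inv ≫ (S.J₁ h' hν μᘁ).inv ▷ (S.act h).obj μ) ▷ X.obj) ▷ μᘁ ⊗≫
    S.cap p e hμ ▷ ((S.act h').obj ν ⊗ S.conj h μ X.obj) ≫ (λ_ _).hom

/-- The object `γ_μ(X) = (E, h^E)` of the crossed center for `X` of degree `h` and `μ` of degree `s`
and dimension `d`: a retract of the idempotent `e^μ_X` together with the induced half-braiding. -/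
structure ConjRetract {k : Type w₃} [Field k] [Linear k C] (d : k) (X : S.CenterObj) {h : G}
    (eX : X.deg = h) {s : Γ} {μ : C} (hμ : gr s μ) where
  E : S.CenterObj
  deg_eq : E.deg = P.act₂ s h
  incl : E.obj ⟶ S.conj h μ X.obj
  retr : S.conj h μ X.obj ⟶ E.obj
  incl_retr : incl ≫ retr = 𝟙 E.obj
  retr_incl : retr ≫ incl = d⁻¹ • S.idem p X eX rfl hμ
  β_eq : ∀ {ν : C} (hν : gr 1 ν), (E.β deg_eq hν).hom =
    d⁻¹ • (incl ▷ ν ≫ S.crossing p X eX rfl hμ hν ≫ (S.act (P.act₂ s h)).obj ν ◁ retr)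

/-- The crossed structure `T` on the crossed center is the one built from the family `ζ` of objects
`ζ s` of degree `s` and dimension `d s`: on each component of degree `h`, the functor `T.act s` is
`X ↦ γ_{ζ s}(X)` on objects and `f ↦ r ∘ (id ⊗ f ⊗ id) ∘ i` on morphisms, where `i` and `r` are the
inclusion and the retraction. -/
structure IsBuiltFrom {k : Type w₃} [Field k] [Linear k C] {ζ : Γ → C} (hζ : ∀ s, gr s (ζ s))
    (d : Γ → k) (T : CrossedStructure P.center S.centerGrading) where
  R : ∀ (s : Γ) (X : S.CenterObj) {h : G} (eX : X.deg = h), S.ConjRetract p (d s) X eX (hζ s)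
  θ : ∀ (s : Γ) (X : S.CenterObj) {h : G} (eX : X.deg = h),
    (T.act s).obj ((Mat_.embedding S.CenterObj).obj X) ≅
      (Mat_.embedding S.CenterObj).obj (R s X eX).E
  map : ∀ (s : Γ) {X Y : S.CenterObj} {h : G} (eX : X.deg = h) (eY : Y.deg = h) (f : X ⟶ Y),
    ∃ f' : (R s X eX).E ⟶ (R s Y eY).E,
      f'.hom = (R s X eX).incl ≫ ((S.act h).obj (ζ s) ◁ f.hom) ▷ (ζ s)ᘁ ≫ (R s Y eY).retr ∧
      (T.act s).map ((Mat_.embedding S.CenterObj).map f) ≫ (θ s Y eY).hom =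
        (θ s X eX).hom ≫ (Mat_.embedding S.CenterObj).map f'

end CrossedStructure
end

end CrossedCat

/-! The value of the action of s at an object X of Z_h is determined by a universal property. An
arrow over s from Y to X (`Arr`) is a natural family Y ⊗ μ ⟶ ^h μ ⊗ X, for μ of degree s, that is
compatible with the half-braiding of Y for factors on the left of μ and with that of X for factors
on its right. The half-braiding of X is itself an arrow over 1. Arrows over s and t compose to an
arrow over st by gluing crossings side by side, and arrows have tensor products by stacking
crossings.

Nonzero dimensions enter only through a `Splitting`: objects M of degree s and M' of degree s⁻¹ such
that the unit is a retract of M ⊗ M'. No zigzag identity between M and M' is needed. Tensoring with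
M is then faithful and reflects isomorphisms. Moreover every ρ of degree st is a retract of M ⊗ (M'
⊗ ρ), a product of objects of degrees s and t. Hence a composite, which J prescribes on products
only, extends to all objects of degree st (`compApp_tensor`), and arrows may be compared on products
(`ext_tensor`).

Every arrow over s into X factors uniquely through any invertible one (`exists_lift`,
`lift_unique`). A choice of invertible arrows into all X (`Cleavage`) therefore defines the functors
of the action, and χ, ι, J and φ are the factorizations of composites, identities, tensor products
and unit arrows. Each coherence law reduces to an identity of arrows (`comp_assoc`, `comp_tensor`,
`tensor_assoc` and so on), which in turn reduces to the coherence of the crossed structure of C.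

Invertible arrows exist because M' ⊗ μ has degree 1, so that the half-braiding of X gives ^h M ⊗ X ⊗
M' ⊗ μ ≅ ^h (M ⊗ M' ⊗ μ) ⊗ X. Under this isomorphism the projector of M ⊗ M' ⊗ μ onto μ comes from a
single idempotent on ^h M ⊗ X ⊗ M' (`conjIdem_conjPush`), and its image E satisfies E ⊗ μ ≅ ^h μ ⊗
X. For M = ζ_s, M' its dual and the evaluation divided by d_s, the compatibility of δ with the
action identifies this idempotent and the half-braiding of E with the formulas of the statement
(`idem_eq`, `crossing_eq`).

Finally, the data pass entrywise from homogeneous objects to formal direct sums. Half-braidings with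
objects of degree 1 do not mix the Γ-components of an object, which yields the grading
(`CenterObj.exists_components`). -/

namespace CrossedCat

/-! ### Calculus of crossings: gluing and stacking. -/

section Gluing

universe v u
variable {C : Type u} [Category.{v} C] [MonoidalCategory C]

/-- The composite `Z ⊗ N ⊗ M ⟶ N' ⊗ Y ⊗ M ⟶ N' ⊗ M' ⊗ X ⟶ K ⊗ X` of two crossings. -/
def glue {X Y Z N M N' M' K : C} (v : Z ⊗ N ⟶ N' ⊗ Y) (u : Y ⊗ M ⟶ M' ⊗ X) (j : N' ⊗ M' ⟶ K) :
    Z ⊗ (N ⊗ M) ⟶ K ⊗ X :=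
  (α_ Z N M).inv ≫ v ▷ M ≫ (α_ N' Y M).hom ≫ N' ◁ u ≫ (α_ N' M' X).inv ≫ j ▷ X

/-- The composite `Y ⊗ Y' ⊗ M ⟶ Y ⊗ M' ⊗ X' ⟶ M'' ⊗ X ⊗ X' ⟶ K ⊗ X ⊗ X'` of two crossings. -/
def stack {X X' Y Y' M M' M'' K : C} (u : Y ⊗ M' ⟶ M'' ⊗ X) (u' : Y' ⊗ M ⟶ M' ⊗ X')
    (c : M'' ⟶ K) : (Y ⊗ Y') ⊗ M ⟶ K ⊗ (X ⊗ X') :=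
  (α_ Y Y' M).hom ≫ Y ◁ u' ≫ (α_ Y M' X').inv ≫ u ▷ X' ≫ (α_ M'' X X').hom ≫ c ▷ (X ⊗ X')

/-- The interchange law lets n and m slide through the two crossings one at a time; `hj` is the
shape of the naturality of J. -/
theorem glue_naturality {X Y Z N₁ M₁ N₁' M₁' K₁ N₂ M₂ N₂' M₂' K₂ : C}
    {v₁ : Z ⊗ N₁ ⟶ N₁' ⊗ Y} {u₁ : Y ⊗ M₁ ⟶ M₁' ⊗ X} {j₁ : N₁' ⊗ M₁' ⟶ K₁}
    {v₂ : Z ⊗ N₂ ⟶ N₂' ⊗ Y} {u₂ : Y ⊗ M₂ ⟶ M₂' ⊗ X} {j₂ : N₂' ⊗ M₂' ⟶ K₂}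
    {n : N₁ ⟶ N₂} {m : M₁ ⟶ M₂} {n' : N₁' ⟶ N₂'} {m' : M₁' ⟶ M₂'} {k : K₁ ⟶ K₂}
    (hv : Z ◁ n ≫ v₂ = v₁ ≫ n' ▷ Y) (hu : Y ◁ m ≫ u₂ = u₁ ≫ m' ▷ X)
    (hj : (n' ⊗ₘ m') ≫ j₂ = j₁ ≫ k) :
    Z ◁ (n ⊗ₘ m) ≫ glue v₂ u₂ j₂ = glue v₁ u₁ j₁ ≫ k ▷ X := by
  unfold glue
  calc
    _ = 𝟙 _ ⊗≫ (Z ◁ n ▷ M₁) ⊗≫ ((Z ⊗ N₂) ◁ m ≫ v₂ ▷ M₂) ⊗≫ N₂' ◁ u₂ ⊗≫ j₂ ▷ X := by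
      rw [MonoidalCategory.tensorHom_def]; monoidal
    _ = 𝟙 _ ⊗≫ (Z ◁ n ≫ v₂) ▷ M₁ ⊗≫ N₂' ◁ (Y ◁ m ≫ u₂) ⊗≫ j₂ ▷ X := by
      rw [whisker_exchange]; monoidal
    _ = 𝟙 _ ⊗≫ v₁ ▷ M₁ ⊗≫ (n' ▷ (Y ⊗ M₁) ≫ N₂' ◁ u₁) ⊗≫ (N₂' ◁ m' ≫ j₂) ▷ X := by
      rw [hv, hu]; monoidal
    _ = 𝟙 _ ⊗≫ v₁ ▷ M₁ ⊗≫ N₁' ◁ u₁ ⊗≫ ((n' ⊗ₘ m') ≫ j₂) ▷ X := by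
      rw [← whisker_exchange, MonoidalCategory.tensorHom_def]; monoidal
    _ = _ := by rw [hj]; monoidal

/-- Three crossings in a row can be bracketed in either way up to the merging maps. The hypothesis
`h` on these maps is exactly the coherence of J with the associator, see `J_assoc'`. -/
theorem glue_assoc {X Y Z W L N M L' N' M' A A' B B' : C} (w : W ⊗ L ⟶ L' ⊗ Z)
    (v : Z ⊗ N ⟶ N' ⊗ Y) (u : Y ⊗ M ⟶ M' ⊗ X) {j₁ : L' ⊗ N' ⟶ A} {j₂ : A ⊗ M' ⟶ B}
    {j₃ : N' ⊗ M' ⟶ A'} {j₄ : L' ⊗ A' ⟶ B'} {a : B ⟶ B'}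
    (h : j₁ ▷ M' ≫ j₂ ≫ a = (α_ L' N' M').hom ≫ L' ◁ j₃ ≫ j₄) :
    W ◁ (α_ L N M).hom ≫ glue w (glue v u j₃) j₄ = glue (glue w v j₁) u j₂ ≫ a ▷ X := by
  unfold glue
  calc
    _ = 𝟙 _ ⊗≫ w ▷ (N ⊗ M) ⊗≫ L' ◁ v ▷ M ⊗≫ L' ◁ N' ◁ u ⊗≫
        ((α_ L' N' M').hom ≫ L' ◁ j₃ ≫ j₄) ▷ X := by monoidal
    _ = 𝟙 _ ⊗≫ w ▷ (N ⊗ M) ⊗≫ L' ◁ v ▷ M ⊗≫ ((L' ⊗ N') ◁ u ≫ j₁ ▷ (M' ⊗ X)) ⊗≫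
        (j₂ ≫ a) ▷ X := by rw [← h]; monoidal
    _ = _ := by rw [whisker_exchange]; monoidal

theorem glue_comp_left {X Y Z Z' N M N' M' K : C} (f : Z' ⟶ Z) (v : Z ⊗ N ⟶ N' ⊗ Y)
    (u : Y ⊗ M ⟶ M' ⊗ X) (j : N' ⊗ M' ⟶ K) :
    glue (f ▷ N ≫ v) u j = f ▷ (N ⊗ M) ≫ glue v u j := by
  unfold glue; monoidal

theorem glue_comp_mid {X Y Y' Z N M N' M' K : C} (f : Y ⟶ Y') (v : Z ⊗ N ⟶ N' ⊗ Y)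
    (u : Y' ⊗ M ⟶ M' ⊗ X) (j : N' ⊗ M' ⟶ K) :
    glue (v ≫ N' ◁ f) u j = glue v (f ▷ M ≫ u) j := by
  unfold glue; monoidal

theorem glue_comp_right {X X' Y Z N M N' M' K : C} (f : X ⟶ X') (v : Z ⊗ N ⟶ N' ⊗ Y)
    (u : Y ⊗ M ⟶ M' ⊗ X) (j : N' ⊗ M' ⟶ K) :
    glue v (u ≫ M' ◁ f) j = glue v u j ≫ K ◁ f := by
  unfold glue
  calc
    _ = 𝟙 _ ⊗≫ v ▷ M ⊗≫ N' ◁ u ⊗≫ ((N' ⊗ M') ◁ f ≫ j ▷ X') := by monoidal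
    _ = _ := by rw [whisker_exchange]; monoidal

theorem glue_isIso {X Y Z N M N' M' K : C} (v : Z ⊗ N ⟶ N' ⊗ Y) (u : Y ⊗ M ⟶ M' ⊗ X)
    (j : N' ⊗ M' ⟶ K) [IsIso v] [IsIso u] [IsIso j] : IsIso (glue v u j) := by
  unfold glue; infer_instance

/-- Gluing and stacking commute. -/
theorem stack_glue {X Y Z X' Y' Z' N M N₁ M₁ N₂ M₂ N₃ M₃ A B D K : C}
    (v : Z ⊗ N₁ ⟶ N₂ ⊗ Y) (u : Y ⊗ M₁ ⟶ M₂ ⊗ X) (v' : Z' ⊗ N ⟶ N₁ ⊗ Y') (u' : Y' ⊗ M ⟶ M₁ ⊗ X')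
    {j' : N₁ ⊗ M₁ ⟶ A} {j : N₂ ⊗ M₂ ⟶ B} {w : Z ⊗ A ⟶ D ⊗ X} {b : B ⟶ D} {c : D ⟶ K}
    {n : N₂ ⟶ N₃} {m : M₂ ⟶ M₃} {j'' : N₃ ⊗ M₃ ⟶ K}
    (hw : Z ◁ j' ≫ w = glue v u j ≫ b ▷ X) (h : (n ⊗ₘ m) ≫ j'' = j ≫ b ≫ c) :
    stack w (glue v' u' j') c = glue (stack v v' n) (stack u u' m) j'' := by
  unfold stack
  unfold glue at hw ⊢
  calc
    _ = 𝟙 _ ⊗≫ Z ◁ v' ▷ M ⊗≫ Z ◁ N₁ ◁ u' ⊗≫ (Z ◁ j' ≫ w) ▷ X' ⊗≫ c ▷ (X ⊗ X') := by monoidal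
    -- `hw` cuts the outer crossing w into v and u. After that u' and v act on disjoint strands and
    -- can be exchanged.
    _ = 𝟙 _ ⊗≫ Z ◁ v' ▷ M ⊗≫ ((Z ⊗ N₁) ◁ u' ≫ v ▷ (M₁ ⊗ X')) ⊗≫ N₂ ◁ u ▷ X' ⊗≫
        (j ≫ b ≫ c) ▷ (X ⊗ X') := by rw [hw]; monoidal
    _ = 𝟙 _ ⊗≫ Z ◁ v' ▷ M ⊗≫ v ▷ (Y' ⊗ M) ⊗≫ (N₂ ◁ (Y ◁ u' ⊗≫ u ▷ X' ⊗≫ m ▷ (X ⊗ X')) ≫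
        n ▷ (M₃ ⊗ (X ⊗ X'))) ⊗≫ j'' ▷ (X ⊗ X') := by
      rw [whisker_exchange, ← h, tensorHom_def']; monoidal
    _ = _ := by rw [whisker_exchange]; monoidal

theorem stack_comp_left {X X' Y Y' Z Z' M M' M'' K : C} (f : Z ⟶ Y) (f' : Z' ⟶ Y')
    (u : Y ⊗ M' ⟶ M'' ⊗ X) (u' : Y' ⊗ M ⟶ M' ⊗ X') (c : M'' ⟶ K) :
    stack (f ▷ M' ≫ u) (f' ▷ M ≫ u') c = (f ⊗ₘ f') ▷ M ≫ stack u u' c := by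
  unfold stack
  calc
    _ = 𝟙 _ ⊗≫ Z ◁ (f' ▷ M ≫ u') ⊗≫ f ▷ (M' ⊗ X') ⊗≫ u ▷ X' ⊗≫ c ▷ (X ⊗ X') := by monoidal
    _ = 𝟙 _ ⊗≫ (Z ◁ (f' ▷ M ≫ u') ≫ f ▷ (M' ⊗ X')) ⊗≫ u ▷ X' ⊗≫ c ▷ (X ⊗ X') := by monoidal
    _ = _ := by rw [whisker_exchange, MonoidalCategory.tensorHom_def]; monoidal

theorem stack_comp_right {X X' Y Y' Z Z' M M' M'' K : C} (f : X ⟶ Z) (f' : X' ⟶ Z')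
    (u : Y ⊗ M' ⟶ M'' ⊗ X) (u' : Y' ⊗ M ⟶ M' ⊗ X') (c : M'' ⟶ K) :
    stack (u ≫ M'' ◁ f) (u' ≫ M' ◁ f') c = stack u u' c ≫ K ◁ (f ⊗ₘ f') := by
  unfold stack
  calc
    _ = 𝟙 _ ⊗≫ Y ◁ u' ⊗≫ ((Y ⊗ M') ◁ f' ≫ u ▷ Z') ⊗≫ M'' ◁ f ▷ Z' ⊗≫ c ▷ (Z ⊗ Z') := by monoidal
    _ = 𝟙 _ ⊗≫ Y ◁ u' ⊗≫ u ▷ X' ⊗≫ (M'' ◁ (X ◁ f' ≫ f ▷ Z') ≫ c ▷ (Z ⊗ Z')) := by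
      rw [whisker_exchange]; monoidal
    _ = _ := by
      rw [← tensorHom_def' f f', whisker_exchange]
      generalize f ⊗ₘ f' = F
      monoidal

theorem stack_isIso {X X' Y Y' M M' M'' K : C} (u : Y ⊗ M' ⟶ M'' ⊗ X) (u' : Y' ⊗ M ⟶ M' ⊗ X')
    (c : M'' ⟶ K) [IsIso u] [IsIso u'] [IsIso c] : IsIso (stack u u' c) := by
  unfold stack; infer_instance

/-- The two hypotheses are the naturality of the outermost crossing at a component of χ and the
associativity of χ. -/
theorem stack_assoc {X₁ X₂ X₃ Y₁ Y₂ Y₃ N A B B' D D' E F : C} (z : Y₃ ⊗ N ⟶ A ⊗ X₃)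
    (y : Y₂ ⊗ A ⟶ B ⊗ X₂) {x : Y₁ ⊗ B ⟶ D ⊗ X₁} {x' : Y₁ ⊗ B' ⟶ D' ⊗ X₁} {c : B ⟶ B'}
    {gc : D ⟶ D'} {e : D' ⟶ F} {p : D ⟶ E} {q : E ⟶ F} (hx : Y₁ ◁ c ≫ x' = x ≫ gc ▷ X₁)
    (hp : p ≫ q = gc ≫ e) :
    (α_ Y₁ Y₂ Y₃).hom ▷ N ≫ stack x' (stack y z c) e =
      stack (stack x y p) z q ≫ F ◁ (α_ X₁ X₂ X₃).hom := by
  unfold stack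
  calc
    _ = 𝟙 _ ⊗≫ (Y₁ ⊗ Y₂) ◁ z ⊗≫ Y₁ ◁ y ▷ X₃ ⊗≫ (Y₁ ◁ c ≫ x') ▷ (X₂ ⊗ X₃) ⊗≫
        e ▷ (X₁ ⊗ X₂ ⊗ X₃) := by monoidal
    _ = 𝟙 _ ⊗≫ (Y₁ ⊗ Y₂) ◁ z ⊗≫ Y₁ ◁ y ▷ X₃ ⊗≫ x ▷ (X₂ ⊗ X₃) ⊗≫
        (gc ≫ e) ▷ (X₁ ⊗ X₂ ⊗ X₃) := by rw [hx]; monoidal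
    _ = _ := by rw [← hp]; monoidal

theorem stack_unit_left {X Y N A B : C} (x : Y ⊗ N ⟶ A ⊗ X) {i : A ⟶ B} {c : B ⟶ A}
    (h : i ≫ c = 𝟙 A) :
    (λ_ Y).hom ▷ N ≫ x =
      stack ((λ_ A).hom ≫ i ≫ (ρ_ B).inv) x c ≫ A ◁ (λ_ X).hom := by
  unfold stack
  calc
    _ = 𝟙 _ ⊗≫ x ⊗≫ (𝟙 A) ▷ X ⊗≫ 𝟙 _ := by monoidal
    _ = _ := by rw [← h]; monoidal

theorem stack_unit_right {X Y N A B D : C} {n : N ⟶ A} {x : Y ⊗ N ⟶ B ⊗ X} {x' : Y ⊗ A ⟶ D ⊗ X}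
    {m : B ⟶ D} {c : D ⟶ B} (hx : Y ◁ n ≫ x' = x ≫ m ▷ X) (h : m ≫ c = 𝟙 B) :
    (ρ_ Y).hom ▷ N ≫ x =
      stack x' ((λ_ N).hom ≫ n ≫ (ρ_ A).inv) c ≫ B ◁ (ρ_ X).hom := by
  unfold stack
  calc
    _ = 𝟙 _ ⊗≫ x ⊗≫ (𝟙 B) ▷ X ⊗≫ 𝟙 _ := by monoidal
    _ = 𝟙 _ ⊗≫ (x ≫ m ▷ X) ⊗≫ c ▷ X ⊗≫ 𝟙 _ := by rw [← h]; monoidal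
    _ = _ := by rw [← hx]; monoidal

/-! ### The unit as a retract of a tensor product. -/

theorem whiskerLeft_cancel {X A B D : C} {f : A ⟶ B} {g : B ⟶ A} (h : g ≫ f = 𝟙 B)
    {a b : X ⊗ B ⟶ D} (e : X ◁ f ≫ a = X ◁ f ≫ b) : a = b := by
  have := congrArg (X ◁ g ≫ ·) e
  simpa only [← whiskerLeft_comp_assoc, h, whiskerLeft_id, Category.id_comp] using this

/-- Insertion of `A ⊗ B` on the left of an object. -/
def ins {A B : C} (co : 𝟙_ C ⟶ A ⊗ B) (R : C) : R ⟶ A ⊗ (B ⊗ R) :=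
  (λ_ R).inv ≫ co ▷ R ≫ (α_ A B R).hom

/-- Contraction of `A ⊗ B` on the left of an object. -/
def con {A B : C} (ev : A ⊗ B ⟶ 𝟙_ C) (R : C) : A ⊗ (B ⊗ R) ⟶ R :=
  (α_ A B R).inv ≫ ev ▷ R ≫ (λ_ R).hom

section

variable {A B : C} {co : 𝟙_ C ⟶ A ⊗ B} {ev : A ⊗ B ⟶ 𝟙_ C}

theorem ins_con (h : co ≫ ev = 𝟙 _) (R : C) : ins co R ≫ con ev R = 𝟙 R := by
  unfold ins con
  calc
    _ = 𝟙 _ ⊗≫ (co ≫ ev) ▷ R ⊗≫ 𝟙 _ := by monoidal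
    _ = _ := by rw [h]; monoidal

theorem ins_tensor (R Q : C) : ins co (R ⊗ Q) =
    (ins co R ⊗ₘ 𝟙 Q) ≫ (α_ A (B ⊗ R) Q).hom ≫ A ◁ (α_ B R Q).hom := by
  unfold ins; rw [tensorHom_id]; monoidal

theorem con_tensor (R Q : C) : A ◁ (α_ B R Q).hom ≫ con ev (R ⊗ Q) =
    (α_ A (B ⊗ R) Q).inv ≫ (con ev R ⊗ₘ 𝟙 Q) := by
  unfold con; rw [tensorHom_id]; monoidal

theorem ins_naturality {R Q : C} (f : R ⟶ Q) : f ≫ ins co Q = ins co R ≫ A ◁ B ◁ f := by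
  unfold ins
  simp only [Category.assoc]
  rw [leftUnitor_inv_naturality_assoc, whisker_exchange_assoc]; simp

theorem con_naturality {R Q : C} (f : R ⟶ Q) : con ev R ≫ f = A ◁ B ◁ f ≫ con ev Q := by
  unfold con
  simp only [Category.assoc]
  rw [← leftUnitor_naturality, ← whisker_exchange_assoc]; simp

/-- Since the unit is a retract of A ⊗ B, f can be recovered from f ▷ A by tensoring with B and
closing the loop A ⊗ B. -/
theorem whiskerRight_injective (h : co ≫ ev = 𝟙 _) {X Y : C} {f g : X ⟶ Y} (hfg : f ▷ A = g ▷ A) :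
    f = g := by
  have key : ∀ f : X ⟶ Y, f = (ρ_ X).inv ≫ X ◁ co ≫ (α_ X A B).inv ≫ (f ▷ A) ▷ B ≫
      (α_ Y A B).hom ≫ Y ◁ ev ≫ (ρ_ Y).hom := fun f => by
    calc
      f = 𝟙 _ ⊗≫ f ▷ (𝟙_ C) ⊗≫ Y ◁ (co ≫ ev) ⊗≫ 𝟙 _ := by rw [h]; monoidal
      _ = 𝟙 _ ⊗≫ (f ▷ (𝟙_ C) ≫ Y ◁ co) ⊗≫ Y ◁ ev ⊗≫ 𝟙 _ := by monoidal
      _ = _ := by rw [← whisker_exchange]; monoidal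
  rw [key f, hfg, ← key g]

/-- In the arrow category f is a retract of f ▷ A ▷ B, and isomorphisms are stable under retracts.
-/
theorem isIso_of_whiskerRight (h : co ≫ ev = 𝟙 _) {X Y : C} (f : X ⟶ Y) [IsIso (f ▷ A)] :
    IsIso f := by
  have hX : ∀ X : C, ((ρ_ X).inv ≫ X ◁ co ≫ (α_ X A B).inv) ≫ (α_ X A B).hom ≫ X ◁ ev ≫
      (ρ_ X).hom = 𝟙 X := fun X => by
    calc
      _ = 𝟙 _ ⊗≫ X ◁ (co ≫ ev) ⊗≫ 𝟙 _ := by monoidal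
      _ = _ := by rw [h]; monoidal
  have r : RetractArrow f (f ▷ A ▷ B) :=
    { i := Arrow.homMk ((ρ_ X).inv ≫ X ◁ co ≫ (α_ X A B).inv)
        ((ρ_ Y).inv ≫ Y ◁ co ≫ (α_ Y A B).inv) (by
          dsimp
          simp only [Category.assoc]
          rw [rightUnitor_inv_naturality_assoc, ← whisker_exchange_assoc]; simp)
      r := Arrow.homMk ((α_ X A B).hom ≫ X ◁ ev ≫ (ρ_ X).hom) ((α_ Y A B).hom ≫ Y ◁ ev ≫ (ρ_ Y).hom) (by
          dsimp
          simp only [Category.assoc]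
          rw [← rightUnitor_naturality, whisker_exchange_assoc]; simp)
      retract := by ext <;> exact hX _ }
  exact (MorphismProperty.isomorphisms C).of_retract r
    (show MorphismProperty.isomorphisms C (f ▷ A ▷ B) from inferInstanceAs (IsIso _))

/-- Identities between crossings, in particular the axioms of a half-braiding, may thus be checked
after gluing with one invertible crossing of A. -/
theorem glue_injective (h : co ≫ ev = 𝟙 _) {X Y Z N N' M' K : C} {v v' : Z ⊗ N ⟶ N' ⊗ Y}
    (u : Y ⊗ A ⟶ M' ⊗ X) (j : N' ⊗ M' ⟶ K) [IsIso u] [IsIso j]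
    (e : glue v u j = glue v' u j) : v = v' := by
  unfold glue at e
  rw [cancel_epi, ← Category.assoc, ← Category.assoc (v' ▷ A), cancel_mono, cancel_mono] at e
  exact whiskerRight_injective h e

end

end Gluing

/-! ### Arrows over elements of Γ and their composition. -/

noncomputable section Arrows

universe v u w₁ w₂
variable {G : Type w₁} {Γ : Type w₂} [Group G] [Group Γ] {P : MatchedPair G Γ}
  {C : Type u} [Category.{v} C] [Preadditive C] [HasFiniteBiproducts C] [MonoidalCategory C]
  [MonoidalPreadditive C] {gr : Γ → ObjectProperty C}

theorem IsMonoidalGrading.mem_tensor (hg : IsMonoidalGrading gr) {s t r : Γ} (e : s * t = r)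
    {X Y : C} (hX : gr s X) (hY : gr t Y) : gr r (X ⊗ Y) :=
  e ▸ hg.tensor hX hY

/-- A presentation of the unit as a retract of a tensor product of homogeneous objects of the
degrees `s` and `s⁻¹`, for every `s`. -/
structure Splitting (gr : Γ → ObjectProperty C) where
  M : Γ → C
  M' : Γ → C
  mem : ∀ s, gr s (M s)
  mem' : ∀ s, gr s⁻¹ (M' s)
  co : ∀ s, 𝟙_ C ⟶ M s ⊗ M' s
  ev : ∀ s, M s ⊗ M' s ⟶ 𝟙_ C
  co_ev : ∀ s, co s ≫ ev s = 𝟙 _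

namespace CrossedStructure

variable (S : CrossedStructure P gr)

/-- The product degree is a variable r with an equation, so that degrees such as s * 1 or s⁻¹ * s
can be replaced by s or 1 without transport. -/
theorem J_assoc' {g g' g'' : G} {s t r : Γ} (e : P.act₂ t g = g') (e' : P.act₂ s g' = g'')
    (hr : s * t = r) (e'' : P.act₂ r g = g'') {μ ν : C} (hμ : gr s μ) (hν : gr t ν)
    (hμν : gr r (μ ⊗ ν)) (X : C) :
    (S.J e' hμ X).hom ▷ (S.act g).obj ν ≫ (S.J e hν (X ⊗ μ)).hom ≫ (S.act g).map (α_ X μ ν).hom =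
      (α_ ((S.act g'').obj X) ((S.act g').obj μ) ((S.act g).obj ν)).hom ≫
        (S.act g'').obj X ◁ (S.J e hν μ).hom ≫ (S.J e'' hμν X).hom := by
  subst hr
  exact S.J_assoc e e' e'' hμ hν hμν X

theorem J_natural_left {g g' : G} {s : Γ} (e : P.act₂ s g = g') {μ : C} (hμ : gr s μ)
    {X Y : C} (f : X ⟶ Y) : (S.act g').map f ▷ (S.act g).obj μ ≫ (S.J e hμ Y).hom =
      (S.J e hμ X).hom ≫ (S.act g).map (f ▷ μ) := by
  have := S.J_natural e hμ hμ (𝟙 μ) f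
  simpa only [CategoryTheory.Functor.map_id, tensorHom_id] using this

theorem J_natural_right {g g' : G} {s : Γ} (e : P.act₂ s g = g') {μ ν : C} (hμ : gr s μ)
    (hν : gr s ν) (m : μ ⟶ ν) (X : C) : (S.act g').obj X ◁ (S.act g).map m ≫ (S.J e hν X).hom =
      (S.J e hμ X).hom ≫ (S.act g).map (X ◁ m) := by
  have := S.J_natural e hμ hν m (𝟙 X)
  simpa only [CategoryTheory.Functor.map_id, id_tensorHom] using this

/-- An arrow over `s` from `Y` to `X`: a natural family `Y ⊗ μ ⟶ ^h μ ⊗ X` for `μ` of degree `s`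
and `h` the degree of `X`, compatible with the half-braidings of `Y` and `X`. -/
structure Arr (s : Γ) (Y X : S.CenterObj) where
  deg_eq : P.act₂ s X.deg = Y.deg
  app : ∀ {h : G}, X.deg = h → ∀ {μ : C}, gr s μ → (Y.obj ⊗ μ ⟶ (S.act h).obj μ ⊗ X.obj)
  natural : ∀ {h : G} (eX : X.deg = h) {μ μ' : C} (hμ : gr s μ) (hμ' : gr s μ') (f : μ ⟶ μ'),
    Y.obj ◁ f ≫ app eX hμ' = app eX hμ ≫ (S.act h).map f ▷ X.obj
  left : ∀ {h h' : G} (eX : X.deg = h) (eY : Y.deg = h') (e : P.act₂ s h = h') {ν μ : C}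
    (hν : gr 1 ν) (hμ : gr s μ) (hνμ : gr s (ν ⊗ μ)),
    app eX hνμ = glue (Y.β eY hν).hom (app eX hμ) (S.J e hμ ν).hom
  right : ∀ {h : G} (eX : X.deg = h) (e : P.act₂ 1 h = h) {μ ν : C}
    (hμ : gr s μ) (hν : gr 1 ν) (hμν : gr s (μ ⊗ ν)),
    app eX hμν = glue (app eX hμ) (X.β eX hν).hom (S.J e hν μ).hom

namespace Arr

variable {S} {s t r : Γ} {W X Y Z : S.CenterObj}

theorem deg_eq' (u : Arr S s Y X) {h h' : G} (eX : X.deg = h) (eY : Y.deg = h') :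
    P.act₂ s h = h' := by
  rw [← eX, ← eY, u.deg_eq]

/-- All components of the arrow are isomorphisms. -/
def Inv (u : Arr S s Y X) : Prop :=
  ∀ {h : G} (eX : X.deg = h) {μ : C} (hμ : gr s μ), IsIso (u.app eX hμ)

theorem ext' {u u' : Arr S s Y X}
    (H : ∀ {h : G} (eX : X.deg = h) {μ : C} (hμ : gr s μ), u.app eX hμ = u'.app eX hμ) :
    u = u' := by
  obtain ⟨_, a, _, _, _⟩ := u
  obtain ⟨_, b, _, _, _⟩ := u'
  have : @a = @b := by
    funext h eX μ hμ
    exact H eX hμ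
  subst this
  rfl

/-- The identity arrow, given by the half-braiding. -/
def id (X : S.CenterObj) : Arr S 1 X X where
  deg_eq := P.one_act₂ _
  app eX _ hμ := (X.β eX hμ).hom
  natural eX _ _ hμ hμ' f := X.β_natural eX hμ hμ' f
  left eX eY e ν μ hν hμ hνμ := by
    obtain rfl := eX.symm.trans eY
    exact X.β_tensor eX hν hμ hνμ
  right eX e μ ν hμ hν hμν := X.β_tensor eX hμ hν hμν

@[simp] theorem id_app (X : S.CenterObj) {h : G} (eX : X.deg = h) {μ : C} (hμ : gr 1 μ) :
    (id X).app eX hμ = (X.β eX hμ).hom := rfl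

theorem id_inv (X : S.CenterObj) : (id X).Inv := fun _ _ _ => by
  rw [id_app]; infer_instance

/-- The composition with a morphism on the left. -/
def precomp (f : Z ⟶ Y) (hf : Z.deg = Y.deg) (u : Arr S s Y X) : Arr S s Z X where
  deg_eq := u.deg_eq.trans hf.symm
  app eX μ hμ := f.hom ▷ μ ≫ u.app eX hμ
  natural eX μ μ' hμ hμ' g := by
    rw [Category.assoc, ← u.natural eX hμ hμ' g, whisker_exchange_assoc]
  left eX eZ e ν μ hν hμ hνμ := by
    rw [u.left eX (hf.symm.trans eZ) e hν hμ hνμ, ← glue_comp_left, f.mem.2 eZ (hf.symm.trans eZ) hν,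
      glue_comp_mid]
  right eX e μ ν hμ hν hμν := by
    rw [u.right eX e hμ hν hμν, ← glue_comp_left]

@[simp] theorem precomp_app (f : Z ⟶ Y) (hf : Z.deg = Y.deg) (u : Arr S s Y X) {h : G}
    (eX : X.deg = h) {μ : C} (hμ : gr s μ) :
    (u.precomp f hf).app eX hμ = f.hom ▷ μ ≫ u.app eX hμ := rfl

/-- The composition with a morphism on the right. -/
def postcomp (u : Arr S s Z Y) (g : Y ⟶ X) (hg : Y.deg = X.deg) : Arr S s Z X where
  deg_eq := by rw [← hg, u.deg_eq]
  app eX μ hμ := u.app (hg.trans eX) hμ ≫ _ ◁ g.hom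
  natural eX μ μ' hμ hμ' f := by
    rw [Category.assoc, whisker_exchange, reassoc_of% (u.natural (hg.trans eX) hμ hμ' f)]
  left eX eZ e ν μ hν hμ hνμ := by
    rw [u.left (hg.trans eX) eZ e hν hμ hνμ, glue_comp_right]
  right eX e μ ν hμ hν hμν := by
    rw [u.right (hg.trans eX) e hμ hν hμν, ← glue_comp_right, ← g.mem.2 (hg.trans eX) eX hν,
      glue_comp_mid]

@[simp] theorem postcomp_app (u : Arr S s Z Y) (g : Y ⟶ X) (hg : Y.deg = X.deg) {h : G}
    (eX : X.deg = h) {μ : C} (hμ : gr s μ) :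
    (u.postcomp g hg).app eX hμ = u.app (hg.trans eX) hμ ≫ _ ◁ g.hom := rfl

/-- The degrees of the factors in the product `M s ⊗ (M' s ⊗ ρ)`. -/
theorem _root_.CrossedCat.Splitting.mem_tensor (D : Splitting gr) (hg : IsMonoidalGrading gr)
    (e : s * t = r) {ρ : C} (hρ : gr r ρ) : gr t (D.M' s ⊗ ρ) :=
  hg.mem_tensor (by rw [← e, inv_mul_cancel_left]) (D.mem' s) hρ

/-- The components of the composite of two arrows. -/
def compApp (D : Splitting gr) (e : s * t = r) (v : Arr S s Z Y) (u : Arr S t Y X) {h : G}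
    (eX : X.deg = h) {ρ : C} (hρ : gr r ρ) : Z.obj ⊗ ρ ⟶ (S.act h).obj ρ ⊗ X.obj :=
  Z.obj ◁ ins (D.co s) ρ ≫ glue (v.app rfl (D.mem s)) (u.app eX (D.mem_tensor S.grading e hρ))
    (S.J (u.deg_eq' eX rfl) (D.mem_tensor S.grading e hρ) (D.M s)).hom ≫
    (S.act h).map (con (D.ev s) ρ) ▷ X.obj

theorem glue_naturality' (v : Arr S s Z Y) (u : Arr S t Y X) {h h' : G} (eX : X.deg = h)
    (eY : Y.deg = h') (e : P.act₂ t h = h') {ν ν' μ μ' : C} (hν : gr s ν) (hν' : gr s ν')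
    (hμ : gr t μ) (hμ' : gr t μ') (n : ν ⟶ ν') (m : μ ⟶ μ') :
    Z.obj ◁ (n ⊗ₘ m) ≫ glue (v.app eY hν') (u.app eX hμ') (S.J e hμ' ν').hom =
      glue (v.app eY hν) (u.app eX hμ) (S.J e hμ ν).hom ≫ (S.act h).map (n ⊗ₘ m) ▷ X.obj :=
  glue_naturality (v.natural eY hν hν' n) (u.natural eX hμ hμ' m) (S.J_natural e hμ hμ' m n)

/-- A component of an arrow is a retract of the one at a tensor product. -/
theorem app_retract (D : Splitting gr) (u : Arr S r Y X) (s : Γ) {h : G} (eX : X.deg = h) {ρ : C}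
    (hρ : gr r ρ) (hρ' : gr r (D.M s ⊗ (D.M' s ⊗ ρ))) :
    u.app eX hρ = Y.obj ◁ ins (D.co s) ρ ≫ u.app eX hρ' ≫
      (S.act h).map (con (D.ev s) ρ) ▷ X.obj := by
  rw [← u.natural eX hρ' hρ, ← whiskerLeft_comp_assoc, ins_con (D.co_ev s), whiskerLeft_id,
    Category.id_comp]

theorem compApp_natural (D : Splitting gr) (e : s * t = r) (v : Arr S s Z Y) (u : Arr S t Y X)
    {h : G} (eX : X.deg = h) {ρ ρ' : C} (hρ : gr r ρ) (hρ' : gr r ρ') (f : ρ ⟶ ρ') :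
    Z.obj ◁ f ≫ compApp D e v u eX hρ' = compApp D e v u eX hρ ≫ (S.act h).map f ▷ X.obj := by
  have h₁ := glue_naturality' v u eX rfl (u.deg_eq' eX rfl) (D.mem s) (D.mem s)
    (D.mem_tensor S.grading e hρ) (D.mem_tensor S.grading e hρ') (𝟙 _) (D.M' s ◁ f)
  rw [id_tensorHom] at h₁
  rw [compApp, compApp, ← whiskerLeft_comp_assoc, ins_naturality, whiskerLeft_comp_assoc,
    reassoc_of% h₁, Category.assoc, Category.assoc, ← comp_whiskerRight, ← comp_whiskerRight,
    ← Functor.map_comp, ← Functor.map_comp, con_naturality]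

/-- The composite of two arrows on a tensor product. -/
theorem compApp_tensor (D : Splitting gr) (e : s * t = r) (v : Arr S s Z Y) (u : Arr S t Y X)
    {h h' : G} (eX : X.deg = h) (eY : Y.deg = h') (e' : P.act₂ t h = h') {ν μ : C} (hν : gr s ν)
    (hμ : gr t μ) (hνμ : gr r (ν ⊗ μ)) :
    compApp D e v u eX hνμ = glue (v.app eY hν) (u.app eX hμ) (S.J e' hμ ν).hom := by
  subst eY
  -- M' ⊗ ν has degree 1, so the half-braiding of Y can carry it: `u.left` splits it off from the
  -- component of u, and `v.right` absorbs it into the component of v. What remains is the component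
  -- of v at M ⊗ (M' ⊗ ν), which contracts to the one at ν.
  have m₁ : gr 1 (D.M' s ⊗ ν) := S.grading.mem_tensor (inv_mul_cancel s) (D.mem' s) hν
  have m₂ : gr s (D.M s ⊗ (D.M' s ⊗ ν)) := S.grading.mem_tensor (mul_one s) (D.mem s) m₁
  have m₃ : gr t ((D.M' s ⊗ ν) ⊗ μ) := S.grading.mem_tensor (one_mul t) m₁ hμ
  have m₄ := D.mem_tensor S.grading e hνμ
  have h₁ := glue_naturality' v u eX rfl e' (D.mem s) (D.mem s) m₃ m₄ (𝟙 _)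
    (α_ (D.M' s) ν μ).hom
  have h₂ := u.left eX rfl e' m₁ hμ m₃
  have h₃ := glue_assoc (v.app rfl (D.mem s)) (Y.β rfl m₁).hom (u.app eX hμ)
    (S.J_assoc' e' (P.one_act₂ _) (one_mul t) e' m₁ hμ m₃ (D.M s))
  have h₄ := v.right rfl (P.one_act₂ _) (D.mem s) m₁ m₂
  have h₅ := glue_naturality' v u eX rfl e' m₂ hν hμ hμ (con (D.ev s) ν) (𝟙 μ)
  rw [id_tensorHom] at h₁
  rw [← h₂, ← h₄] at h₃
  rw [compApp, ins_tensor]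
  simp only [whiskerLeft_comp, Category.assoc]
  rw [reassoc_of% h₁, reassoc_of% h₃, ← comp_whiskerRight, ← comp_whiskerRight,
    ← Functor.map_comp, ← Functor.map_comp, con_tensor, Iso.hom_inv_id_assoc, ← h₅,
    ← whiskerLeft_comp_assoc, tensorHom_comp_tensorHom, ins_con (D.co_ev s), Category.comp_id,
    id_tensorHom_id, whiskerLeft_id, Category.id_comp]

/-- The composition of arrows. -/
def comp (D : Splitting gr) (e : s * t = r) (v : Arr S s Z Y) (u : Arr S t Y X) :
    Arr S r Z X where
  deg_eq := by rw [← e, P.mul_act₂, u.deg_eq, v.deg_eq]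
  app eX _ hρ := compApp D e v u eX hρ
  natural eX _ _ hρ hρ' f := compApp_natural D e v u eX hρ hρ' f
  left {h h'} eX eZ e' ν ρ hν hρ hνρ := by
    have e₁ := u.deg_eq' eX rfl
    have e₂ := v.deg_eq' rfl eZ
    have m₁ := D.mem_tensor S.grading e hρ
    have m₂ : gr r (D.M s ⊗ (D.M' s ⊗ ρ)) := S.grading.mem_tensor e (D.mem s) m₁
    have m₃ : gr s (ν ⊗ D.M s) := S.grading.mem_tensor (one_mul s) hν (D.mem s)
    have m₄ : gr r ((ν ⊗ D.M s) ⊗ (D.M' s ⊗ ρ)) := S.grading.mem_tensor e m₃ m₁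
    have m₅ : gr r (ν ⊗ (D.M s ⊗ (D.M' s ⊗ ρ))) := S.grading.mem_tensor (one_mul r) hν m₂
    -- The identity is first obtained with M ⊗ (M' ⊗ ρ) in place of ρ: there the composite is a
    -- gluing, and `v.left` with `glue_assoc` moves the half-braiding of Z to the front.
    have h₁ := compApp_natural D e v u eX m₄ m₅ (α_ _ _ _).hom
    have h₂ := compApp_tensor D e v u eX rfl e₁ m₃ m₁ m₄
    have h₃ := compApp_tensor D e v u eX rfl e₁ (D.mem s) m₁ m₂
    have h₄ := v.left rfl eZ e₂ hν (D.mem s) m₃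
    have h₅ := glue_assoc (Z.β eZ hν).hom (v.app rfl (D.mem s)) (u.app eX m₁)
      (S.J_assoc' e₁ e₂ e e' (D.mem s) m₁ m₂ ν)
    rw [h₂, h₄, ← h₅, cancel_epi, ← h₃] at h₁
    -- The general case follows along ν ◁ con, which is a split epimorphism with section ν ◁ ins.
    have h₆ := compApp_natural D e v u eX m₅ hνρ (ν ◁ con (D.ev s) ρ)
    have h₇ := glue_naturality (Z.β_natural eZ hν hν (𝟙 ν))
      (compApp_natural D e v u eX m₂ hρ (con (D.ev s) ρ))
      (S.J_natural e' m₂ hρ (con (D.ev s) ρ) (𝟙 ν))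
    rw [id_tensorHom] at h₇
    rw [h₁, ← h₇] at h₆
    refine whiskerLeft_cancel (g := ν ◁ ins (D.co s) ρ) ?_ h₆
    rw [← whiskerLeft_comp, ins_con (D.co_ev s), whiskerLeft_id]
  right {h} eX e' μ ν hμ hν hμν := by
    have e₁ := u.deg_eq' eX rfl
    have m₁ := D.mem_tensor S.grading e hμ
    have m₂ : gr r (D.M s ⊗ (D.M' s ⊗ μ)) := S.grading.mem_tensor e (D.mem s) m₁
    have m₃ : gr t ((D.M' s ⊗ μ) ⊗ ν) := S.grading.mem_tensor (mul_one t) m₁ hν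
    have m₄ : gr r ((D.M s ⊗ (D.M' s ⊗ μ)) ⊗ ν) := S.grading.mem_tensor (mul_one r) m₂ hν
    have m₅ : gr r (D.M s ⊗ ((D.M' s ⊗ μ) ⊗ ν)) := S.grading.mem_tensor e (D.mem s) m₃
    -- As for the left compatibility: first on M ⊗ (M' ⊗ μ), where `u.right` applies, then along the
    -- contraction onto μ.
    have h₁ := compApp_natural D e v u eX m₄ m₅ (α_ _ _ _).hom
    have h₂ := compApp_tensor D e v u eX rfl e₁ (D.mem s) m₃ m₅
    have h₃ := compApp_tensor D e v u eX rfl e₁ (D.mem s) m₁ m₂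
    have h₄ := u.right eX e' m₁ hν m₃
    have h₅ := glue_assoc (v.app rfl (D.mem s)) (u.app eX m₁) (X.β eX hν).hom
      (S.J_assoc' e' e₁ (mul_one t) e₁ m₁ hν m₃ (D.M s))
    rw [h₂, h₄, h₅, cancel_mono, ← h₃] at h₁
    have h₆ := compApp_natural D e v u eX m₄ hμν (con (D.ev s) μ ⊗ₘ 𝟙 ν)
    have h₇ := glue_naturality (compApp_natural D e v u eX m₂ hμ (con (D.ev s) μ))
      (X.β_natural eX hν hν (𝟙 ν)) (S.J_natural e' hν hν (𝟙 ν) (con (D.ev s) μ))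
    rw [← h₁, ← h₇] at h₆
    refine whiskerLeft_cancel (g := ins (D.co s) μ ⊗ₘ 𝟙 ν) ?_ h₆
    rw [tensorHom_comp_tensorHom, ins_con (D.co_ev s), Category.comp_id, id_tensorHom_id]

/-- The defining property of the composition. -/
theorem comp_app (D : Splitting gr) (e : s * t = r) (v : Arr S s Z Y) (u : Arr S t Y X)
    {h h' : G} (eX : X.deg = h) (eY : Y.deg = h') (e' : P.act₂ t h = h') {ν μ : C} (hν : gr s ν)
    (hμ : gr t μ) (hνμ : gr r (ν ⊗ μ)) :
    (comp D e v u).app eX hνμ = glue (v.app eY hν) (u.app eX hμ) (S.J e' hμ ν).hom :=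
  compApp_tensor D e v u eX eY e' hν hμ hνμ

/-- Arrows over `s * t` that agree on tensor products are equal. -/
theorem ext_tensor (D : Splitting gr) (e : s * t = r) {u u' : Arr S r Y X}
    (H : ∀ {h : G} (eX : X.deg = h) {ν μ : C} (_ : gr s ν) (_ : gr t μ) (hνμ : gr r (ν ⊗ μ)),
      u.app eX hνμ = u'.app eX hνμ) : u = u' :=
  ext' fun {h} eX {ρ} hρ => by
    have m₁ := D.mem_tensor S.grading e hρ
    have m₂ : gr r (D.M s ⊗ (D.M' s ⊗ ρ)) := S.grading.mem_tensor e (D.mem s) m₁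
    rw [u.app_retract D s eX hρ m₂, u'.app_retract D s eX hρ m₂, H eX (D.mem s) m₁ m₂]

/-- On M ⊗ (M' ⊗ ρ) the composite is glued from isomorphisms, and by naturality the component at ρ
is a retract of that one. -/
theorem comp_inv (D : Splitting gr) (e : s * t = r) {v : Arr S s Z Y} {u : Arr S t Y X}
    (hv : v.Inv) (hu : u.Inv) : (comp D e v u).Inv := fun {h} eX {ρ} hρ => by
  have m₁ := D.mem_tensor S.grading e hρ
  have m₂ : gr r (D.M s ⊗ (D.M' s ⊗ ρ)) := S.grading.mem_tensor e (D.mem s) m₁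
  have e' := u.deg_eq' eX rfl
  have := hv rfl (D.mem s)
  have := hu eX m₁
  have i : IsIso ((comp D e v u).app eX m₂) := by
    rw [comp_app D e v u eX rfl e' (D.mem s) m₁ m₂]
    exact glue_isIso _ _ _
  have n₁ := (comp D e v u).natural eX hρ m₂ (ins (D.co s) ρ)
  have n₂ := (comp D e v u).natural eX m₂ hρ (con (D.ev s) ρ)
  have a : RetractArrow ((comp D e v u).app eX hρ) ((comp D e v u).app eX m₂) :=
    { i := Arrow.homMk (Z.obj ◁ ins (D.co s) ρ) ((S.act h).map (ins (D.co s) ρ) ▷ X.obj) n₁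
      r := Arrow.homMk (Z.obj ◁ con (D.ev s) ρ) ((S.act h).map (con (D.ev s) ρ) ▷ X.obj) n₂
      retract := by
        ext
        · change Z.obj ◁ ins (D.co s) ρ ≫ Z.obj ◁ con (D.ev s) ρ = _
          rw [← whiskerLeft_comp, ins_con (D.co_ev s), whiskerLeft_id]
          rfl
        · change (S.act h).map (ins (D.co s) ρ) ▷ X.obj ≫ (S.act h).map (con (D.ev s) ρ) ▷ X.obj = _
          rw [← comp_whiskerRight, ← Functor.map_comp, ins_con (D.co_ev s),
            CategoryTheory.Functor.map_id, id_whiskerRight]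
          rfl }
  exact (MorphismProperty.isomorphisms C).of_retract a i

/-- It suffices to compare components at ν ⊗ μ with ν of degree st, and ν is in turn a retract of M
⊗ (M' ⊗ ν). On a product of three factors both composites are triple gluings, and `glue_assoc`
applies. -/
theorem comp_assoc (D : Splitting gr) {q st tr : Γ} (e₁ : s * t = st) (e₂ : st * r = q)
    (e₃ : t * r = tr) (e₄ : s * tr = q) (w : Arr S s W Z) (v : Arr S t Z Y) (u : Arr S r Y X) :
    comp D e₂ (comp D e₁ w v) u = comp D e₄ w (comp D e₃ v u) := by
  refine ext_tensor D e₂ fun {h} eX {ν μ} hν hμ hνμ => ?_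
  have a₁ := u.deg_eq' eX rfl
  have a₂ := v.deg_eq' rfl rfl
  have a₃ : P.act₂ tr h = Z.deg := by rw [← e₃, P.mul_act₂, a₁, a₂]
  -- reduce to a product of three factors
  have n₁ := D.mem_tensor S.grading e₁ hν
  have n₂ : gr st (D.M s ⊗ (D.M' s ⊗ ν)) := S.grading.mem_tensor e₁ (D.mem s) n₁
  have n₃ : gr q ((D.M s ⊗ (D.M' s ⊗ ν)) ⊗ μ) := S.grading.mem_tensor e₂ n₂ hμ
  have n₄ : gr tr ((D.M' s ⊗ ν) ⊗ μ) := S.grading.mem_tensor e₃ n₁ hμ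
  have n₅ : gr q (D.M s ⊗ ((D.M' s ⊗ ν) ⊗ μ)) := S.grading.mem_tensor e₄ (D.mem s) n₄
  have key : (comp D e₂ (comp D e₁ w v) u).app eX n₃ = (comp D e₄ w (comp D e₃ v u)).app eX n₃ := by
    rw [← cancel_mono ((S.act h).map (α_ (D.M s) (D.M' s ⊗ ν) μ).hom ▷ X.obj),
      ← (comp D e₄ w (comp D e₃ v u)).natural eX n₃ n₅,
      comp_app D e₄ w _ eX rfl a₃ (D.mem s) n₄ n₅, comp_app D e₃ v u eX rfl a₁ n₁ hμ n₄,
      comp_app D e₂ _ u eX rfl a₁ n₂ hμ n₃, comp_app D e₁ w v rfl rfl a₂ (D.mem s) n₁ n₂]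
    exact (glue_assoc _ _ _ (S.J_assoc' a₁ a₂ e₃ a₃ n₁ hμ n₄ (D.M s))).symm
  refine whiskerLeft_cancel (f := con (D.ev s) ν ▷ μ) (g := ins (D.co s) ν ▷ μ) ?_ ?_
  · rw [← comp_whiskerRight, ins_con (D.co_ev s), id_whiskerRight]
  · rw [Arr.natural _ eX n₃ hνμ, Arr.natural _ eX n₃ hνμ, key]

theorem id_comp (D : Splitting gr) (e : 1 * s = s) (u : Arr S s Y X) : comp D e (id Y) u = u :=
  ext_tensor D e fun {h} eX {ν μ} hν hμ hνμ => by
    rw [comp_app D e _ u eX rfl (u.deg_eq' eX rfl) hν hμ,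
      u.left eX rfl (u.deg_eq' eX rfl) hν hμ]
    rfl

theorem comp_id (D : Splitting gr) (e : s * 1 = s) (u : Arr S s Y X) : comp D e u (id X) = u :=
  ext_tensor D e fun {h} eX {ν μ} hν hμ hνμ => by
    rw [comp_app D e u _ eX eX (P.one_act₂ _) hν hμ,
      u.right eX (P.one_act₂ _) hν hμ]
    rfl

theorem precomp_comp (D : Splitting gr) (e : s * t = r) (f : W ⟶ Z) (hf : W.deg = Z.deg)
    (v : Arr S s Z Y) (u : Arr S t Y X) :
    comp D e (v.precomp f hf) u = (comp D e v u).precomp f hf :=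
  ext_tensor D e fun {h} eX {ν μ} hν hμ hνμ => by
    rw [comp_app D e _ u eX rfl (u.deg_eq' eX rfl) hν hμ, precomp_app, precomp_app,
      comp_app D e _ u eX rfl (u.deg_eq' eX rfl) hν hμ, glue_comp_left]

theorem comp_postcomp (D : Splitting gr) (e : s * t = r) (v : Arr S s W Z) (u : Arr S t Z Y)
    (g : Y ⟶ X) (hg : Y.deg = X.deg) :
    comp D e v (u.postcomp g hg) = (comp D e v u).postcomp g hg :=
  ext_tensor D e fun {h} eX {ν μ} hν hμ hνμ => by
    rw [comp_app D e _ _ eX rfl (u.deg_eq' (hg.trans eX) rfl) hν hμ, postcomp_app, postcomp_app,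
      comp_app D e _ u (hg.trans eX) rfl (u.deg_eq' (hg.trans eX) rfl) hν hμ, glue_comp_right]

theorem postcomp_comp (D : Splitting gr) (e : s * t = r) (v : Arr S s W Z) (g : Z ⟶ Y)
    (hg : Z.deg = Y.deg) (u : Arr S t Y X) :
    comp D e (v.postcomp g hg) u = comp D e v (u.precomp g hg) :=
  ext_tensor D e fun {h} eX {ν μ} hν hμ hνμ => by
    rw [comp_app D e _ _ eX rfl (u.deg_eq' eX rfl) hν hμ, postcomp_app,
      comp_app D e _ _ eX hg (u.deg_eq' eX rfl) hν hμ, precomp_app, glue_comp_mid]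

theorem precomp_postcomp (f : W ⟶ Z) (hf : W.deg = Z.deg) (v : Arr S s Z Y) (g : Y ⟶ X)
    (hg : Y.deg = X.deg) :
    (v.precomp f hf).postcomp g hg = (v.postcomp g hg).precomp f hf :=
  ext' fun eX _ hμ => by simp

theorem precomp_precomp (f : W ⟶ Z) (hf : W.deg = Z.deg) (g : Z ⟶ Y) (hg : Z.deg = Y.deg)
    (v : Arr S s Y X) : (v.precomp g hg).precomp f hf = v.precomp (f ≫ g) (hf.trans hg) :=
  ext' fun eX _ hμ => by simp

theorem postcomp_postcomp (v : Arr S s W Z) (f : Z ⟶ Y) (hf : Z.deg = Y.deg) (g : Y ⟶ X)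
    (hg : Y.deg = X.deg) :
    (v.postcomp f hf).postcomp g hg = v.postcomp (f ≫ g) (hf.trans hg) :=
  ext' fun eX _ hμ => by simp

theorem precomp_id (v : Arr S s Y X) : v.precomp (𝟙 Y) rfl = v :=
  ext' fun eX _ hμ => by simp

theorem postcomp_id (v : Arr S s Y X) : v.postcomp (𝟙 X) rfl = v :=
  ext' fun eX _ hμ => by simp

/-- This is the compatibility with half-braidings that defines the morphisms of the crossed center.
-/
theorem id_precomp (f : Y ⟶ X) (hf : Y.deg = X.deg) : (id X).precomp f hf = (id Y).postcomp f hf :=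
  ext' fun eX _ hμ => f.mem.2 (hf.trans eX) eX hμ

end Arr
end CrossedStructure
end Arrows
-- Tensor products of arrows and factorization through invertible arrows.
section

universe v u
variable {C : Type u} [Category.{v} C] [MonoidalCategory C]

theorem glue_unit {N M N' M' K : C} {a : N ⟶ N'} {b : M ⟶ M'} {j : N' ⊗ M' ⟶ K} {c : N ⊗ M ⟶ K}
    (h : (a ⊗ₘ b) ≫ j = c) :
    (λ_ (N ⊗ M)).hom ≫ c ≫ (ρ_ K).inv =
      glue ((λ_ N).hom ≫ a ≫ (ρ_ N').inv) ((λ_ M).hom ≫ b ≫ (ρ_ M').inv) j := by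
  unfold glue
  rw [← h, MonoidalCategory.tensorHom_def]
  monoidal

theorem unit_naturality {N M N' M' : C} {a : N ⟶ N'} {b : M ⟶ M'} {f : N ⟶ M} {f' : N' ⟶ M'}
    (h : f ≫ b = a ≫ f') : 𝟙_ C ◁ f ≫ (λ_ M).hom ≫ b ≫ (ρ_ M').inv =
      ((λ_ N).hom ≫ a ≫ (ρ_ N').inv) ≫ f' ▷ 𝟙_ C := by
  rw [leftUnitor_naturality_assoc, reassoc_of% h]; simp

theorem unit_isIso {N N' : C} (a : N ⟶ N') [IsIso a] :
    IsIso ((λ_ N).hom ≫ a ≫ (ρ_ N').inv) := inferInstance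

theorem glue_comp_first {X Y Z W L N M N' M' K : C} (f : W ⊗ L ⟶ Z ⊗ N) (v : Z ⊗ N ⟶ N' ⊗ Y)
    (u : Y ⊗ M ⟶ M' ⊗ X) (j : N' ⊗ M' ⟶ K) :
    (α_ W L M).inv ≫ f ▷ M ≫ (α_ Z N M).hom ≫ glue v u j = glue (f ≫ v) u j := by
  unfold glue; simp

end

noncomputable section Arrows

universe v u w₁ w₂
variable {G : Type w₁} {Γ : Type w₂} [Group G] [Group Γ] {P : MatchedPair G Γ}
  {C : Type u} [Category.{v} C] [Preadditive C] [HasFiniteBiproducts C] [MonoidalCategory C]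
  [MonoidalPreadditive C] {gr : Γ → ObjectProperty C}

namespace CrossedStructure
namespace Arr

variable {S : CrossedStructure P gr} {s t r : Γ} {W X Y Z X' Y' Z' : S.CenterObj}

/-- The unit arrow over `s`. -/
def unit (s : Γ) : Arr S s CenterObj.unit CenterObj.unit where
  deg_eq := P.act₂_one s
  app e μ _ := (λ_ μ).hom ≫ (S.ι e.symm).hom.app μ ≫ (ρ_ ((S.act _).obj μ)).inv
  natural e μ μ' hμ hμ' f := unit_naturality ((S.ι e.symm).hom.naturality f)
  left {h h'} e e₁ e' ν μ hν hμ hνμ := by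
    obtain rfl := e.symm.trans e₁
    exact glue_unit (S.ι_J e.symm e' hμ ν)
  right e e' μ ν hμ hν hμν := glue_unit (S.ι_J e.symm e' hν μ)

/-- The tensor product of arrows. -/
def tensor (e : P.act₁ X'.deg t = s) (u : Arr S s Y X) (u' : Arr S t Y' X') :
    Arr S t (CenterObj.tensor Y Y') (CenterObj.tensor X X') where
  deg_eq := by
    change P.act₂ t (X.deg * X'.deg) = Y.deg * Y'.deg
    rw [P.act₂_mul, e, u.deg_eq, u'.deg_eq]
  -- The arrow u' crosses μ first and turns it into the image of μ under the degree of X', which has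
  -- degree s by `e`; this is what u accepts. Then χ merges the two actions.
  app eX μ hμ := stack (u.app rfl (e ▸ S.act_mem X'.deg hμ)) (u'.app rfl hμ)
    ((S.χ eX).hom.app μ)
  natural {h} eX μ μ' hμ hμ' f := by
    subst e
    have h₁ := u'.natural rfl hμ hμ' f
    have h₂ := u.natural rfl (S.act_mem X'.deg hμ) (S.act_mem X'.deg hμ') ((S.act X'.deg).map f)
    have h₃ := (S.χ eX).hom.naturality f
    simp only [Functor.comp_map, Functor.comp_obj] at h₃
    generalize (S.χ eX).hom.app μ = c₁ at *
    generalize (S.χ eX).hom.app μ' = c₂ at *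
    change (Y.obj ⊗ Y'.obj) ◁ f ≫ _ = _ ≫ _ ▷ (X.obj ⊗ X'.obj)
    unfold stack
    simp only [tensor_whiskerLeft, Category.assoc, Iso.inv_hom_id_assoc]
    rw [← whiskerLeft_comp_assoc, h₁, whiskerLeft_comp_assoc, ← comp_whiskerRight, ← h₃,
      comp_whiskerRight, associator_inv_naturality_middle_assoc, ← comp_whiskerRight_assoc, h₂,
      comp_whiskerRight_assoc, associator_naturality_left_assoc]
  left {h h'} eX eY e' ν μ hν hμ hνμ := by
    subst e
    -- Naturality of u at J splits its component at the image of ν ⊗ μ into two crossings. The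
    -- remaining identity of merging maps is `J_χ`.
    have h₁ := u.natural rfl (S.grading.mem_tensor (one_mul _) (S.mem_one _ hν)
      (S.act_mem X'.deg hμ)) (S.act_mem X'.deg hνμ) (S.J (u'.deg_eq' rfl rfl) hμ ν).hom
    rw [u.left rfl rfl (u.deg_eq' rfl rfl) (S.mem_one _ hν) (S.act_mem X'.deg hμ)] at h₁
    rw [u'.left rfl rfl (u'.deg_eq' rfl rfl) hν hμ hνμ]
    exact stack_glue _ _ _ _ h₁ (S.J_χ eX eY (u'.deg_eq' rfl rfl) (u.deg_eq' rfl rfl) e' hμ ν).symm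
  right {h} eX e' μ ν hμ hν hμν := by
    subst e
    have h₁ := u.natural rfl (S.grading.mem_tensor (mul_one _) (S.act_mem X'.deg hμ)
      (S.mem_one _ hν)) (S.act_mem X'.deg hμν) (S.J (P.one_act₂ _) hν μ).hom
    rw [u.right rfl (P.one_act₂ _) (S.act_mem X'.deg hμ) (S.mem_one _ hν)] at h₁
    rw [u'.right rfl (P.one_act₂ _) hμ hν hμν]
    exact stack_glue _ _ _ _ h₁ (S.J₁_χ eX hν μ).symm

theorem tensor_app (e : P.act₁ X'.deg t = s) (u : Arr S s Y X) (u' : Arr S t Y' X') {a b h : G}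
    (ha : X.deg = a) (hb : X'.deg = b) (eX : X.deg * X'.deg = h) (e' : a * b = h) {μ : C}
    (hμ : gr t μ) (hμ' : gr s ((S.act b).obj μ)) :
    (tensor e u u').app eX hμ =
      stack (u.app ha hμ') (u'.app hb hμ) ((S.χ e').hom.app μ) := by
  subst ha hb
  rfl

theorem tensor_inv (e : P.act₁ X'.deg t = s) {u : Arr S s Y X} {u' : Arr S t Y' X'} (hu : u.Inv)
    (hu' : u'.Inv) : (tensor e u u').Inv := fun {h} eX {μ} hμ => by
  have := hu rfl (e ▸ S.act_mem X'.deg hμ : gr s ((S.act X'.deg).obj μ))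
  have := hu' rfl hμ
  exact stack_isIso _ _ _

theorem unit_inv (s : Γ) : (unit s : Arr S s _ _).Inv := fun {h} eX {μ} hμ => by
  exact unit_isIso ((S.ι eX.symm).hom.app μ)

/-- The half-braiding of a tensor product is by definition the stack of the two half-braidings,
merged by χ. -/
theorem id_tensor (e : P.act₁ X'.deg 1 = 1) : tensor e (id X) (id X') = id (CenterObj.tensor X X') :=
  ext' fun _ _ _ => rfl

theorem id_unit : (unit 1 : Arr S 1 _ _) = id CenterObj.unit :=
  ext' fun _ _ _ => rfl

/-- The tensor product is compatible with the composition. -/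
theorem comp_tensor (D : Splitting gr) {s' t' r' : Γ} (e : s * t = r) (e' : s' * t' = r')
    (e₁ : P.act₁ Y'.deg s' = s) (e₂ : P.act₁ X'.deg t' = t) (e₃ : P.act₁ X'.deg r' = r)
    (v : Arr S s Z Y) (v' : Arr S s' Z' Y') (u : Arr S t Y X) (u' : Arr S t' Y' X') :
    tensor e₃ (comp D e v u) (comp D e' v' u') =
      comp D e' (tensor e₁ v v') (tensor e₂ u u') := by
  subst e₁ e₂
  refine ext_tensor D e' fun {h} eX {ν μ} hν hμ hνμ => ?_
  have a := (tensor rfl u u').deg_eq' eX rfl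
  have b := u'.deg_eq' rfl rfl
  have hνμ' : gr r ((S.act X'.deg).obj (ν ⊗ μ)) := e₃ ▸ S.act_mem _ hνμ
  have m : gr r ((S.act Y'.deg).obj ν ⊗ (S.act X'.deg).obj μ) :=
    S.grading.mem_tensor e (S.act_mem _ hν) (S.act_mem _ hμ)
  rw [comp_app D e' _ _ eX rfl a hν hμ, tensor_app e₃ _ _ rfl rfl eX eX hνμ hνμ',
    comp_app D e' v' u' rfl rfl b hν hμ]
  -- The component of the composite at the image of ν ⊗ μ is compared through J with the one at a
  -- product of images, which is a gluing; then gluing and stacking commute.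
  have h₁ := (comp D e v u).natural rfl m hνμ' (S.J b hμ ν).hom
  rw [comp_app D e v u rfl rfl (u.deg_eq' rfl rfl) (S.act_mem _ hν) (S.act_mem _ hμ)] at h₁
  exact stack_glue _ _ _ _ h₁ (S.J_χ eX rfl b (u.deg_eq' rfl rfl) a hμ ν).symm

theorem unit_comp_unit (D : Splitting gr) (e : s * t = r) :
    comp D e (unit s) (unit t) = (unit r : Arr S r _ _) :=
  ext_tensor D e fun {h} eX {ν μ} hν hμ hνμ => by
    have a := (unit t : Arr S t _ _).deg_eq' eX eX
    rw [comp_app D e _ _ eX eX a hν hμ]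
    exact (glue_unit (S.ι_J eX.symm a hμ ν)).symm

theorem tensor_precomp (e : P.act₁ X'.deg t = s) (f : Z ⟶ Y) (hf : Z.deg = Y.deg) (f' : Z' ⟶ Y')
    (hf' : Z'.deg = Y'.deg) (u : Arr S s Y X) (u' : Arr S t Y' X') :
    tensor e (u.precomp f hf) (u'.precomp f' hf') =
      (tensor e u u').precomp (CenterObj.tensorHom f f') (congrArg₂ (· * ·) hf hf') :=
  ext' fun _ _ _ => stack_comp_left _ _ _ _ _

theorem tensor_postcomp (e : P.act₁ X'.deg t = s) (e' : P.act₁ Y'.deg t = s) (u : Arr S s Z Y)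
    (u' : Arr S t Z' Y') (f : Y ⟶ X) (hf : Y.deg = X.deg) (f' : Y' ⟶ X')
    (hf' : Y'.deg = X'.deg) :
    tensor e (u.postcomp f hf) (u'.postcomp f' hf') =
      (tensor e' u u').postcomp (CenterObj.tensorHom f f') (congrArg₂ (· * ·) hf hf') :=
  ext' fun {h} eX {μ} hμ => by
    have e₁ : Y.deg * Y'.deg = h := (congrArg₂ (· * ·) hf hf').trans eX
    exact (tensor_app e _ _ rfl rfl eX eX hμ (e ▸ S.act_mem _ hμ)).trans
      ((stack_comp_right _ _ _ _ _).trans (congrArg (· ≫ _)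
        (tensor_app e' u u' hf hf' e₁ eX hμ (e ▸ S.act_mem _ hμ)).symm))

theorem tensor_assoc {X'' Y'' : S.CenterObj} {q : Γ} (e₁ : P.act₁ X'.deg t = s)
    (e₂ : P.act₁ X''.deg q = t) (e₃ : P.act₁ (X'.deg * X''.deg) q = s) (u : Arr S s Y X)
    (u' : Arr S t Y' X') (u'' : Arr S q Y'' X'') :
    (tensor e₃ u (tensor e₂ u' u'')).precomp (CenterObj.assoc Y Y' Y'').hom (mul_assoc _ _ _) =
      (tensor e₂ (tensor e₁ u u') u'').postcomp (CenterObj.assoc X X' X'').hom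
        (mul_assoc _ _ _) :=
  ext' fun {h} eX {μ} hμ => by
    have e₄ : X.deg * X'.deg * X''.deg = h := (mul_assoc _ _ _).trans eX
    have m₁ : gr t ((S.act X''.deg).obj μ) := e₂ ▸ S.act_mem _ hμ
    have m₂ : gr s ((S.act X'.deg).obj ((S.act X''.deg).obj μ)) := e₁ ▸ S.act_mem _ m₁
    have m₃ : gr s ((S.act (X'.deg * X''.deg)).obj μ) := e₃ ▸ S.act_mem _ hμ
    exact stack_assoc _ _ (u.natural rfl m₂ m₃
      ((S.χ (rfl : X'.deg * X''.deg = _)).hom.app μ))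
      (S.χ_assoc rfl rfl e₄ eX μ)

theorem unit_tensor (e : P.act₁ X.deg t = s) (u : Arr S t Y X) :
    u.precomp (CenterObj.leftUnitor Y).hom (one_mul _) =
      (tensor e (unit s) u).postcomp (CenterObj.leftUnitor X).hom (one_mul _) :=
  ext' fun {h} eX {μ} hμ => by
    subst eX
    exact stack_unit_left (u.app rfl hμ) (S.ι_χ rfl (one_mul _) μ)

/-- The action of 1 fixes t only propositionally, so u is also needed as an arrow u' over s, with an
explicit transport relating the two. -/
theorem tensor_unit (e : P.act₁ 1 t = s) (e' : t = s) (u : Arr S t Y X) (u' : Arr S s Y X)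
    (h : e' ▸ u = u') :
    u.precomp (CenterObj.rightUnitor Y).hom (mul_one _) =
      (tensor (X' := CenterObj.unit) e u' (unit t)).postcomp (CenterObj.rightUnitor X).hom
        (mul_one _) :=
  ext' fun {h} eX {μ} hμ => by
    subst e' h eX
    exact stack_unit_right (u.natural rfl hμ (e ▸ S.act_mem 1 hμ) ((S.ι rfl).hom.app μ))
      (S.χ_ι rfl (mul_one _) μ)

/-- An arrow with the same source `Y` as `c` factors through an invertible arrow `u`. -/
theorem exists_lift {E : S.CenterObj} (D : Splitting gr) {u : Arr S s E X} (hu : u.Inv)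
    (c : Arr S s Y X) (hY : Y.deg = E.deg) : ∃ f : Y ⟶ E, u.precomp f hY = c := by
  have := hu rfl (D.mem s)
  -- The required factorization leaves no other choice for f ▷ M, as the component of u at M is
  -- invertible.
  let T : Y.obj ⊗ D.M s ⟶ E.obj ⊗ D.M s := c.app rfl (D.mem s) ≫ inv (u.app rfl (D.mem s))
  have hT : T ≫ u.app rfl (D.mem s) = c.app rfl (D.mem s) := by simp [T]
  -- The strand M is closed by means of the retraction of M ⊗ M' onto the unit.
  let f : Y.obj ⟶ E.obj := (ρ_ _).inv ≫ Y.obj ◁ D.co s ≫ (α_ _ _ _).inv ≫ T ▷ D.M' s ≫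
    (α_ _ _ _).hom ≫ E.obj ◁ D.ev s ≫ (ρ_ _).hom
  have hf : ∀ μ : C, f ▷ μ = Y.obj ◁ ins (D.co s) μ ≫ (α_ _ _ _).inv ≫ T ▷ (D.M' s ⊗ μ) ≫
      (α_ _ _ _).hom ≫ E.obj ◁ con (D.ev s) μ := fun μ => by
    simp only [f, ins, con]; monoidal
  -- M' ⊗ μ has degree 1, so `right` expresses the components of u and of c at M ⊗ (M' ⊗ μ) through
  -- those at M, where they differ by T; contracting gives the claim at μ.
  have key : ∀ {μ : C} (hμ : gr s μ), f ▷ μ ≫ u.app rfl hμ = c.app rfl hμ := fun {μ} hμ => by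
    have m₁ : gr 1 (D.M' s ⊗ μ) := D.mem_tensor S.grading (mul_one s) hμ
    have m₂ : gr s (D.M s ⊗ (D.M' s ⊗ μ)) := S.grading.mem_tensor (mul_one s) (D.mem s) m₁
    rw [hf, Category.assoc, Category.assoc, Category.assoc, Category.assoc,
      u.natural rfl m₂ hμ (con (D.ev s) μ), u.right rfl (P.one_act₂ _) (D.mem s) m₁ m₂,
      reassoc_of% (glue_comp_first T (u.app rfl (D.mem s)) (X.β rfl m₁).hom
        (S.J (P.one_act₂ _) m₁ (D.M s)).hom), hT, ← c.right rfl (P.one_act₂ _) (D.mem s) m₁ m₂]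
    exact (c.app_retract D s rfl hμ m₂).symm
  refine ⟨⟨f, fun h => (h hY).elim, fun {g} eY eE ν hν => ?_⟩, ?_⟩
  -- Compatibility with half-braidings is tested after gluing with the component of u at M; `left`
  -- for u and for c turns it into `key`.
  · have e := u.deg_eq' rfl eE
    have m : gr s (ν ⊗ D.M s) := S.grading.mem_tensor (one_mul s) hν (D.mem s)
    refine glue_injective (D.co_ev s) (u.app rfl (D.mem s)) (S.J e (D.mem s) ν).hom ?_
    rw [glue_comp_mid, key, ← c.left rfl eY e hν (D.mem s) m, glue_comp_left,
      ← u.left rfl eE e hν (D.mem s) m, key]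
  · refine ext' fun {h} eX {μ} hμ => ?_
    subst eX
    exact key hμ

/-- Invertibility of u at M determines f ▷ M, and tensoring with M is faithful. All coherence laws
of the action are proved by this cancellation. -/
theorem lift_unique {E : S.CenterObj} (D : Splitting gr) {u : Arr S s E X} (hu : u.Inv)
    {f f' : Y ⟶ E} (hY : Y.deg = E.deg) (h : u.precomp f hY = u.precomp f' hY) : f = f' := by
  have := hu rfl (D.mem s)
  have h₁ := congrArg (fun c => c.app rfl (D.mem s)) h
  simp only [precomp_app, cancel_mono] at h₁
  exact CenterObj.hom_ext (whiskerRight_injective (D.co_ev s) h₁)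

/-- The factorization of an arrow through an invertible arrow. -/
def lift {E : S.CenterObj} (D : Splitting gr) {u : Arr S s E X} (hu : u.Inv)
    (c : Arr S s Y X) (hY : Y.deg = E.deg) : Y ⟶ E := (exists_lift D hu c hY).choose

theorem lift_spec {E : S.CenterObj} (D : Splitting gr) {u : Arr S s E X} (hu : u.Inv)
    (c : Arr S s Y X) (hY : Y.deg = E.deg) : u.precomp (lift D hu c hY) hY = c :=
  (exists_lift D hu c hY).choose_spec

/-- The factorization of an invertible arrow through another one is an isomorphism. -/
def liftIso {E : S.CenterObj} (D : Splitting gr) {u : Arr S s E X} (hu : u.Inv)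
    {c : Arr S s Y X} (hc : c.Inv) (hY : Y.deg = E.deg) : Y ≅ E where
  hom := lift D hu c hY
  inv := lift D hc u hY.symm
  hom_inv_id := lift_unique D hc rfl (by
    rw [← precomp_precomp _ hY _ hY.symm, lift_spec, lift_spec, precomp_id])
  inv_hom_id := lift_unique D hu rfl (by
    rw [← precomp_precomp _ hY.symm _ hY, lift_spec, lift_spec, precomp_id])

end Arr
end CrossedStructure
end Arrows
-- Existence of invertible arrows: splitting an idempotent.
section

universe v u
variable {C : Type u} [Category.{v} C] [MonoidalCategory C]

theorem isIso_of_glue {A B : C} {co : 𝟙_ C ⟶ A ⊗ B} {ev : A ⊗ B ⟶ 𝟙_ C} (h : co ≫ ev = 𝟙 _)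
    {X Y Z N N' M' K : C} (v : Z ⊗ N ⟶ N' ⊗ Y) (u : Y ⊗ A ⟶ M' ⊗ X) (j : N' ⊗ M' ⟶ K) [IsIso u]
    [IsIso j] [i : IsIso (glue v u j)] : IsIso v := by
  have : IsIso (v ▷ A) := by
    unfold glue at i
    rwa [isIso_comp_left_iff, isIso_comp_right_iff] at i
  exact isIso_of_whiskerRight h v

theorem glue_comp_out {X Y Z N M N' N'' M' K : C} (v : Z ⊗ N ⟶ N' ⊗ Y) (f : N' ⟶ N'')
    (u : Y ⊗ M ⟶ M' ⊗ X) (j : N'' ⊗ M' ⟶ K) :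
    glue (v ≫ f ▷ Y) u j = glue v u (f ▷ M' ≫ j) := by
  unfold glue
  calc
    _ = 𝟙 _ ⊗≫ v ▷ M ⊗≫ (f ▷ (Y ⊗ M) ≫ N'' ◁ u) ⊗≫ j ▷ X := by monoidal
    _ = _ := by rw [← whisker_exchange]; monoidal

theorem glue_comp_last {X Y Z N M N' M' K K' : C} (v : Z ⊗ N ⟶ N' ⊗ Y)
    (u : Y ⊗ M ⟶ M' ⊗ X) (j : N' ⊗ M' ⟶ K) (f : K ⟶ K') :
    glue v u (j ≫ f) = glue v u j ≫ f ▷ X := by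
  unfold glue; simp

end

noncomputable section Existence

universe v u w₁ w₂
variable {G : Type w₁} {Γ : Type w₂} [Group G] [Group Γ] {P : MatchedPair G Γ}
  {C : Type u} [Category.{v} C] [Preadditive C] [HasFiniteBiproducts C] [MonoidalCategory C]
  [MonoidalPreadditive C] {gr : Γ → ObjectProperty C}

namespace CrossedStructure

variable {S : CrossedStructure P gr}

/-- The isomorphism `^h L ⊗ X ⊗ ν ≅ ^h (L ⊗ ν) ⊗ X` for `ν` of degree `1`. -/
def push (X : S.CenterObj) {h : G} (eX : X.deg = h) (L : C) {ν : C} (hν : gr 1 ν) :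
    ((S.act h).obj L ⊗ X.obj) ⊗ ν ⟶ (S.act h).obj (L ⊗ ν) ⊗ X.obj :=
  (α_ _ _ _).hom ≫ (S.act h).obj L ◁ (X.β eX hν).hom ≫ (α_ _ _ _).inv ≫
    (S.J (P.one_act₂ h) hν L).hom ▷ X.obj

instance (X : S.CenterObj) {h : G} (eX : X.deg = h) (L : C) {ν : C} (hν : gr 1 ν) :
    IsIso (push X eX L hν) := by
  unfold push; infer_instance

variable (X : S.CenterObj) {h h' : G} (eX : X.deg = h)

theorem glue_push {Y N L ν : C} (v : Y ⊗ N ⟶ (S.act h).obj L ⊗ X.obj) (hν : gr 1 ν) :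
    glue v (X.β eX hν).hom (S.J (P.one_act₂ h) hν L).hom =
      (α_ _ _ _).inv ≫ v ▷ ν ≫ push X eX L hν := rfl

theorem push_natural_left {L L' : C} (f : L ⟶ L') {ν : C} (hν : gr 1 ν) :
    (S.act h).map f ▷ X.obj ▷ ν ≫ push X eX L' hν =
      push X eX L hν ≫ (S.act h).map (f ▷ ν) ▷ X.obj := by
  unfold push
  simp only [Category.assoc]
  rw [← comp_whiskerRight, ← S.J_natural_left, comp_whiskerRight, associator_naturality_left_assoc,
    ← whisker_exchange_assoc, associator_inv_naturality_left_assoc]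

theorem push_natural_right (L : C) {ν ν' : C} (hν : gr 1 ν) (hν' : gr 1 ν') (g : ν ⟶ ν') :
    ((S.act h).obj L ⊗ X.obj) ◁ g ≫ push X eX L hν' =
      push X eX L hν ≫ (S.act h).map (L ◁ g) ▷ X.obj := by
  unfold push
  simp only [Category.assoc]
  rw [← comp_whiskerRight, ← S.J_natural_right _ hν hν', comp_whiskerRight, tensor_whiskerLeft_assoc,
    Iso.inv_hom_id_assoc, ← whiskerLeft_comp_assoc, X.β_natural eX hν hν' g,
    whiskerLeft_comp_assoc, associator_inv_naturality_middle_assoc]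

/-- Multiplicativity of the half-braiding splits the crossing of ν ⊗ ν', and the coherence of J with
the associator merges the images in L ⊗ ν ⊗ ν'. -/
theorem push_assoc (L : C) {ν ν' : C} (hν : gr 1 ν) (hν' : gr 1 ν') (hνν' : gr 1 (ν ⊗ ν')) :
    push X eX L hν ▷ ν' ≫ push X eX (L ⊗ ν) hν' ≫ (S.act h).map (α_ L ν ν').hom ▷ X.obj =
      (α_ _ _ _).hom ≫ push X eX L hνν' := by
  have hJ := S.J_assoc' (P.one_act₂ h) (P.one_act₂ h) (one_mul 1) (P.one_act₂ h) hν hν' hνν' L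
  unfold push
  rw [X.β_tensor eX hν hν' hνν', J₁]
  calc
    _ = 𝟙 _ ⊗≫ (S.act h).obj L ◁ (X.β eX hν).hom ▷ ν' ⊗≫
        ((S.J (P.one_act₂ h) hν L).hom ▷ (X.obj ⊗ ν') ≫
          (S.act h).obj (L ⊗ ν) ◁ (X.β eX hν').hom) ⊗≫
        ((S.J (P.one_act₂ h) hν' (L ⊗ ν)).hom ≫ (S.act h).map (α_ L ν ν').hom) ▷ X.obj := by
      monoidal
    _ = 𝟙 _ ⊗≫ (S.act h).obj L ◁ (X.β eX hν).hom ▷ ν' ⊗≫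
        ((S.act h).obj L ⊗ (S.act h).obj ν) ◁ (X.β eX hν').hom ⊗≫
        ((S.J (P.one_act₂ h) hν L).hom ▷ (S.act h).obj ν' ≫ (S.J (P.one_act₂ h) hν' (L ⊗ ν)).hom ≫
          (S.act h).map (α_ L ν ν').hom) ▷ X.obj := by
      rw [← whisker_exchange]; monoidal
    _ = _ := by rw [hJ]; monoidal

/-- J and the half-braiding with ν act on disjoint strands; after exchanging them only the coherence
of J for the degrees s and 1 remains. -/
theorem push_act {s : Γ} (e : P.act₂ s h = h') (L : C) {μ ν : C} (hμ : gr s μ) (hν : gr 1 ν)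
    (hμν : gr s (μ ⊗ ν)) :
    ((α_ _ _ _).inv ≫ (S.J e hμ L).hom ▷ X.obj) ▷ ν ≫ push X eX (L ⊗ μ) hν ≫
        (S.act h).map (α_ L μ ν).hom ▷ X.obj =
      (α_ _ _ _).hom ≫ (S.act h').obj L ◁ push X eX μ hν ≫ (α_ _ _ _).inv ≫
        (S.J e hμν L).hom ▷ X.obj := by
  have hJ := S.J_assoc' (P.one_act₂ h) e (mul_one s) e hμ hν hμν L
  unfold push
  calc
    _ = 𝟙 _ ⊗≫ ((S.J e hμ L).hom ▷ (X.obj ⊗ ν) ≫ (S.act h).obj (L ⊗ μ) ◁ (X.β eX hν).hom) ⊗≫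
        ((S.J (P.one_act₂ h) hν (L ⊗ μ)).hom ≫ (S.act h).map (α_ L μ ν).hom) ▷ X.obj := by
      monoidal
    _ = 𝟙 _ ⊗≫ ((S.act h').obj L ⊗ (S.act h).obj μ) ◁ (X.β eX hν).hom ⊗≫
        ((S.J e hμ L).hom ▷ (S.act h).obj ν ≫ (S.J (P.one_act₂ h) hν (L ⊗ μ)).hom ≫
          (S.act h).map (α_ L μ ν).hom) ▷ X.obj := by
      rw [← whisker_exchange]; monoidal
    _ = _ := by rw [hJ]; monoidal

variable (D : Splitting gr) (s : Γ)

theorem _root_.CrossedCat.Splitting.mem_one (hg : IsMonoidalGrading gr) {μ : C} (hμ : gr s μ) :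
    gr 1 (D.M' s ⊗ μ) := D.mem_tensor hg (mul_one s) hμ

/-- The object `^h M ⊗ X ⊗ M'`. -/
abbrev conjObj (X : S.CenterObj) (h : G) : C := ((S.act h).obj (D.M s) ⊗ X.obj) ⊗ D.M' s

/-- The idempotent on `^h M ⊗ X ⊗ M'` whose image is the value at `X` of the action of `s`. -/
def conjIdem : conjObj D s X h ⟶ conjObj D s X h :=
  (ρ_ _).inv ≫ conjObj D s X h ◁ D.co s ≫ (α_ _ _ _).inv ≫
    ((α_ _ _ _).hom ≫ push X eX (D.M s) (D.mem_one s S.grading (D.mem s)) ≫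
      (S.act h).map (con (D.ev s) (D.M s)) ▷ X.obj) ▷ D.M' s

/-- The morphism `^h M ⊗ X ⊗ M' ⊗ μ ⟶ ^h (M ⊗ M' ⊗ μ) ⊗ X`. -/
def conjPush {μ : C} (hμ : gr s μ) : conjObj D s X h ⊗ μ ⟶
    (S.act h).obj (D.M s ⊗ (D.M' s ⊗ μ)) ⊗ X.obj :=
  (α_ _ _ _).hom ≫ push X eX (D.M s) (D.mem_one s S.grading hμ)

instance {μ : C} (hμ : gr s μ) : IsIso (conjPush X eX D s hμ) := by
  unfold conjPush; infer_instance

theorem conjPush_natural {μ μ' : C} (hμ : gr s μ) (hμ' : gr s μ') (f : μ ⟶ μ') :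
    conjObj D s X h ◁ f ≫ conjPush X eX D s hμ' =
      conjPush X eX D s hμ ≫ (S.act h).map (D.M s ◁ D.M' s ◁ f) ▷ X.obj := by
  unfold conjPush
  rw [tensor_whiskerLeft_assoc, Iso.inv_hom_id_assoc,
    push_natural_right X eX _ (D.mem_one s S.grading hμ), Category.assoc]

theorem conjPush_push {μ ν : C} (hμ : gr s μ) (hν : gr 1 ν) (hμν : gr s (μ ⊗ ν)) :
    conjPush X eX D s hμ ▷ ν ≫ push X eX (D.M s ⊗ (D.M' s ⊗ μ)) hν ≫
      (S.act h).map ((α_ _ _ _).hom ≫ D.M s ◁ (α_ _ _ _).hom) ▷ X.obj =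
    (α_ _ _ _).hom ≫ conjPush X eX D s hμν := by
  have m : gr 1 ((D.M' s ⊗ μ) ⊗ ν) :=
    S.grading.mem_tensor (mul_one 1) (D.mem_one s S.grading hμ) hν
  have h₁ := push_assoc X eX (D.M s) (D.mem_one s S.grading hμ) hν m
  have h₂ := push_natural_right X eX (D.M s) m (D.mem_one s S.grading hμν) (α_ _ _ _).hom
  unfold conjPush
  rw [Functor.map_comp, comp_whiskerRight, comp_whiskerRight, Category.assoc, reassoc_of% h₁, ← h₂]
  monoidal

/-- The central computation. The isomorphism `conjPush` conjugates the idempotent, tensored with μ,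
into ^h (con ≫ ins) ⊗ X, where con ≫ ins is the projector of M ⊗ M' ⊗ μ onto its retract μ. The
proof slides the inserted M ⊗ M' to the far right, pushes everything through X at once, and
contracts inside the action. -/
theorem conjIdem_conjPush {μ : C} (hμ : gr s μ) :
    conjIdem X eX D s ▷ μ ≫ conjPush X eX D s hμ =
      conjPush X eX D s hμ ≫ (S.act h).map (con (D.ev s) μ ≫ ins (D.co s) μ) ▷ X.obj := by
  have m₁ := D.mem_one s S.grading (D.mem s)
  have m₂ := D.mem_one s S.grading hμ
  have m₃ : gr s (D.M s ⊗ (D.M' s ⊗ μ)) := S.grading.mem_tensor (mul_one s) (D.mem s) m₂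
  have h₁ := push_natural_left X eX (con (D.ev s) (D.M s)) m₂
  have h₂ := conjPush_push X eX D s (D.mem s) m₂ m₃
  have h₃ := conjPush_natural X eX D s hμ m₃ (ins (D.co s) μ)
  -- Inserting a new M ⊗ M' next to μ and contracting the old one is the same as contracting first
  -- and inserting afterwards, by naturality of the contraction.
  have h₄ : D.M s ◁ D.M' s ◁ ins (D.co s) μ ≫ D.M s ◁ (α_ _ _ _).inv ≫ (α_ _ _ _).inv ≫
      con (D.ev s) (D.M s) ▷ (D.M' s ⊗ μ) = con (D.ev s) μ ≫ ins (D.co s) μ := by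
    have := con_tensor (ev := D.ev s) (D.M s) (D.M' s ⊗ μ)
    rw [tensorHom_id] at this
    rw [con_naturality, ← this, whiskerLeft_inv_hom_assoc]
  calc
    _ = 𝟙 _ ⊗≫ conjObj D s X h ◁ ins (D.co s) μ ⊗≫ conjPush X eX D s (D.mem s) ▷ (D.M' s ⊗ μ) ≫
        (S.act h).map (con (D.ev s) (D.M s)) ▷ X.obj ▷ (D.M' s ⊗ μ) ≫
          push X eX (D.M s) m₂ := by
      unfold conjIdem ins conjPush; monoidal
    _ = 𝟙 _ ⊗≫ conjObj D s X h ◁ ins (D.co s) μ ⊗≫ (conjPush X eX D s (D.mem s) ▷ (D.M' s ⊗ μ) ≫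
        push X eX _ m₂ ≫ (S.act h).map ((α_ _ _ _).hom ≫ D.M s ◁ (α_ _ _ _).hom) ▷ X.obj) ≫
          (S.act h).map (D.M s ◁ (α_ _ _ _).inv ≫ (α_ _ _ _).inv ≫
            con (D.ev s) (D.M s) ▷ (D.M' s ⊗ μ)) ▷ X.obj := by
      rw [h₁]
      simp only [Category.assoc, ← comp_whiskerRight, ← Functor.map_comp]
      simp
    _ = (conjObj D s X h ◁ ins (D.co s) μ ≫ conjPush X eX D s m₃) ≫
          (S.act h).map (D.M s ◁ (α_ _ _ _).inv ≫ (α_ _ _ _).inv ≫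
            con (D.ev s) (D.M s) ▷ (D.M' s ⊗ μ)) ▷ X.obj := by
      rw [h₂]; monoidal
    _ = _ := by
      rw [h₃, Category.assoc, ← comp_whiskerRight, ← Functor.map_comp, h₄]

/-- After tensoring with M, which is faithful, the morphism is conjugate to the image of con ≫ ins,
and this is idempotent because ins ≫ con is the identity. -/
theorem conjIdem_idem : conjIdem X eX D s ≫ conjIdem X eX D s = conjIdem X eX D s := by
  refine whiskerRight_injective (D.co_ev s) ?_
  have h₁ := conjIdem_conjPush X eX D s (D.mem s)
  rw [← cancel_mono (conjPush X eX D s (D.mem s)), comp_whiskerRight, Category.assoc, h₁,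
    reassoc_of% h₁, ← comp_whiskerRight, ← Functor.map_comp, Category.assoc,
    reassoc_of% (ins_con (D.co_ev s))]

/-- A splitting of the idempotent `conjIdem`. -/
structure ConjSplit where
  E : C
  i : E ⟶ conjObj D s X h
  r : conjObj D s X h ⟶ E
  i_r : i ≫ r = 𝟙 E
  r_i : r ≫ i = conjIdem X eX D s

/-- A chosen splitting in an idempotent complete category. -/
def conjSplit [IsIdempotentComplete C] : ConjSplit X eX D s :=
  have h := IsIdempotentComplete.idempotents_split _ _ (conjIdem_idem X eX D s)
  ⟨h.choose, h.choose_spec.choose, h.choose_spec.choose_spec.choose,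
    h.choose_spec.choose_spec.choose_spec.1, h.choose_spec.choose_spec.choose_spec.2⟩

namespace ConjSplit

variable {X eX D s} (K : ConjSplit X eX D s)

/-- The components `E ⊗ μ ⟶ ^h μ ⊗ X` of the universal arrow. -/
def app {μ : C} (hμ : gr s μ) : K.E ⊗ μ ⟶ (S.act h).obj μ ⊗ X.obj :=
  K.i ▷ μ ≫ conjPush X eX D s hμ ≫ (S.act h).map (con (D.ev s) μ) ▷ X.obj

/-- By `conjIdem_conjPush`, the idempotent r ≫ i becomes con ≫ ins, which is absorbed by the
contraction that ends `app`. -/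
theorem r_app {μ : C} (hμ : gr s μ) : K.r ▷ μ ≫ K.app hμ =
    conjPush X eX D s hμ ≫ (S.act h).map (con (D.ev s) μ) ▷ X.obj := by
  unfold app
  rw [← comp_whiskerRight_assoc, K.r_i, reassoc_of% (conjIdem_conjPush X eX D s hμ),
    ← comp_whiskerRight, ← Functor.map_comp, Category.assoc, ins_con (D.co_ev s), Category.comp_id]

instance app_isIso {μ : C} (hμ : gr s μ) : IsIso (K.app hμ) := by
  refine ⟨(S.act h).map (ins (D.co s) μ) ▷ X.obj ≫ inv (conjPush X eX D s hμ) ≫ K.r ▷ μ, ?_, ?_⟩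
  · have h₁ : conjPush X eX D s hμ ≫ (S.act h).map (con (D.ev s) μ) ▷ X.obj ≫
        (S.act h).map (ins (D.co s) μ) ▷ X.obj ≫ inv (conjPush X eX D s hμ) =
          K.r ▷ μ ≫ K.i ▷ μ := by
      rw [← comp_whiskerRight_assoc, ← Functor.map_comp, ← comp_whiskerRight, K.r_i,
        ← Category.assoc, ← conjIdem_conjPush, Category.assoc, IsIso.hom_inv_id, Category.comp_id]
    unfold app
    simp only [Category.assoc]
    rw [reassoc_of% h₁]
    simp only [← comp_whiskerRight, K.i_r, id_whiskerRight, Category.comp_id]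
  · rw [Category.assoc, Category.assoc, K.r_app, IsIso.inv_hom_id_assoc, ← comp_whiskerRight,
      ← Functor.map_comp, ins_con (D.co_ev s), CategoryTheory.Functor.map_id, id_whiskerRight]

theorem app_natural {μ μ' : C} (hμ : gr s μ) (hμ' : gr s μ') (f : μ ⟶ μ') :
    K.E ◁ f ≫ K.app hμ' = K.app hμ ≫ (S.act h).map f ▷ X.obj := by
  unfold app
  rw [whisker_exchange_assoc, reassoc_of% (conjPush_natural X eX D s hμ hμ' f)]
  simp only [Category.assoc]
  rw [← comp_whiskerRight, ← comp_whiskerRight, ← Functor.map_comp, ← Functor.map_comp,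
    con_naturality]

theorem app_right {μ ν : C} (hμ : gr s μ) (hν : gr 1 ν) (hμν : gr s (μ ⊗ ν)) :
    K.app hμν = glue (K.app hμ) (X.β eX hν).hom (S.J (P.one_act₂ h) hν μ).hom := by
  have h₁ := push_natural_left X eX (con (D.ev s) μ) hν
  have h₂ := conjPush_push X eX D s hμ hν hμν
  have h₃ := con_tensor (ev := D.ev s) μ ν
  rw [tensorHom_id] at h₃
  rw [glue_push]
  unfold app
  have h₄ : con (D.ev s) μ ▷ ν = ((α_ _ _ _).hom ≫ D.M s ◁ (α_ _ _ _).hom) ≫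
      con (D.ev s) (μ ⊗ ν) := by rw [Category.assoc, h₃, Iso.hom_inv_id_assoc]
  rw [comp_whiskerRight, comp_whiskerRight, Category.assoc, Category.assoc, h₁, h₄,
    Functor.map_comp, comp_whiskerRight _ _ X.obj, reassoc_of% h₂]
  simp

/-- The half-braiding on the image of the idempotent. -/
def braid (e : P.act₂ s h = h') {ν : C} (hν : gr 1 ν) : K.E ⊗ ν ⟶ (S.act h').obj ν ⊗ K.E :=
  (ρ_ _).inv ≫ (K.E ⊗ ν) ◁ D.co s ≫ (α_ _ _ _).inv ≫
    ((α_ _ _ _).hom ≫ K.app (S.grading.mem_tensor (one_mul s) hν (D.mem s)) ≫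
      (S.J e (D.mem s) ν).inv ▷ X.obj ≫ (α_ _ _ _).hom) ▷ D.M' s ≫
    (α_ _ _ _).hom ≫ (S.act h').obj ν ◁ K.r

/-- This is the compatibility of the universal arrow with the half-braidings on the left. `braid` is
made from `app` at ν ⊗ M. For general μ, `r_app` removes the retraction, `push_act` brings J next to
the inverse contained in `braid`, and `app_right` recognizes the component at (ν ⊗ M) ⊗ (M' ⊗ μ), as
M' ⊗ μ has degree 1. The contraction then cancels the insertion. -/
theorem braid_app (e : P.act₂ s h = h') {ν μ : C} (hν : gr 1 ν) (hμ : gr s μ)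
    (hνμ : gr s (ν ⊗ μ)) :
    K.app hνμ = glue (K.braid e hν) (K.app hμ) (S.J e hμ ν).hom := by
  have m₁ := D.mem_one s S.grading hμ
  have m₂ : gr s (D.M s ⊗ (D.M' s ⊗ μ)) := S.grading.mem_tensor (mul_one s) (D.mem s) m₁
  have m₃ : gr s (ν ⊗ D.M s) := S.grading.mem_tensor (one_mul s) hν (D.mem s)
  have m₄ : gr s ((ν ⊗ D.M s) ⊗ (D.M' s ⊗ μ)) := S.grading.mem_tensor (mul_one s) m₃ m₁
  have h₁ := S.J_natural_right e m₂ hμ (con (D.ev s) μ) ν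
  have h₂ := push_act X eX e ν (D.mem s) m₁ m₂
  have h₃ := K.app_right m₃ m₁ m₄
  rw [glue_push, Iso.eq_inv_comp] at h₃
  have h₄ := K.app_natural m₄ hνμ ((α_ _ _ _).hom ≫ ν ◁ con (D.ev s) μ)
  symm
  calc
    _ = 𝟙 _ ⊗≫ (K.E ⊗ ν) ◁ ins (D.co s) μ ⊗≫ K.app m₃ ▷ (D.M' s ⊗ μ) ≫
        (S.J e (D.mem s) ν).inv ▷ X.obj ▷ (D.M' s ⊗ μ) ⊗≫
          (S.act h').obj ν ◁ (K.r ▷ μ ≫ K.app hμ) ⊗≫ (S.J e hμ ν).hom ▷ X.obj := by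
      unfold glue braid ins; monoidal
    _ = 𝟙 _ ⊗≫ (K.E ⊗ ν) ◁ ins (D.co s) μ ⊗≫ K.app m₃ ▷ (D.M' s ⊗ μ) ≫
        (S.J e (D.mem s) ν).inv ▷ X.obj ▷ (D.M' s ⊗ μ) ⊗≫
          (S.act h').obj ν ◁ push X eX (D.M s) m₁ ⊗≫
            ((S.act h').obj ν ◁ (S.act h).map (con (D.ev s) μ) ≫ (S.J e hμ ν).hom) ▷ X.obj := by
      rw [K.r_app, conjPush]; monoidal
    _ = 𝟙 _ ⊗≫ (K.E ⊗ ν) ◁ ins (D.co s) μ ⊗≫ K.app m₃ ▷ (D.M' s ⊗ μ) ≫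
        (S.J e (D.mem s) ν).inv ▷ X.obj ▷ (D.M' s ⊗ μ) ≫ (α_ _ _ _).hom ▷ (D.M' s ⊗ μ) ≫
          ((α_ _ _ _).hom ≫ (S.act h').obj ν ◁ push X eX (D.M s) m₁ ≫ (α_ _ _ _).inv ≫
            (S.J e m₂ ν).hom ▷ X.obj) ≫ (S.act h).map (ν ◁ con (D.ev s) μ) ▷ X.obj := by
      rw [h₁]; monoidal
    _ = 𝟙 _ ⊗≫ (K.E ⊗ ν) ◁ ins (D.co s) μ ⊗≫ K.app m₃ ▷ (D.M' s ⊗ μ) ≫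
        push X eX (ν ⊗ D.M s) m₁ ≫ (S.act h).map (α_ _ _ _).hom ▷ X.obj ≫
          (S.act h).map (ν ◁ con (D.ev s) μ) ▷ X.obj := by
      have h₅ : (S.J e (D.mem s) ν).inv ▷ X.obj ▷ (D.M' s ⊗ μ) ≫ (α_ _ _ _).hom ▷ (D.M' s ⊗ μ) ≫
          ((α_ _ _ _).inv ≫ (S.J e (D.mem s) ν).hom ▷ X.obj) ▷ (D.M' s ⊗ μ) = 𝟙 _ := by
        rw [← comp_whiskerRight, ← comp_whiskerRight, Iso.hom_inv_id_assoc, ← comp_whiskerRight,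
          Iso.inv_hom_id, id_whiskerRight, id_whiskerRight]
      rw [← h₂, Category.assoc, Category.assoc, reassoc_of% h₅]
    _ = 𝟙 _ ⊗≫ (K.E ⊗ ν) ◁ ins (D.co s) μ ⊗≫ K.E ◁ ((α_ _ _ _).hom ≫ ν ◁ con (D.ev s) μ) ≫
        K.app hνμ := by
      rw [h₄, Functor.map_comp, comp_whiskerRight, ← reassoc_of% h₃]; monoidal
    _ = K.E ◁ ν ◁ (ins (D.co s) μ ≫ con (D.ev s) μ) ≫ K.app hνμ := by
      monoidal
    _ = _ := by rw [ins_con (D.co_ev s)]; simp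

/-- Glued with the isomorphism `app` at M, the morphism becomes `app` at ν ⊗ M, again an
isomorphism; tensoring with M reflects isomorphisms. -/
instance (e : P.act₂ s h = h') {ν : C} (hν : gr 1 ν) : IsIso (K.braid e hν) := by
  have := K.braid_app e hν (D.mem s) (S.grading.mem_tensor (one_mul s) hν (D.mem s))
  have i : IsIso (glue (K.braid e hν) (K.app (D.mem s)) (S.J e (D.mem s) ν).hom) := by
    rw [← this]; infer_instance
  exact isIso_of_glue (D.co_ev s) _ (K.app (D.mem s)) (S.J e (D.mem s) ν).hom

/-- The image of the idempotent as an object of the crossed center. -/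
def obj (K : ConjSplit X (rfl : X.deg = X.deg) D s) : S.CenterObj where
  deg := P.act₂ s X.deg
  obj := K.E
  β e _ hν := asIso (K.braid e hν)
  β_natural {g} e {ν ν'} hν hν' f := by
    have m := S.grading.mem_tensor (one_mul s) hν (D.mem s)
    have m' := S.grading.mem_tensor (one_mul s) hν' (D.mem s)
    -- Both axioms are tested after gluing with the isomorphism `app` at M: `braid_app` reduces this
    -- one to the naturality of `app`, and the next one also to the coherence of J.
    refine glue_injective (D.co_ev s) (K.app (D.mem s)) (S.J e (D.mem s) ν').hom ?_
    rw [asIso_hom, asIso_hom, glue_comp_out, S.J_natural_left, glue_comp_last,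
      ← K.braid_app e hν (D.mem s) m, ← glue_comp_first, ← K.braid_app e hν' (D.mem s) m',
      ← K.app_natural m m']
    simp
  β_tensor {g} e {ν₁ ν₂} k₁ k₂ k₁₂ := by
    have m₁ := S.grading.mem_tensor (one_mul s) k₁₂ (D.mem s)
    have m₂ := S.grading.mem_tensor (one_mul s) k₂ (D.mem s)
    have m₃ := S.grading.mem_tensor (one_mul s) k₁ m₂
    refine glue_injective (D.co_ev s) (K.app (D.mem s)) (S.J e (D.mem s) (ν₁ ⊗ ν₂)).hom ?_
    have h₁ := glue_assoc (K.braid e k₁) (K.braid e k₂) (K.app (D.mem s))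
      (S.J_assoc' e (P.one_act₂ _) (one_mul s) e k₂ (D.mem s) m₂ ν₁)
    rw [← K.braid_app e k₂ (D.mem s) m₂, ← K.braid_app e k₁ m₂ m₃, K.app_natural m₁ m₃,
      cancel_mono, K.braid_app e k₁₂ (D.mem s) m₁] at h₁
    exact h₁

/-- The universal arrow. -/
def arr (K : ConjSplit X (rfl : X.deg = X.deg) D s) : Arr S s K.obj X where
  deg_eq := rfl
  app {h'} eX' μ hμ := by subst eX'; exact K.app hμ
  natural eX μ μ' hμ hμ' f := by subst eX; exact K.app_natural hμ hμ' f
  left eX eY e ν μ hν hμ hνμ := by subst eX; exact K.braid_app e hν hμ hνμ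
  right eX e μ ν hμ hν hμν := by subst eX; exact K.app_right hμ hν hμν

theorem arr_inv (K : ConjSplit X (rfl : X.deg = X.deg) D s) : K.arr.Inv := fun {h} eX {μ} hμ => by
  subst eX
  exact K.app_isIso hμ

/-- The inclusion in terms of the universal arrow. -/
theorem i_eq : K.i = (ρ_ _).inv ≫ K.E ◁ D.co s ≫ (α_ _ _ _).inv ≫ K.app (D.mem s) ▷ D.M' s := by
  have h₁ : K.i ≫ conjIdem X eX D s = K.i := by rw [← K.r_i, reassoc_of% K.i_r]
  calc
    _ = K.i ≫ conjIdem X eX D s := h₁.symm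
    _ = 𝟙 _ ⊗≫ (K.i ▷ (𝟙_ C) ≫ _ ◁ D.co s) ⊗≫ conjPush X eX D s (D.mem s) ▷ D.M' s ≫
        ((S.act h).map (con (D.ev s) (D.M s)) ▷ X.obj) ▷ D.M' s := by
      unfold conjIdem conjPush; monoidal
    _ = _ := by rw [← whisker_exchange]; unfold app; monoidal

end ConjSplit

end CrossedStructure
end Existence
-- Comparison with the formulas given by the pivotal structure.
noncomputable section Pivotal

universe v u w₁ w₂ w₃

section

variable {C : Type u} [Category.{v} C] [MonoidalCategory C] [RightRigidCategory C]

/-- One of the two zigzag identities of the dual. -/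
theorem dualMate_evaluation {X Y : C} (p : Y ⊗ X ⟶ 𝟙_ C) : dualMate p ▷ X ≫ ε_ X Xᘁ = p := by
  unfold dualMate
  calc
    _ = 𝟙 _ ⊗≫ Y ◁ η_ X Xᘁ ▷ X ⊗≫ (p ▷ (Xᘁ ⊗ X) ≫ 𝟙_ C ◁ ε_ X Xᘁ) ⊗≫ 𝟙 _ := by monoidal
    _ = 𝟙 _ ⊗≫ Y ◁ (η_ X Xᘁ ▷ X ⊗≫ X ◁ ε_ X Xᘁ) ⊗≫ p ⊗≫ 𝟙 _ := by
      rw [← whisker_exchange]; monoidal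
    _ = _ := by
      rw [ExactPairing.evaluation_coevaluation'']; monoidal

/-- The evaluation `X ⊗ Xᘁ ⟶ 𝟙` given by a pivotal structure. -/
def PivotalStructure.ev (p : PivotalStructure C) (X : C) : X ⊗ Xᘁ ⟶ 𝟙_ C :=
  (p.δ X).hom ▷ Xᘁ ≫ ε_ (Xᘁ) ((Xᘁ)ᘁ)

end

variable {G : Type w₁} {Γ : Type w₂} [Group G] [Group Γ] {P : MatchedPair G Γ}
  {C : Type u} [Category.{v} C] [Preadditive C] [HasFiniteBiproducts C] [MonoidalCategory C]
  [MonoidalPreadditive C] {gr : Γ → ObjectProperty C} [RightRigidCategory C]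

namespace CrossedStructure

variable (S : CrossedStructure P gr) {p : PivotalStructure C} (hp : S.IsPivotal p)

include hp in
/-- The pairing `cap` is the image of the pivotal evaluation. -/
theorem cap_eq {h h' : G} {s : Γ} (e : P.act₂ s h = h') (e' : P.act₂ s⁻¹ h' = h) {μ : C}
    (hμ : gr s μ) (hμ' : gr s⁻¹ μᘁ) :
    S.cap p e hμ = (S.J e' hμ' μ).hom ≫ (S.act h').map (p.ev μ) ≫ (S.φ h').inv := by
  unfold cap
  -- The adjoint mate moves the identification of duals to the other side of the evaluation, where
  -- pivotality of the action replaces δ of the image by the image of δ. Evaluating `dualAct` then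
  -- leaves the image of the pivotal evaluation.
  rw [MonoidalCategory.tensorHom_def, Category.assoc, ← rightAdjointMate_comp_evaluation,
    ← comp_whiskerRight_assoc, ← hp e e' hμ hμ', comp_whiskerRight_assoc, dualAct,
    dualMate_evaluation, reassoc_of% (S.J_natural_left e' hμ' (p.δ μ).hom),
    ← Functor.map_comp_assoc]
  rfl

include hp in
-- By `cap_eq` the pairing is the image of the pivotal evaluation. The coherence of J with the
-- associator and the left unitor moves this contraction from outside the action to inside.
theorem cap_contract {h h' k : G} {s t : Γ} (e : P.act₂ s h = h') {μ ν : C} (hμ : gr s μ)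
    (hν : gr t ν) (e₁ : P.act₂ t k = h') (e₂ : P.act₂ (s⁻¹ * t) k = h)
    (hμν : gr (s⁻¹ * t) (μᘁ ⊗ ν)) :
    (S.act h).obj μ ◁ (S.J e₁ hν μᘁ).hom ≫ (S.J e₂ hμν μ).hom ≫
      (S.act k).map (con (p.ev μ) ν) =
    (α_ _ _ _).inv ≫ S.cap p e hμ ▷ (S.act k).obj ν ≫ (λ_ _).hom := by
  have e' : P.act₂ s⁻¹ h' = h := by rw [← e, ← P.mul_act₂, inv_mul_cancel, P.one_act₂]
  have hμ' := S.grading.mem_dual hμ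
  have h₁ := S.J_assoc' e₁ e' rfl e₂ hμ' hν hμν μ
  have h₂ := S.J_natural_left e₁ hν (p.ev μ)
  have h₃ := S.J_unit_left e₁ hν
  rw [S.cap_eq hp e e' hμ hμ', ← h₃]
  unfold con
  simp only [Functor.map_comp, comp_whiskerRight, Category.assoc]
  rw [← comp_whiskerRight_assoc (S.φ h').inv, Iso.inv_hom_id, id_whiskerRight, Category.id_comp,
    reassoc_of% h₂, ← cancel_epi (α_ _ _ _).hom, ← reassoc_of% h₁, Iso.hom_inv_id_assoc,
    ← (S.act k).map_comp_assoc (α_ _ _ _).hom, Iso.hom_inv_id, CategoryTheory.Functor.map_id,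
    Category.id_comp]

variable {S} (X : S.CenterObj) {h h' : G} (eX : X.deg = h) {s : Γ} (e : P.act₂ s h = h') {μ : C}
  (hμ : gr s μ)

include hp in
-- The formula of the statement contracts with `cap` outside the action, whereas `conjIdem`
-- contracts inside it; `cap_contract` passes from one to the other and cancels the inverse of J.
theorem idem_eq (hμμ : gr 1 (μᘁ ⊗ μ)) : S.idem p X eX e hμ =
    (ρ_ _).inv ≫ S.conj h μ X.obj ◁ η_ μ μᘁ ≫ (α_ _ _ _).inv ≫ ((α_ _ _ _).hom ≫
      push X eX μ hμμ ≫ (S.act h).map (con (p.ev μ) μ) ▷ X.obj) ▷ μᘁ := by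
  have m : gr (s⁻¹ * s) (μᘁ ⊗ μ) := S.grading.tensor (S.grading.mem_dual hμ) hμ
  have e₂ : P.act₂ (s⁻¹ * s) h = h := by rw [inv_mul_cancel, P.one_act₂]
  have h₁ := S.cap_contract hp e hμ hμ e e₂ m
  -- The same J, read for the degree 1 in place of s⁻¹ * s.
  rw [S.J_congr (inv_mul_cancel s) e₂ (P.one_act₂ h) m hμμ] at h₁
  unfold idem push
  symm
  calc
    _ = (ρ_ _).inv ≫ S.conj h μ X.obj ◁ η_ μ μᘁ ⊗≫ (S.act h).obj μ ◁ (X.β eX hμμ).hom ▷ μᘁ ⊗≫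
        ((S.J (P.one_act₂ h) hμμ μ).hom ≫ (S.act h).map (con (p.ev μ) μ)) ▷ (X.obj ⊗ μᘁ) ⊗≫
          𝟙 _ := by monoidal
    _ = (ρ_ _).inv ≫ S.conj h μ X.obj ◁ η_ μ μᘁ ⊗≫ (S.act h).obj μ ◁ (X.β eX hμμ).hom ▷ μᘁ ⊗≫
        ((S.act h).obj μ ◁ (S.J e hμ μᘁ).inv ≫ (S.act h).obj μ ◁ (S.J e hμ μᘁ).hom ≫
          (S.J (P.one_act₂ h) hμμ μ).hom ≫ (S.act h).map (con (p.ev μ) μ)) ▷ (X.obj ⊗ μᘁ) ⊗≫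
          𝟙 _ := by rw [whiskerLeft_inv_hom_assoc]
    _ = _ := by rw [h₁]; monoidal

include hp in
-- The same passage from outside to inside the action as in `idem_eq`, now with ν between μᘁ and μ;
-- the inverse of J for ν and μ survives and frees the image of ν.
theorem crossing_eq {ν : C} (hν : gr 1 ν) (m : gr 1 (μᘁ ⊗ (ν ⊗ μ))) :
    S.crossing p X eX e hμ hν =
    (ρ_ _).inv ≫ (S.conj h μ X.obj ⊗ ν) ◁ η_ μ μᘁ ≫ (α_ _ _ _).inv ≫
      ((α_ _ _ _).hom ≫ (α_ _ _ _).hom ≫ push X eX μ m ≫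
        (S.act h).map (con (p.ev μ) (ν ⊗ μ)) ▷ X.obj ≫ (S.J e hμ ν).inv ▷ X.obj ≫
          (α_ _ _ _).hom) ▷ μᘁ ≫ (α_ _ _ _).hom := by
  have hνμ : gr s (ν ⊗ μ) := S.grading.mem_tensor (one_mul s) hν hμ
  have hμν : gr s⁻¹ (μᘁ ⊗ ν) := S.grading.mem_tensor (mul_one _) (S.grading.mem_dual hμ) hν
  have m₁ : gr 1 ((μᘁ ⊗ ν) ⊗ μ) := S.grading.mem_tensor (inv_mul_cancel s) hμν hμ
  have m₂ : gr (s⁻¹ * s) (μᘁ ⊗ (ν ⊗ μ)) := S.grading.tensor (S.grading.mem_dual hμ) hνμ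
  have e₂ : P.act₂ (s⁻¹ * s) h = h := by rw [inv_mul_cancel, P.one_act₂]
  have h₁ := S.cap_contract hp e hμ hνμ e e₂ m₂
  rw [S.J_congr (inv_mul_cancel s) e₂ (P.one_act₂ h) m₂ m] at h₁
  have h₂ := S.J_assoc' e (P.one_act₂ h') (one_mul s) e hν hμ hνμ μᘁ
  -- The inverted coherence of J trades the isomorphisms for the bracketing (μᘁ ⊗ ν) ⊗ μ for those
  -- of μᘁ ⊗ (ν ⊗ μ), the one used in `braid`.
  have h₃ : (S.J e hμ (μᘁ ⊗ ν)).inv ≫ (S.J₁ h' hν μᘁ).inv ▷ (S.act h).obj μ =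
      (S.act h).map (α_ μᘁ ν μ).hom ≫ (S.J e hνμ μᘁ).inv ≫
        (S.act h').obj μᘁ ◁ (S.J e hμ ν).inv ≫ (α_ _ _ _).inv := by
    have h₄ : IsIso (S.J₁ h' hν μᘁ).hom := inferInstance
    rw [← cancel_epi (S.J e hμ (μᘁ ⊗ ν)).hom, Iso.hom_inv_id_assoc,
      ← cancel_epi ((S.J₁ h' hν μᘁ).hom ▷ (S.act h).obj μ), ← comp_whiskerRight, Iso.hom_inv_id,
      id_whiskerRight]
    unfold J₁
    rw [reassoc_of% h₂, Iso.hom_inv_id_assoc, whiskerLeft_hom_inv_assoc, Iso.hom_inv_id]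
  have h₅ := X.β_natural eX m₁ m (α_ μᘁ ν μ).hom
  unfold crossing push
  simp only [h₃]
  symm
  calc
    _ = (ρ_ _).inv ≫ (S.conj h μ X.obj ⊗ ν) ◁ η_ μ μᘁ ⊗≫
        (S.act h).obj μ ◁ (X.β eX m).hom ▷ μᘁ ⊗≫
        ((S.J (P.one_act₂ h) m μ).hom ≫ (S.act h).map (con (p.ev μ) (ν ⊗ μ)) ≫
          (S.J e hμ ν).inv) ▷ (X.obj ⊗ μᘁ) ⊗≫ 𝟙 _ := by monoidal
    _ = (ρ_ _).inv ≫ (S.conj h μ X.obj ⊗ ν) ◁ η_ μ μᘁ ⊗≫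
        (S.act h).obj μ ◁ (X.β eX m).hom ▷ μᘁ ⊗≫
        ((S.act h).obj μ ◁ (S.J e hνμ μᘁ).inv ≫ ((S.act h).obj μ ◁ (S.J e hνμ μᘁ).hom ≫
          (S.J (P.one_act₂ h) m μ).hom ≫ (S.act h).map (con (p.ev μ) (ν ⊗ μ))) ≫
          (S.J e hμ ν).inv) ▷ (X.obj ⊗ μᘁ) ⊗≫ 𝟙 _ := by
      simp only [Category.assoc]
      rw [whiskerLeft_inv_hom_assoc]
    _ = (ρ_ _).inv ≫ (S.conj h μ X.obj ⊗ ν) ◁ η_ μ μᘁ ⊗≫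
        (S.act h).obj μ ◁ (X.β eX m).hom ▷ μᘁ ⊗≫
        ((S.act h).obj μ ◁ (S.J e hνμ μᘁ).inv ⊗≫ (S.cap p e hμ ▷ (S.act h).obj (ν ⊗ μ) ≫
          𝟙_ C ◁ (S.J e hμ ν).inv)) ▷ (X.obj ⊗ μᘁ) ⊗≫ 𝟙 _ := by
      rw [h₁]; monoidal
    _ = (ρ_ _).inv ≫ (S.conj h μ X.obj ⊗ ν) ◁ η_ μ μᘁ ⊗≫
        (S.act h).obj μ ◁ ((X.obj ◁ (α_ μᘁ ν μ).hom ≫ (X.β eX m).hom) ≫ ((S.J e hνμ μᘁ).inv ≫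
        (S.act h').obj μᘁ ◁ (S.J e hμ ν).inv ≫ (α_ _ _ _).inv) ▷ X.obj) ▷ μᘁ ⊗≫
        S.cap p e hμ ▷ ((S.act h').obj ν ⊗ S.conj h μ X.obj) ≫ (λ_ _).hom := by
      rw [← whisker_exchange]; monoidal
    _ = _ := by
      rw [h₅]; monoidal

/-- The splitting of the unit given by objects of nonzero dimension of a pivotal category. -/
def pivotalSplitting {k : Type w₃} [Field k] [Linear k C] (hg : IsMonoidalGrading gr)
    {ζ : Γ → C} (hζ : ∀ s, gr s (ζ s)) {d : Γ → k}
    (hd : ∀ s, d s ≠ 0 ∧ p.dim (ζ s) = d s • 𝟙 (𝟙_ C)) : Splitting gr where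
  M := ζ
  M' s := (ζ s)ᘁ
  mem := hζ
  mem' s := hg.mem_dual (hζ s)
  co s := η_ (ζ s) (ζ s)ᘁ
  -- Unscaled, coevaluation followed by the pivotal evaluation is the dimension; this is the origin
  -- of the factor d⁻¹ in the idempotent and the half-braiding.
  ev s := (d s)⁻¹ • p.ev (ζ s)
  co_ev s := by
    rw [Linear.comp_smul]
    exact (congrArg _ (hd s).2).trans (by rw [smul_smul, inv_mul_cancel₀ (hd s).1, one_smul])

section Linear

variable {k : Type w₃} [Field k] [Linear k C] [MonoidalLinear k C]
  (hlin : ∀ g, (S.act g).Linear k) {ζ : Γ → C} (hζ : ∀ s, gr s (ζ s)) {d : Γ → k}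
  (hd : ∀ s, d s ≠ 0 ∧ p.dim (ζ s) = d s • 𝟙 (𝟙_ C))

theorem con_smul {A B : C} (c : k) (ev : A ⊗ B ⟶ 𝟙_ C) (R : C) :
    con (c • ev) R = c • con ev R := by
  unfold con
  rw [MonoidalLinear.smul_whiskerRight, Linear.smul_comp, Linear.comp_smul]

theorem conjIdem_smul [∀ g, (S.act g).Linear k] (D : Splitting gr) (s : Γ) {c : k}
    {ev : D.M s ⊗ D.M' s ⟶ 𝟙_ C} (h₁ : D.ev s = c • ev) (m : gr 1 (D.M' s ⊗ D.M s)) :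
    conjIdem X eX D s = c • ((ρ_ _).inv ≫ conjObj D s X h ◁ D.co s ≫ (α_ _ _ _).inv ≫
      ((α_ _ _ _).hom ≫ push X eX (D.M s) m ≫
        (S.act h).map (con ev (D.M s)) ▷ X.obj) ▷ D.M' s) := by
  unfold conjIdem
  rw [h₁, con_smul, Functor.map_smul, MonoidalLinear.smul_whiskerRight, Linear.comp_smul,
    Linear.comp_smul, MonoidalLinear.smul_whiskerRight, Linear.comp_smul, Linear.comp_smul,
    Linear.comp_smul]

theorem braid_smul [∀ g, (S.act g).Linear k] {D : Splitting gr} {s : Γ} {c : k}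
    {ev : D.M s ⊗ D.M' s ⟶ 𝟙_ C} (h₁ : D.ev s = c • ev) (K : ConjSplit X eX D s)
    (e : P.act₂ s h = h') {ν : C} (hν : gr 1 ν) (m : gr 1 (D.M' s ⊗ (ν ⊗ D.M s))) :
    K.braid e hν = c • (K.i ▷ ν ≫ ((ρ_ _).inv ≫ (conjObj D s X h ⊗ ν) ◁ D.co s ≫ (α_ _ _ _).inv ≫
      ((α_ _ _ _).hom ≫ (α_ _ _ _).hom ≫ push X eX (D.M s) m ≫
        (S.act h).map (con ev (ν ⊗ D.M s)) ▷ X.obj ≫ (S.J e (D.mem s) ν).inv ▷ X.obj ≫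
          (α_ _ _ _).hom) ▷ D.M' s ≫ (α_ _ _ _).hom) ≫ (S.act h').obj ν ◁ K.r) := by
  unfold ConjSplit.braid ConjSplit.app conjPush
  rw [h₁, con_smul, Functor.map_smul, MonoidalLinear.smul_whiskerRight]
  simp only [Linear.comp_smul, Linear.smul_comp, MonoidalLinear.smul_whiskerRight]
  congr 1
  simp only [Category.assoc]
  rw [rightUnitor_inv_naturality_assoc, ← whisker_exchange_assoc,
    associator_inv_naturality_left_assoc, ← comp_whiskerRight_assoc (K.i ▷ ν ▷ D.M s),
    associator_naturality_left_assoc]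

include hp hlin in
theorem conjIdem_eq (s : Γ) :
    conjIdem X eX (pivotalSplitting S.grading hζ hd) s =
      (d s)⁻¹ • S.idem p X eX rfl (hζ s) := by
  have := hlin
  have m := S.grading.mem_tensor (inv_mul_cancel s) (S.grading.mem_dual (hζ s)) (hζ s)
  rw [idem_eq hp X eX rfl (hζ s) m]
  exact conjIdem_smul X eX (pivotalSplitting S.grading hζ hd) s (ev := p.ev (ζ s)) rfl m

include hp hlin in
theorem braid_eq {s : Γ} (K : ConjSplit X eX (pivotalSplitting S.grading hζ hd) s)
    (e : P.act₂ s h = h') {ν : C} (hν : gr 1 ν) : K.braid e hν =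
      (d s)⁻¹ • (K.i ▷ ν ≫ S.crossing p X eX e (hζ s) hν ≫ (S.act h').obj ν ◁ K.r) := by
  have := hlin
  have m := S.grading.mem_tensor (inv_mul_cancel s) (S.grading.mem_dual (hζ s))
    (S.grading.mem_tensor (one_mul s) hν (hζ s))
  rw [crossing_eq hp X eX e (hζ s) hν m]
  exact braid_smul X eX (D := pivotalSplitting S.grading hζ hd) (ev := p.ev (ζ s)) rfl K e hν m

end Linear

end CrossedStructure
end Pivotal
-- The action on homogeneous objects and its coherence, by universal property.
noncomputable section Cleavages

universe v u w₁ w₂ w₃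
variable {G : Type w₁} {Γ : Type w₂} [Group G] [Group Γ] {P : MatchedPair G Γ}
  {C : Type u} [Category.{v} C] [Preadditive C] [HasFiniteBiproducts C] [MonoidalCategory C]
  [MonoidalPreadditive C] {gr : Γ → ObjectProperty C}

namespace CrossedStructure

/-- A choice of invertible arrows into all objects. -/
structure Cleavage (S : CrossedStructure P gr) where
  D : Splitting gr
  obj : Γ → S.CenterObj → S.CenterObj
  arr : ∀ s X, Arr S s (obj s X) X
  inv : ∀ s X, (arr s X).Inv

theorem CenterObj.deg_tensor_congr {S : CrossedStructure P gr} {X X' Y Y' : S.CenterObj}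
    (h : X.deg = X'.deg) (h' : Y.deg = Y'.deg) :
    (CenterObj.tensor X Y).deg = (CenterObj.tensor X' Y').deg :=
  congrArg₂ (· * ·) h h'

namespace Cleavage

variable {S : CrossedStructure P gr} (T : S.Cleavage) {s t r : Γ} {X Y Z W : S.CenterObj}

theorem deg_obj (s : Γ) (X : S.CenterObj) : (T.obj s X).deg = P.act₂ s X.deg :=
  (T.arr s X).deg_eq.symm

theorem deg_obj_eq (h : X.deg = Y.deg) : (T.obj s X).deg = (T.obj s Y).deg := by
  rw [deg_obj, deg_obj, h]

open Classical in
/-- The functoriality of the action of `s`. -/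
def map (s : Γ) (f : X ⟶ Y) : T.obj s X ⟶ T.obj s Y :=
  -- Between different degrees only the zero morphism exists, so zero is the only additive choice
  -- there.
  if h : X.deg = Y.deg then
    Arr.lift T.D (T.inv s Y) ((T.arr s X).postcomp f h) (T.deg_obj_eq h)
  else 0

theorem precomp_map (h : X.deg = Y.deg) (f : X ⟶ Y)
    (h' : (T.obj s X).deg = (T.obj s Y).deg) :
    (T.arr s Y).precomp (T.map s f) h' = (T.arr s X).postcomp f h := by
  unfold map
  rw [dif_pos h, Arr.lift_spec]

theorem map_app (h : X.deg = Y.deg) (f : X ⟶ Y) {a : G} (eY : Y.deg = a) {μ : C} (hμ : gr s μ) :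
    (T.map s f).hom ▷ μ ≫ (T.arr s Y).app eY hμ =
      (T.arr s X).app (h.trans eY) hμ ≫ _ ◁ f.hom :=
  congrArg (fun c => c.app eY hμ) (T.precomp_map h f (T.deg_obj_eq h))

theorem hom_eq_zero {X Y : S.CenterObj} (h : X.deg ≠ Y.deg) (f : X ⟶ Y) : f = 0 :=
  CenterObj.hom_ext (f.mem.1 h)

theorem map_of_ne (h : X.deg ≠ Y.deg) (f : X ⟶ Y) : T.map s f = 0 := dif_neg h

theorem hom_ext {f f' : Y ⟶ T.obj s X} (hY : Y.deg = (T.obj s X).deg)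
    (h : ∀ {μ : C} (hμ : gr s μ), f.hom ▷ μ ≫ (T.arr s X).app rfl hμ =
      f'.hom ▷ μ ≫ (T.arr s X).app rfl hμ) : f = f' :=
  Arr.lift_unique T.D (T.inv s X) hY (Arr.ext' fun {a} eX {μ} hμ => by subst eX; exact h hμ)

theorem map_add (f g : X ⟶ Y) : T.map s (f + g) = T.map s f + T.map s g := by
  by_cases h : X.deg = Y.deg
  · refine T.hom_ext (T.deg_obj_eq h) fun {μ} hμ => ?_
    rw [T.map_app h, CenterObj.add_hom, CenterObj.add_hom, MonoidalPreadditive.whiskerLeft_add,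
      Preadditive.comp_add, MonoidalPreadditive.add_whiskerRight, Preadditive.add_comp,
      T.map_app h, T.map_app h]
  · rw [T.map_of_ne h, T.map_of_ne h, T.map_of_ne h, add_zero]

theorem map_zero : T.map s (0 : X ⟶ Y) = 0 := by
  have := T.map_add (s := s) (0 : X ⟶ Y) 0
  rwa [add_zero, left_eq_add] at this

theorem map_smul {k : Type w₃} [Field k] [Linear k C] [MonoidalLinear k C] (c : k) (f : X ⟶ Y) :
    T.map s (c • f) = c • T.map s f := by
  by_cases h : X.deg = Y.deg
  · refine T.hom_ext (T.deg_obj_eq h) fun {μ} hμ => ?_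
    rw [T.map_app h, CenterObj.smul_hom, CenterObj.smul_hom, MonoidalLinear.whiskerLeft_smul,
      Linear.comp_smul, MonoidalLinear.smul_whiskerRight, Linear.smul_comp, T.map_app h]
  · rw [T.map_of_ne h, T.map_of_ne h, smul_zero]

/-- The action of `s`. -/
def functor (s : Γ) : S.CenterObj ⥤ S.CenterObj where
  obj := T.obj s
  map := T.map s
  -- Morphisms into the source of an invertible arrow are compared after composition with that
  -- arrow. The naturality and coherence laws below follow the same pattern: the defining properties
  -- of the factorizations reduce them to identities of arrows.
  map_id X := Arr.lift_unique T.D (T.inv s X) rfl (by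
    rw [T.precomp_map rfl, Arr.precomp_id, Arr.postcomp_id])
  map_comp {X Y Z} f g := by
    by_cases h : X.deg = Y.deg
    · by_cases h' : Y.deg = Z.deg
      · refine Arr.lift_unique T.D (T.inv s Z) (T.deg_obj_eq (h.trans h')) ?_
        rw [T.precomp_map (h.trans h'),
          ← Arr.precomp_precomp _ (T.deg_obj_eq h) _ (T.deg_obj_eq h'), T.precomp_map h',
          ← Arr.precomp_postcomp, T.precomp_map h, Arr.postcomp_postcomp]
      · rw [T.map_of_ne h', T.map_of_ne (fun e => h' (h.symm.trans e)), comp_zero]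
    · rw [T.map_of_ne h, zero_comp, hom_eq_zero h f, zero_comp, map_zero]

instance (s : Γ) : (T.functor s).Additive where
  map_add := T.map_add _ _

theorem deg_comp (e : s * t = r) (X : S.CenterObj) :
    (T.obj s (T.obj t X)).deg = (T.obj r X).deg := by
  rw [deg_obj, deg_obj, deg_obj, ← e, P.mul_act₂]

/-- The composition isomorphism at an object. -/
def compIso (e : s * t = r) (X : S.CenterObj) : T.obj s (T.obj t X) ≅ T.obj r X :=
  Arr.liftIso T.D (T.inv r X) (Arr.comp_inv T.D e (T.inv s (T.obj t X)) (T.inv t X))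
    (T.deg_comp e X)

theorem precomp_compIso (e : s * t = r) (X : S.CenterObj)
    (h : (T.obj s (T.obj t X)).deg = (T.obj r X).deg) :
    (T.arr r X).precomp (T.compIso e X).hom h =
      Arr.comp T.D e (T.arr s (T.obj t X)) (T.arr t X) :=
  Arr.lift_spec T.D (T.inv r X) _ _

theorem compIso_naturality (e : s * t = r) (f : X ⟶ Y) :
    T.map s (T.map t f) ≫ (T.compIso e Y).hom = (T.compIso e X).hom ≫ T.map r f := by
  by_cases h : X.deg = Y.deg
  · refine Arr.lift_unique T.D (T.inv r Y) ((T.deg_comp e X).trans (T.deg_obj_eq h)) ?_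
    rw [← Arr.precomp_precomp _ (T.deg_obj_eq (T.deg_obj_eq h)) _ (T.deg_comp e Y),
      ← Arr.precomp_precomp _ (T.deg_comp e X) _ (T.deg_obj_eq h), precomp_compIso,
      T.precomp_map h, ← Arr.precomp_comp, T.precomp_map (T.deg_obj_eq h), Arr.postcomp_comp,
      T.precomp_map h, Arr.comp_postcomp, ← T.precomp_compIso e X (T.deg_comp e X),
      Arr.precomp_postcomp]
  · rw [T.map_of_ne h, T.map_of_ne h, T.map_zero, zero_comp, comp_zero]

theorem deg_unit (X : S.CenterObj) : X.deg = (T.obj 1 X).deg := by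
  rw [deg_obj, P.one_act₂]

/-- The unit isomorphism at an object. -/
def unitIso (X : S.CenterObj) : X ≅ T.obj 1 X :=
  Arr.liftIso T.D (T.inv 1 X) (Arr.id_inv X) (T.deg_unit X)

theorem precomp_unitIso (X : S.CenterObj) (h : X.deg = (T.obj 1 X).deg) :
    (T.arr 1 X).precomp (T.unitIso X).hom h = Arr.id X :=
  Arr.lift_spec T.D (T.inv 1 X) _ _

theorem unitIso_naturality (f : X ⟶ Y) :
    f ≫ (T.unitIso Y).hom = (T.unitIso X).hom ≫ T.map 1 f := by
  by_cases h : X.deg = Y.deg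
  · refine Arr.lift_unique T.D (T.inv 1 Y) (h.trans (T.deg_unit Y)) ?_
    rw [← Arr.precomp_precomp _ h _ (T.deg_unit Y),
      ← Arr.precomp_precomp _ (T.deg_unit X) _ (T.deg_obj_eq h), precomp_unitIso, T.precomp_map h,
      ← Arr.precomp_postcomp, precomp_unitIso, Arr.id_precomp]
  · rw [T.map_of_ne h, hom_eq_zero h f, zero_comp, comp_zero]

/-- The unit isomorphism. -/
def unitNatIso {s : Γ} (hs : s = 1) : 𝟭 S.CenterObj ≅ T.functor s := by
  subst hs
  exact NatIso.ofComponents T.unitIso fun f => T.unitIso_naturality f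

/-- The action of the group on the homogeneous objects of the crossed center. -/
def groupAction : GroupAction Γ S.CenterObj where
  act := T.functor
  χ e := NatIso.ofComponents (T.compIso e) (fun f => T.compIso_naturality e f)
  ι {e} he := T.unitNatIso he
  χ_assoc {g h k gh hk ghk} e₁ e₂ e₃ e₄ X := by
    change (T.compIso e₁ (T.obj k X)).hom ≫ (T.compIso e₃ X).hom =
      T.map g (T.compIso e₂ X).hom ≫ (T.compIso e₄ X).hom
    have d₁ := T.deg_comp e₁ (T.obj k X)
    have d₂ := T.deg_comp e₂ X
    -- Both sides are factorizations of triple composites of arrows, which agree by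
    -- `Arr.comp_assoc`.
    refine Arr.lift_unique T.D (T.inv ghk X) (d₁.trans (T.deg_comp e₃ X)) ?_
    rw [← Arr.precomp_precomp _ d₁ _ (T.deg_comp e₃ X),
      ← Arr.precomp_precomp _ (T.deg_obj_eq d₂) _ (T.deg_comp e₄ X), precomp_compIso,
      precomp_compIso, ← Arr.precomp_comp, ← Arr.precomp_comp, precomp_compIso,
      T.precomp_map d₂, Arr.postcomp_comp, precomp_compIso, Arr.comp_assoc T.D e₁ e₃ e₂ e₄]
  ι_χ {e g} he h X := by
    subst he
    change (T.unitIso _).hom ≫ (T.compIso h X).hom = 𝟙 (T.obj g X)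
    refine Arr.lift_unique T.D (T.inv g X) rfl ?_
    rw [Arr.precomp_id, ← Arr.precomp_precomp _ (T.deg_unit _) _ (T.deg_comp h X),
      precomp_compIso, ← Arr.precomp_comp, precomp_unitIso, Arr.id_comp]
  χ_ι {e g} he h X := by
    subst he
    change T.map g (T.unitIso X).hom ≫ (T.compIso h X).hom = 𝟙 (T.obj g X)
    refine Arr.lift_unique T.D (T.inv g X) rfl ?_
    rw [Arr.precomp_id,
      ← Arr.precomp_precomp _ (T.deg_obj_eq (T.deg_unit _)) _ (T.deg_comp h X),
      precomp_compIso, ← Arr.precomp_comp, T.precomp_map (T.deg_unit X), Arr.postcomp_comp,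
      precomp_unitIso, Arr.comp_id]

section Tensor

variable (Y)

theorem deg_tensor (e : P.act₁ Y.deg s = t) (X : S.CenterObj) :
    (CenterObj.tensor (T.obj t X) (T.obj s Y)).deg = (T.obj s (CenterObj.tensor X Y)).deg := by
  rw [deg_obj]
  change (T.obj t X).deg * (T.obj s Y).deg = P.act₂ s (X.deg * Y.deg)
  rw [deg_obj, deg_obj, P.act₂_mul, e]

/-- The compatibility of the action with the tensor product. -/
def tensorIso (e : P.act₁ Y.deg s = t) (X : S.CenterObj) :
    CenterObj.tensor (T.obj t X) (T.obj s Y) ≅ T.obj s (CenterObj.tensor X Y) :=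
  Arr.liftIso T.D (T.inv s _) (Arr.tensor_inv e (T.inv t X) (T.inv s Y)) (T.deg_tensor Y e X)

theorem precomp_tensorIso (e : P.act₁ Y.deg s = t) (X : S.CenterObj) (h) :
    (T.arr s (CenterObj.tensor X Y)).precomp (T.tensorIso Y e X).hom h =
      Arr.tensor e (T.arr t X) (T.arr s Y) :=
  Arr.lift_spec T.D (T.inv s _) _ _

variable {Y}

theorem tensorIso_naturality {X' Y' : S.CenterObj} (e : P.act₁ Y.deg s = t)
    (e' : P.act₁ Y'.deg s = t) (h : Y.deg = Y'.deg) (f : X ⟶ X') (f' : Y ⟶ Y') :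
    CenterObj.tensorHom (T.map t f) (T.map s f') ≫ (T.tensorIso Y' e' X').hom =
      (T.tensorIso Y e X).hom ≫ T.map s (CenterObj.tensorHom f f') := by
  by_cases h' : X.deg = X'.deg
  · have h₁ : (CenterObj.tensor X Y).deg = (CenterObj.tensor X' Y').deg :=
      CenterObj.deg_tensor_congr h' h
    refine Arr.lift_unique T.D (T.inv s _) ((T.deg_tensor Y e X).trans (T.deg_obj_eq h₁)) ?_
    rw [← Arr.precomp_precomp _ (CenterObj.deg_tensor_congr (T.deg_obj_eq h') (T.deg_obj_eq h)) _
        (T.deg_tensor Y' e' X'), precomp_tensorIso,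
      ← Arr.tensor_precomp (hf := T.deg_obj_eq h') (hf' := T.deg_obj_eq h), T.precomp_map h',
      T.precomp_map h, Arr.tensor_postcomp e' e,
      ← Arr.precomp_precomp _ (T.deg_tensor Y e X) _ (T.deg_obj_eq h₁), T.precomp_map h₁,
      ← Arr.precomp_postcomp, precomp_tensorIso]
  -- As Y and Y' have the same degree, cancellation in G shows that the tensor products also have
  -- different degrees; both sides vanish.
  · have h₁ : (CenterObj.tensor X Y).deg ≠ (CenterObj.tensor X' Y').deg := fun h'' => by
      refine h' (mul_right_cancel (b := Y.deg) ?_)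
      conv_rhs => rw [h]
      exact h''
    rw [T.map_of_ne h₁, comp_zero, T.map_of_ne h']
    have : CenterObj.tensorHom (0 : T.obj t X ⟶ T.obj t X') (T.map s f') = 0 :=
      MonoidalPreadditive.zero_tensor (C := S.CenterObj) _
    rw [this, zero_comp]

theorem deg_unitObj (s : Γ) :
    (CenterObj.unit : S.CenterObj).deg = (T.obj s CenterObj.unit).deg := by
  rw [deg_obj]
  exact (P.act₂_one s).symm

/-- The compatibility of the action with the unit. -/
def unitObjIso (s : Γ) : (CenterObj.unit : S.CenterObj) ≅ T.obj s CenterObj.unit :=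
  Arr.liftIso T.D (T.inv s _) (Arr.unit_inv s) (T.deg_unitObj s)

theorem precomp_unitObjIso (s : Γ) (h) :
    (T.arr s CenterObj.unit).precomp (T.unitObjIso s).hom h = Arr.unit s :=
  Arr.lift_spec T.D (T.inv s _) _ _

/-- Coherence of `tensorIso` with the associators. -/
theorem tensorIso_assoc {q : Γ} (e : P.act₁ Z.deg s = t) (e' : P.act₁ Y.deg t = q)
    (e'' : P.act₁ (CenterObj.tensor Y Z).deg s = q) (X : S.CenterObj) :
    CenterObj.tensorHom (T.tensorIso Y e' X).hom (𝟙 (T.obj s Z)) ≫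
        (T.tensorIso Z e (CenterObj.tensor X Y)).hom ≫ T.map s (CenterObj.assoc X Y Z).hom =
      (CenterObj.assoc _ _ _).hom ≫ CenterObj.tensorHom (𝟙 (T.obj q X)) (T.tensorIso Z e Y).hom ≫
        (T.tensorIso (CenterObj.tensor Y Z) e'' X).hom := by
  have d₁ : (CenterObj.tensor (CenterObj.tensor X Y) Z).deg =
    (CenterObj.tensor X (CenterObj.tensor Y Z)).deg := mul_assoc _ _ _
  have d₂ := T.deg_tensor Z e (CenterObj.tensor X Y)
  have d₃ := T.deg_tensor (CenterObj.tensor Y Z) e'' X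
  have d₄ := T.deg_tensor Y e' X
  have d₅ := T.deg_tensor Z e Y
  have d₆ : (CenterObj.tensor (CenterObj.tensor (T.obj q X) (T.obj t Y)) (T.obj s Z)).deg =
    (CenterObj.tensor (T.obj q X) (CenterObj.tensor (T.obj t Y) (T.obj s Z))).deg :=
    mul_assoc _ _ _
  refine Arr.lift_unique T.D (T.inv s _)
    ((CenterObj.deg_tensor_congr d₄ rfl).trans (d₂.trans (T.deg_obj_eq d₁))) ?_
  rw [← Arr.precomp_precomp _ (CenterObj.deg_tensor_congr d₄ rfl) _ (d₂.trans (T.deg_obj_eq d₁)),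
    ← Arr.precomp_precomp _ d₂ _ (T.deg_obj_eq d₁), T.precomp_map d₁, ← Arr.precomp_postcomp,
    precomp_tensorIso, ← Arr.precomp_postcomp,
    ← Arr.tensor_precomp (hf := d₄) (hf' := rfl), precomp_tensorIso, Arr.precomp_id]
  rw [← Arr.precomp_precomp _ d₆ _ ((CenterObj.deg_tensor_congr rfl d₅).trans d₃),
    ← Arr.precomp_precomp _ (CenterObj.deg_tensor_congr rfl d₅) _ d₃, precomp_tensorIso,
    ← Arr.tensor_precomp (hf := rfl) (hf' := d₅), precomp_tensorIso, Arr.precomp_id]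
  exact (Arr.tensor_assoc e' e e'' _ _ _).symm

theorem tensorIso_unit_left (e : P.act₁ X.deg s = t) :
    CenterObj.tensorHom (T.unitObjIso t).hom (𝟙 (T.obj s X)) ≫
        (T.tensorIso X e CenterObj.unit).hom ≫ T.map s (CenterObj.leftUnitor X).hom =
      (CenterObj.leftUnitor _).hom := by
  have d₁ : (CenterObj.tensor CenterObj.unit X).deg = X.deg := one_mul _
  have d₂ := T.deg_tensor X e CenterObj.unit
  have d₃ := T.deg_unitObj t
  refine Arr.lift_unique T.D (T.inv s _)
    ((CenterObj.deg_tensor_congr d₃ rfl).trans (d₂.trans (T.deg_obj_eq d₁))) ?_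
  rw [← Arr.precomp_precomp _ (CenterObj.deg_tensor_congr d₃ rfl) _ (d₂.trans (T.deg_obj_eq d₁)),
    ← Arr.precomp_precomp _ d₂ _ (T.deg_obj_eq d₁), T.precomp_map d₁, ← Arr.precomp_postcomp,
    precomp_tensorIso, ← Arr.precomp_postcomp,
    ← Arr.tensor_precomp (hf := d₃) (hf' := rfl), precomp_unitObjIso, Arr.precomp_id]
  exact (Arr.unit_tensor e _).symm

theorem tensorIso_unit_right (e : P.act₁ (CenterObj.unit : S.CenterObj).deg s = s) :
    CenterObj.tensorHom (𝟙 (T.obj s X)) (T.unitObjIso s).hom ≫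
        (T.tensorIso CenterObj.unit e X).hom ≫ T.map s (CenterObj.rightUnitor X).hom =
      (CenterObj.rightUnitor _).hom := by
  have d₁ : (CenterObj.tensor X CenterObj.unit).deg = X.deg := mul_one _
  have d₂ := T.deg_tensor CenterObj.unit e X
  have d₃ := T.deg_unitObj s
  refine Arr.lift_unique T.D (T.inv s _)
    ((CenterObj.deg_tensor_congr rfl d₃).trans (d₂.trans (T.deg_obj_eq d₁))) ?_
  rw [← Arr.precomp_precomp _ (CenterObj.deg_tensor_congr rfl d₃) _ (d₂.trans (T.deg_obj_eq d₁)),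
    ← Arr.precomp_precomp _ d₂ _ (T.deg_obj_eq d₁), T.precomp_map d₁, ← Arr.precomp_postcomp,
    precomp_tensorIso, ← Arr.precomp_postcomp,
    ← Arr.tensor_precomp (hf := rfl) (hf' := d₃), precomp_unitObjIso, Arr.precomp_id]
  exact (Arr.tensor_unit e rfl _ _ rfl).symm

/-- One side factors the composite of two tensor products of arrows, the other the tensor product of
two composites; these agree by `Arr.comp_tensor`, which rests on `J_χ` in C. -/
theorem tensorIso_comp {s' t' r' : Γ} (e : s * t = r) (e' : s' * t' = r')
    (e₁ : P.act₁ Y.deg t = t') (e₂ : P.act₁ (T.obj t Y).deg s = s') (e₃ : P.act₁ Y.deg r = r')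
    (X : S.CenterObj) :
    (T.tensorIso (T.obj t Y) e₂ (T.obj t' X)).hom ≫ T.map s (T.tensorIso Y e₁ X).hom ≫
        (T.compIso e (CenterObj.tensor X Y)).hom =
      CenterObj.tensorHom (T.compIso e' X).hom (T.compIso e Y).hom ≫
        (T.tensorIso Y e₃ X).hom := by
  have d₁ := T.deg_tensor (T.obj t Y) e₂ (T.obj t' X)
  have d₂ := T.deg_tensor Y e₁ X
  have d₃ := T.deg_comp e (CenterObj.tensor X Y)
  have d₄ := T.deg_tensor Y e₃ X
  have d₅ : (CenterObj.tensor (T.obj s' (T.obj t' X)) (T.obj s (T.obj t Y))).deg =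
      (CenterObj.tensor (T.obj r' X) (T.obj r Y)).deg :=
    CenterObj.deg_tensor_congr (T.deg_comp e' X) (T.deg_comp e Y)
  refine Arr.lift_unique T.D (T.inv r _) (d₅.trans d₄) ?_
  rw [← Arr.precomp_precomp _ d₁ _ ((T.deg_obj_eq d₂).trans d₃),
    ← Arr.precomp_precomp _ (T.deg_obj_eq d₂) _ d₃, precomp_compIso, ← Arr.precomp_comp,
    T.precomp_map d₂, Arr.postcomp_comp, precomp_tensorIso, ← Arr.precomp_comp, precomp_tensorIso,
    ← Arr.precomp_precomp _ d₅ _ d₄, precomp_tensorIso,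
    ← Arr.tensor_precomp (hf := T.deg_comp e' X) (hf' := T.deg_comp e Y), precomp_compIso,
    precomp_compIso, Arr.comp_tensor T.D e' e e₂ e₁ e₃]

theorem unitObjIso_comp (e : s * t = r) :
    (T.unitObjIso s).hom ≫ T.map s (T.unitObjIso t).hom ≫ (T.compIso e CenterObj.unit).hom =
      (T.unitObjIso r).hom := by
  have d₁ := T.deg_unitObj s
  have d₂ := T.deg_unitObj t
  have d₃ := T.deg_comp e CenterObj.unit
  refine Arr.lift_unique T.D (T.inv r _) (T.deg_unitObj r) ?_
  rw [← Arr.precomp_precomp _ d₁ _ ((T.deg_obj_eq d₂).trans d₃),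
    ← Arr.precomp_precomp _ (T.deg_obj_eq d₂) _ d₃, precomp_compIso, ← Arr.precomp_comp,
    T.precomp_map d₂, Arr.postcomp_comp, precomp_unitObjIso, ← Arr.precomp_comp,
    precomp_unitObjIso, precomp_unitObjIso, Arr.unit_comp_unit]

theorem tensorIso_unitIso (e : P.act₁ Y.deg 1 = 1) :
    CenterObj.tensorHom (T.unitIso X).hom (T.unitIso Y).hom ≫ (T.tensorIso Y e X).hom =
      (T.unitIso (CenterObj.tensor X Y)).hom := by
  refine Arr.lift_unique T.D (T.inv 1 _) (T.deg_unit _) ?_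
  rw [← Arr.precomp_precomp _ (CenterObj.deg_tensor_congr (T.deg_unit X) (T.deg_unit Y)) _
    (T.deg_tensor Y e X), precomp_tensorIso,
    ← Arr.tensor_precomp (hf := T.deg_unit X) (hf' := T.deg_unit Y), precomp_unitIso,
    precomp_unitIso, precomp_unitIso, Arr.id_tensor]

theorem unitIso_unit : (T.unitIso CenterObj.unit).hom = (T.unitObjIso 1).hom := by
  refine Arr.lift_unique T.D (T.inv 1 _) (T.deg_unit _) ?_
  rw [precomp_unitIso, precomp_unitObjIso, Arr.id_unit]

end Tensor

end Cleavage
end CrossedStructure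
end Cleavages
-- Extension of crossed data to formal direct sums.
noncomputable section

universe v u w₁ w₂

namespace FormalSum

variable {D : Type u} [Category.{v} D] [Preadditive D]

theorem entry_mapMat (F : D ⥤ D) [F.Additive] {M N : Mat_ D} (f : M ⟶ N) (i : M.ι) (j : N.ι) :
    entry (M := F.mapMat_.obj M) (N := F.mapMat_.obj N) (F.mapMat_.map f) i j =
      F.map (entry f i j) := rfl

theorem mapMat_along (F : D ⥤ D) [F.Additive] {M N : Mat_ D} (σ : M.ι → N.ι)
    (a : ∀ i, M.X i ⟶ N.X (σ i)) :
    F.mapMat_.map (along σ a) =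
      along (M := F.mapMat_.obj M) (N := F.mapMat_.obj N) σ (fun i => F.map (a i)) :=
  entry_ext fun i j => by
    refine (entry_mapMat F (along σ a) i j).trans ?_
    refine (F.map_comp (a i) (entry (𝟙 N) (σ i) j)).trans (congrArg (F.map (a i) ≫ ·) ?_)
    refine (entry_mapMat F (𝟙 N) (σ i) j).symm.trans ?_
    rw [F.mapMat_.map_id]

instance (F : D ⥤ D) [F.Additive] : F.mapMat_.Additive where
  map_add {_ _ f g} := entry_ext fun i j => F.map_add (f := entry f i j) (g := entry g i j)

/-- The morphism `f` of formal sums has the entries `a i` at `(i, σ i)` and zero elsewhere. -/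
def IsAlong {M N : Mat_ D} (f : M ⟶ N) (σ : M.ι → N.ι) (a : ∀ i, M.X i ⟶ N.X (σ i)) : Prop :=
  f = along σ a

namespace IsAlong

variable {M N K : Mat_ D} {f : M ⟶ N} {σ : M.ι → N.ι} {a : ∀ i, M.X i ⟶ N.X (σ i)}

/-- The coherence isomorphisms of formal sums have one prescribed entry in each row. As the index
maps of two composites agree definitionally in the applications, a coherence law reduces to the same
law for the summands. -/
theorem eq {f' : M ⟶ N} {b : ∀ i, M.X i ⟶ N.X (σ i)} (h : IsAlong f σ a) (h' : IsAlong f' σ b)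
    (hab : ∀ i, a i = b i) : f = f' :=
  Eq.trans h ((congrArg (along σ) (funext hab)).trans (Eq.symm h'))

theorem comp {g : N ⟶ K} {τ : N.ι → K.ι} {b : ∀ i, N.X i ⟶ K.X (τ i)} (h : IsAlong f σ a)
    (h' : IsAlong g τ b) : IsAlong (f ≫ g) (fun i => τ (σ i)) (fun i => a i ≫ b (σ i)) :=
  (congrArg₂ (· ≫ ·) h h').trans (along_comp_along σ a τ b)

theorem map (F : D ⥤ D) [F.Additive] (h : IsAlong f σ a) :
    IsAlong (M := F.mapMat_.obj M) (N := F.mapMat_.obj N) (F.mapMat_.map f) σ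
      (fun i => F.map (a i)) :=
  (congrArg F.mapMat_.map h).trans (mapMat_along F σ a)

theorem id (M : Mat_ D) : IsAlong (𝟙 M) (fun i => i) (fun i => 𝟙 (M.X i)) :=
  (along_id _ fun _ => rfl).symm

end IsAlong

/-- A family of isomorphisms as an isomorphism of formal sums. -/
def diag {ι : Type} [Fintype ι] {X Y : ι → D} (a : ∀ i, X i ≅ Y i) :
    (⟨ι, X⟩ : Mat_ D) ≅ ⟨ι, Y⟩ where
  hom := along (M := ⟨ι, X⟩) (N := ⟨ι, Y⟩) (fun i => i) fun i => (a i).hom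
  inv := along (M := ⟨ι, Y⟩) (N := ⟨ι, X⟩) (fun i => i) fun i => (a i).inv
  hom_inv_id := (along_comp_along _ _ _ _).trans (along_id _ fun _ => Iso.hom_inv_id _)
  inv_hom_id := (along_comp_along _ _ _ _).trans (along_id _ fun _ => Iso.inv_hom_id _)

theorem along_natural {ι κ : Type} [Fintype ι] [Fintype κ] {X X' : ι → D} {Y Y' : κ → D}
    {a : ∀ i, X i ⟶ X' i} {b : ∀ i, Y i ⟶ Y' i} {f : (⟨ι, X⟩ : Mat_ D) ⟶ ⟨κ, Y⟩}
    {f' : (⟨ι, X'⟩ : Mat_ D) ⟶ ⟨κ, Y'⟩} (h : ∀ i j, entry f i j ≫ b j = a i ≫ entry f' i j) :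
    f ≫ along (M := ⟨κ, Y⟩) (N := ⟨κ, Y'⟩) (fun i => i) b =
      along (M := ⟨ι, X⟩) (N := ⟨ι, X'⟩) (fun i => i) a ≫ f' :=
  entry_ext fun i j => by
    refine (entry_comp_along (N := ⟨κ, Y⟩) (K := ⟨κ, Y'⟩) (fun i => i) (fun _ _ h => h) b f i
      j).trans ((h i j).trans ?_)
    exact (entry_along_comp (M := ⟨ι, X⟩) (N := ⟨ι, X'⟩) (fun i => i) a f' i j).symm

variable [MonoidalCategory D]

theorem isAlong_assoc (M N K : Mat_ D) : IsAlong (tAssoc M N K).hom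
    (fun p => (p.1.1, (p.1.2, p.2)))
    (fun p => (α_ (M.X p.1.1) (N.X p.1.2) (K.X p.2)).hom) := rfl

theorem isAlong_left (M : Mat_ D) : IsAlong (tLeft M).hom (fun p => p.2)
    (fun p => (λ_ (M.X p.2)).hom) := rfl

theorem isAlong_right (M : Mat_ D) : IsAlong (tRight M).hom (fun p => p.1)
    (fun p => (ρ_ (M.X p.1)).hom) := rfl

variable [MonoidalPreadditive D]

namespace IsAlong

variable {M N M' N' : Mat_ D} {f : M ⟶ N} {σ : M.ι → N.ι} {a : ∀ i, M.X i ⟶ N.X (σ i)}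
  {g : M' ⟶ N'} {τ : M'.ι → N'.ι} {b : ∀ i, M'.X i ⟶ N'.X (τ i)}

theorem tensorHom (h : IsAlong f σ a) (h' : IsAlong g τ b) :
    IsAlong (M := tObj M M') (N := tObj N N') (tHom f g) (fun p => (σ p.1, τ p.2))
      (fun p => a p.1 ⊗ₘ b p.2) := by
  have e : tHom f g = tHom f (𝟙 M') ≫ tHom (𝟙 N) g := by
    rw [tHom_comp, Category.id_comp, Category.comp_id]
  unfold IsAlong at h h' ⊢
  rw [e, h, h', tHom_along_id, tHom_id_along]
  refine (along_comp_along (M := tObj M M') (N := tObj N M') (K := tObj N N') _ _ _ _).trans ?_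
  exact congrArg (along _) (funext fun p => (MonoidalCategory.tensorHom_def _ _).symm)

theorem whiskerLeft (K : Mat_ D) (h : IsAlong f σ a) :
    IsAlong (M := tObj K M) (N := tObj K N) (tHom (𝟙 K) f) (fun p => (p.1, σ p.2))
      (fun p => K.X p.1 ◁ a p.2) :=
  (congrArg (tHom (𝟙 K)) h).trans (tHom_id_along K σ a)

theorem whiskerRight (K : Mat_ D) (h : IsAlong f σ a) :
    IsAlong (M := tObj M K) (N := tObj N K) (tHom f (𝟙 K)) (fun p => (σ p.1, p.2))
      (fun p => a p.1 ▷ K.X p.2) :=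
  (congrArg (tHom · (𝟙 K)) h).trans (tHom_along_id K σ a)

end IsAlong

end FormalSum

open FormalSum

variable {G : Type w₁} {Γ : Type w₂} [Group G] [Group Γ]

/-- The data of a crossed structure on a category that need not have direct sums, with respect to
a family of properties of objects. -/
structure CrossedData (P : MatchedPair G Γ) {D : Type u} [Category.{v} D] [Preadditive D]
    [MonoidalCategory D] [MonoidalPreadditive D] (gr : Γ → ObjectProperty D) extends
    GroupAction G D where
  additive : ∀ g, (act g).Additive
  J : ∀ {g g' : G} {s : Γ}, P.act₂ s g = g' → ∀ {μ : D}, gr s μ → ∀ X : D,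
    ((act g').obj X ⊗ (act g).obj μ ≅ (act g).obj (X ⊗ μ))
  J_natural : ∀ {g g' : G} {s : Γ} (e : P.act₂ s g = g') {μ ν : D} (hμ : gr s μ) (hν : gr s ν)
    (m : μ ⟶ ν) {X Y : D} (f : X ⟶ Y),
    ((act g').map f ⊗ₘ (act g).map m) ≫ (J e hν Y).hom = (J e hμ X).hom ≫ (act g).map (f ⊗ₘ m)
  φ : ∀ g : G, 𝟙_ D ≅ (act g).obj (𝟙_ D)
  J_assoc : ∀ {g g' g'' : G} {s t : Γ} (e : P.act₂ t g = g') (e' : P.act₂ s g' = g'')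
    (e'' : P.act₂ (s * t) g = g'') {μ ν : D} (hμ : gr s μ) (hν : gr t ν)
    (hμν : gr (s * t) (μ ⊗ ν)) (X : D),
    (J e' hμ X).hom ▷ (act g).obj ν ≫ (J e hν (X ⊗ μ)).hom ≫ (act g).map (α_ X μ ν).hom =
      (α_ ((act g'').obj X) ((act g').obj μ) ((act g).obj ν)).hom ≫
        (act g'').obj X ◁ (J e hν μ).hom ≫ (J e'' hμν X).hom
  J_unit_left : ∀ {g g' : G} {s : Γ} (e : P.act₂ s g = g') {μ : D} (hμ : gr s μ),
    (φ g').hom ▷ (act g).obj μ ≫ (J e hμ (𝟙_ D)).hom ≫ (act g).map (λ_ μ).hom =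
      (λ_ ((act g).obj μ)).hom
  J_unit_right : ∀ {g : G} (e : P.act₂ 1 g = g) (h₁ : gr 1 (𝟙_ D)) (X : D),
    (act g).obj X ◁ (φ g).hom ≫ (J e h₁ X).hom ≫ (act g).map (ρ_ X).hom =
      (ρ_ ((act g).obj X)).hom
  J_χ : ∀ {g h k g' h' k' : G} {s : Γ} (e : g * h = k) (e' : g' * h' = k')
    (eh : P.act₂ s h = h') (eg : P.act₂ (P.act₁ h s) g = g') (ek : P.act₂ s k = k')
    {μ : D} (hμ : gr s μ) (hμ' : gr (P.act₁ h s) ((act h).obj μ)) (X : D),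
    (J eg hμ' ((act h').obj X)).hom ≫ (act g).map (J eh hμ X).hom ≫
        (χ e).hom.app (X ⊗ μ) =
      ((χ e').hom.app X ⊗ₘ (χ e).hom.app μ) ≫ (J ek hμ X).hom
  φ_χ : ∀ {g h k : G} (e : g * h = k),
    (φ g).hom ≫ (act g).map (φ h).hom ≫ (χ e).hom.app (𝟙_ D) = (φ k).hom
  ι_J : ∀ {e : G} (he : e = 1) {s : Γ} (e' : P.act₂ s e = e) {μ : D} (hμ : gr s μ) (X : D),
    ((ι he).hom.app X ⊗ₘ (ι he).hom.app μ) ≫ (J e' hμ X).hom = (ι he).hom.app (X ⊗ μ)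
  ι_φ : ∀ {e : G} (he : e = 1), (ι he).hom.app (𝟙_ D) = (φ e).hom

namespace CrossedData

variable {P : MatchedPair G Γ} {D : Type u} [Category.{v} D] [Preadditive D]
    [MonoidalCategory D] [MonoidalPreadditive D] {gr : Γ → ObjectProperty D}
    (A : CrossedData P gr)

instance (g : G) : (A.act g).Additive := A.additive g

/-- The composition isomorphism for formal sums. -/
def matχ {g h k : G} (e : g * h = k) :
    (A.act h).mapMat_ ⋙ (A.act g).mapMat_ ≅ (A.act k).mapMat_ :=
  NatIso.ofComponents (fun M => diag fun i => (A.χ e).app (M.X i)) fun f =>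
    along_natural fun i j => (A.χ e).hom.naturality (entry f i j)

theorem isAlong_matχ {g h k : G} (e : g * h = k) (M : Mat_ D) :
    IsAlong (M := (A.act g).mapMat_.obj ((A.act h).mapMat_.obj M)) ((A.matχ e).hom.app M)
      (fun i => i) (fun i => (A.χ e).hom.app (M.X i)) := rfl

/-- The unit isomorphism for formal sums. -/
def matι {e : G} (he : e = 1) : 𝟭 (Mat_ D) ≅ (A.act e).mapMat_ :=
  NatIso.ofComponents (fun M => diag fun i => (A.ι he).app (M.X i)) fun f =>
    along_natural fun i j => (A.ι he).hom.naturality (entry f i j)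

theorem isAlong_matι {e : G} (he : e = 1) (M : Mat_ D) :
    IsAlong (M := M) ((A.matι he).hom.app M)
      (fun i => i) (fun i => (A.ι he).hom.app (M.X i)) := rfl

/-- The action on formal sums. -/
def matAction : GroupAction G (Mat_ D) where
  act g := (A.act g).mapMat_
  χ := A.matχ
  ι := A.matι
  χ_assoc {g _ _ _ _ _} e₁ e₂ e₃ e₄ M :=
    IsAlong.eq (.comp (A.isAlong_matχ e₁ _) (A.isAlong_matχ e₃ M))
      (.comp (.map (A.act g) (A.isAlong_matχ e₂ M)) (A.isAlong_matχ e₄ M))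
      fun i => A.χ_assoc e₁ e₂ e₃ e₄ (M.X i)
  ι_χ {_ _} he h M :=
    IsAlong.eq (.comp (A.isAlong_matι he _) (A.isAlong_matχ h M)) (.id _)
      fun i => A.ι_χ he h (M.X i)
  χ_ι {_ g} he h M :=
    IsAlong.eq (.comp (.map (A.act g) (A.isAlong_matι he M)) (A.isAlong_matχ h M)) (.id _)
      fun i => A.χ_ι he h (M.X i)

variable {grM : Γ → ObjectProperty (Mat_ D)}

/-- The compatibility isomorphism with the tensor product for formal sums. -/
def matJ (hgr : ∀ {s : Γ} {M : Mat_ D}, grM s M → ∀ i, gr s (M.X i)) {g g' : G} {s : Γ}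
    (e : P.act₂ s g = g') {M : Mat_ D} (hM : grM s M) (X : Mat_ D) :
    tObj ((A.act g').mapMat_.obj X) ((A.act g).mapMat_.obj M) ≅ (A.act g).mapMat_.obj (tObj X M) :=
  diag (ι := X.ι × M.ι) (X := fun p => (A.act g').obj (X.X p.1) ⊗ (A.act g).obj (M.X p.2))
    (Y := fun p => (A.act g).obj (X.X p.1 ⊗ M.X p.2)) fun p => A.J e (hgr hM p.2) (X.X p.1)

theorem isAlong_matJ (hgr : ∀ {s : Γ} {M : Mat_ D}, grM s M → ∀ i, gr s (M.X i)) {g g' : G}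
    {s : Γ} (e : P.act₂ s g = g') {M : Mat_ D} (hM : grM s M) (X : Mat_ D) :
    IsAlong (A.matJ hgr e hM X).hom (fun p => p) (fun p => (A.J e (hgr hM p.2) (X.X p.1)).hom) :=
  rfl

/-- The isomorphism between the unit and its image for formal sums. -/
def matφ (g : G) : (tUnit : Mat_ D) ≅ (A.act g).mapMat_.obj tUnit :=
  diag (ι := PUnit) (X := fun _ => 𝟙_ D) (Y := fun _ => (A.act g).obj (𝟙_ D)) fun _ => A.φ g

theorem isAlong_matφ (g : G) : IsAlong (A.matφ g).hom (fun p => p) (fun _ => (A.φ g).hom) := rfl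

/-- The crossed structure on formal sums. -/
def mat (hgr : ∀ {s : Γ} {M : Mat_ D}, grM s M → ∀ i, gr s (M.X i)) (hM : IsMonoidalGrading grM)
    (hact : ∀ (g : G) {s : Γ} {M : Mat_ D}, grM s M →
      grM (P.act₁ g s) ((A.act g).mapMat_.obj M)) : CrossedStructure P grM where
  toGroupAction := A.matAction
  grading := hM
  additive g := inferInstanceAs ((A.act g).mapMat_.Additive)
  act_mem := hact
  J e _ hμ X := A.matJ hgr e hμ X
  J_natural {_ _ _} e {_ _} hμ hν m {_ _} f :=
    along_natural fun i j => A.J_natural e (hgr hμ i.2) (hgr hν j.2) (entry m i.2 j.2)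
      (entry f i.1 j.1)
  φ := A.matφ
  J_assoc {g _ _ _ _} e e' e'' {μ _} hμ hν hμν X :=
    IsAlong.eq (.comp (.whiskerRight _ (A.isAlong_matJ hgr e' hμ X))
        (.comp (A.isAlong_matJ hgr e hν _) (.map (A.act g) (isAlong_assoc _ _ _))))
      (.comp (isAlong_assoc _ _ _) (.comp (.whiskerLeft _ (A.isAlong_matJ hgr e hν μ))
        (A.isAlong_matJ hgr e'' hμν X)))
      fun i => A.J_assoc e e' e'' (hgr hμ i.1.2) (hgr hν i.2) (hgr hμν (i.1.2, i.2)) (X.X i.1.1)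
  J_unit_left {g g' _} e {_} hμ :=
    IsAlong.eq (.comp (.whiskerRight _ (A.isAlong_matφ g'))
        (.comp (A.isAlong_matJ hgr e hμ _) (.map (A.act g) (isAlong_left _))))
      (isAlong_left _) fun i => A.J_unit_left e (hgr hμ i.2)
  J_unit_right {g} e h₁ X :=
    IsAlong.eq (.comp (.whiskerLeft _ (A.isAlong_matφ g))
        (.comp (A.isAlong_matJ hgr e h₁ _) (.map (A.act g) (isAlong_right _))))
      (isAlong_right _) fun i => A.J_unit_right e (hgr h₁ PUnit.unit) (X.X i.1)
  J_χ {g h _ _ _ _ _} e e' eh eg ek {μ} hμ X :=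
    IsAlong.eq (.comp (A.isAlong_matJ hgr eg (hact h hμ) _)
        (.comp (.map (A.act g) (A.isAlong_matJ hgr eh hμ X)) (A.isAlong_matχ e _)))
      (.comp (.tensorHom (A.isAlong_matχ e' X) (A.isAlong_matχ e μ)) (A.isAlong_matJ hgr ek hμ X))
      fun i => A.J_χ e e' eh eg ek (hgr hμ i.2) (hgr (hact h hμ) i.2) (X.X i.1)
  φ_χ {g h k} e :=
    IsAlong.eq (.comp (A.isAlong_matφ g) (.comp (.map (A.act g) (A.isAlong_matφ h))
      (A.isAlong_matχ e _))) (A.isAlong_matφ k) fun _ => A.φ_χ e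
  ι_J {_} he _ e' {μ} hμ X :=
    IsAlong.eq (.comp (.tensorHom (A.isAlong_matι he X) (A.isAlong_matι he μ))
      (A.isAlong_matJ hgr e' hμ X)) (A.isAlong_matι he _) fun i => A.ι_J he e' (hgr hμ i.2) (X.X i.1)
  ι_φ {e} he := IsAlong.eq (A.isAlong_matι he _) (A.isAlong_matφ e) fun _ => A.ι_φ he

end CrossedData
end
-- Crossed data on homogeneous objects, including zero objects of arbitrary degree.
noncomputable section

universe v u w₁ w₂ w₃

section Zero

variable {C : Type u} [Category.{v} C] [Preadditive C] [MonoidalCategory C]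
  [MonoidalPreadditive C]

theorem isZero_tensor_right (X : C) {Y : C} (hY : IsZero Y) : IsZero (X ⊗ Y) :=
  (tensorLeft X).map_isZero hY

theorem isZero_tensor_left {X : C} (hX : IsZero X) (Y : C) : IsZero (X ⊗ Y) :=
  (tensorRight Y).map_isZero hX

end Zero

variable {G : Type w₁} {Γ : Type w₂} [Group G] [Group Γ] {P : MatchedPair G Γ}
  {C : Type u} [Category.{v} C] [Preadditive C] [HasFiniteBiproducts C] [MonoidalCategory C]
  [MonoidalPreadditive C] {gr : Γ → ObjectProperty C}

namespace CrossedStructure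

variable (S : CrossedStructure P gr)

/-- The objects of degree `x.1` and the zero objects. -/
def weakGrading (x : G × Γ) : ObjectProperty S.CenterObj := fun Y => Y.deg = x.1 ∨ IsZero Y

namespace Cleavage

variable {S} (T : S.Cleavage) {s s' : Γ} {x : G × Γ} {Y : S.CenterObj}

theorem isZero_obj (s : Γ) (hY : IsZero Y) : IsZero (T.obj s Y) :=
  (T.functor s).map_isZero hY

open Classical in
/-- The compatibility with the tensor product, extended to zero objects of a wrong degree. -/
def weakJ (e : P.act₁ x.1 s = s') (hY : S.weakGrading x Y) (X : S.CenterObj) :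
    CenterObj.tensor (T.obj s' X) (T.obj s Y) ≅ T.obj s (CenterObj.tensor X Y) :=
  if h : Y.deg = x.1 then T.tensorIso Y (by rw [h, e]) X
  else (isZero_tensor_right _ (T.isZero_obj s (hY.resolve_left h))).iso
    (T.isZero_obj s (isZero_tensor_right X (hY.resolve_left h)))

theorem weakJ_eq (e : P.act₁ x.1 s = s') (hY : S.weakGrading x Y) (X : S.CenterObj)
    (h : Y.deg = x.1) (e' : P.act₁ Y.deg s = s') : T.weakJ e hY X = T.tensorIso Y e' X :=
  dif_pos h

theorem isZero_left {X Y : S.CenterObj} (hX : IsZero X) : IsZero (CenterObj.tensor X Y) :=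
  isZero_tensor_left hX Y

theorem isZero_right {X Y : S.CenterObj} (hY : IsZero Y) : IsZero (CenterObj.tensor X Y) :=
  isZero_tensor_right X hY

/-- The crossed structure on the homogeneous objects of the crossed center. -/
def crossedData : CrossedData P.center S.weakGrading where
  toGroupAction := T.groupAction
  additive s := inferInstanceAs (T.functor s).Additive
  J e _ hμ X := T.weakJ e hμ X
  J_natural {s s' x} e {μ ν} hμ hν m {X Y} f := by
    change CenterObj.tensorHom (T.map s' f) (T.map s m) ≫ (T.weakJ e hν Y).hom =
      (T.weakJ e hμ X).hom ≫ T.map s (CenterObj.tensorHom f m)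
    -- Here and in the laws below, an object of the wrong degree is a zero object. Then the source
    -- or the target of both sides is zero and nothing is to be shown.
    by_cases h : μ.deg = x.1
    · by_cases h' : ν.deg = x.1
      · have e₁ : P.act₁ μ.deg s = s' := h ▸ e
        have e₂ : P.act₁ ν.deg s = s' := h' ▸ e
        rw [T.weakJ_eq e hμ X h e₁, T.weakJ_eq e hν Y h' e₂]
        exact T.tensorIso_naturality e₁ e₂ (h.trans h'.symm) f m
      · exact (T.isZero_obj s (isZero_right (hν.resolve_left h'))).eq_of_tgt _ _
    · exact (isZero_right (T.isZero_obj s (hμ.resolve_left h))).eq_of_src _ _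
  φ := T.unitObjIso
  J_assoc {s s' s'' x y} e e' e'' {μ ν} hμ hν hμν X := by
    change CenterObj.tensorHom (T.weakJ e' hμ X).hom (𝟙 (T.obj s ν)) ≫
        (T.weakJ e hν (CenterObj.tensor X μ)).hom ≫ T.map s (CenterObj.assoc X μ ν).hom =
      (CenterObj.assoc _ _ _).hom ≫ CenterObj.tensorHom (𝟙 (T.obj s'' X)) (T.weakJ e hν μ).hom ≫
        (T.weakJ e'' hμν X).hom
    by_cases h : μ.deg = x.1
    · by_cases h' : ν.deg = y.1
      · have e₁ : P.act₁ ν.deg s = s' := h' ▸ e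
        have e₂ : P.act₁ μ.deg s' = s'' := h ▸ e'
        have h'' : (CenterObj.tensor μ ν).deg = (x * y).1 := congrArg₂ (· * ·) h h'
        have e₃ : P.act₁ (CenterObj.tensor μ ν).deg s = s'' := by rw [h'']; exact e''
        rw [T.weakJ_eq e' hμ X h e₂, T.weakJ_eq e hν _ h' e₁, T.weakJ_eq e hν _ h' e₁,
          T.weakJ_eq e'' hμν X h'' e₃]
        exact T.tensorIso_assoc e₁ e₂ e₃ X
      · exact (isZero_right (T.isZero_obj s (hν.resolve_left h'))).eq_of_src _ _
    · exact (isZero_left (isZero_right (T.isZero_obj s' (hμ.resolve_left h)))).eq_of_src _ _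
  J_unit_left {s s' x} e {μ} hμ := by
    change CenterObj.tensorHom (T.unitObjIso s').hom (𝟙 (T.obj s μ)) ≫
        (T.weakJ e hμ CenterObj.unit).hom ≫ T.map s (CenterObj.leftUnitor μ).hom =
      (CenterObj.leftUnitor _).hom
    by_cases h : μ.deg = x.1
    · have e₁ : P.act₁ μ.deg s = s' := h ▸ e
      rw [T.weakJ_eq e hμ _ h e₁]
      exact T.tensorIso_unit_left e₁
    · exact (T.isZero_obj s (hμ.resolve_left h)).eq_of_tgt _ _
  J_unit_right {s} e h₁ X := by
    change CenterObj.tensorHom (𝟙 (T.obj s X)) (T.unitObjIso s).hom ≫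
        (T.weakJ e h₁ X).hom ≫ T.map s (CenterObj.rightUnitor X).hom =
      (CenterObj.rightUnitor _).hom
    rw [T.weakJ_eq e h₁ X rfl e]
    exact T.tensorIso_unit_right e
  J_χ {g h k g' h' k' x} e e' eh eg ek {μ} hμ hμ' X := by
    change (T.weakJ eg hμ' (T.obj h' X)).hom ≫ T.map g (T.weakJ eh hμ X).hom ≫
        (T.compIso e (CenterObj.tensor X μ)).hom =
      CenterObj.tensorHom (T.compIso e' X).hom (T.compIso e μ).hom ≫ (T.weakJ ek hμ X).hom
    by_cases hx : μ.deg = x.1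
    · have e₁ : P.act₁ μ.deg h = h' := hx ▸ eh
      have hx' : (T.obj h μ).deg = (P.center.act₁ h x).1 := by
        rw [deg_obj, hx]; rfl
      have e₂ : P.act₁ (T.obj h μ).deg g = g' := by rw [hx']; exact eg
      have e₃ : P.act₁ μ.deg k = k' := hx ▸ ek
      rw [T.weakJ_eq eg hμ' _ hx' e₂, T.weakJ_eq eh hμ X hx e₁, T.weakJ_eq ek hμ X hx e₃]
      exact T.tensorIso_comp e e' e₁ e₂ e₃ X
    · exact (T.isZero_obj k (isZero_right (hμ.resolve_left hx))).eq_of_tgt _ _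
  φ_χ e := T.unitObjIso_comp e
  ι_J {s} he {x} e' {μ} hμ X := by
    subst he
    change CenterObj.tensorHom (T.unitIso X).hom (T.unitIso μ).hom ≫ (T.weakJ e' hμ X).hom =
      (T.unitIso (CenterObj.tensor X μ)).hom
    by_cases h : μ.deg = x.1
    · have e₁ : P.act₁ μ.deg 1 = 1 := h ▸ e'
      rw [T.weakJ_eq e' hμ X h e₁]
      exact T.tensorIso_unitIso e₁
    · exact (T.isZero_obj 1 (isZero_right (hμ.resolve_left h))).eq_of_tgt _ _
  ι_φ {s} he := by
    subst he
    exact T.unitIso_unit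

end Cleavage
end CrossedStructure
end
-- The grading of the crossed center.
noncomputable section

universe v u w₁ w₂ w₃

section Biproducts

variable {C : Type u} [Category.{v} C] [Preadditive C] [HasFiniteBiproducts C]

/-- An object with a complete family of orthogonal direct summands is their direct sum. -/
theorem nonempty_iso_biproduct {ι : Type} [Fintype ι] {X : C} {Y : ι → C} (i : ∀ a, Y a ⟶ X)
    (p : ∀ a, X ⟶ Y a) (h : ∀ a, i a ≫ p a = 𝟙 _) (h' : ∀ a b, a ≠ b → i a ≫ p b = 0)
    (hs : ∑ a, p a ≫ i a = 𝟙 X) : Nonempty (X ≅ ⨁ Y) := by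
  classical
  let b : Bicone Y := ⟨X, p, i, fun a a' => by
    split_ifs with e
    · subst e; simpa using h a
    · exact h' a a' e⟩
  exact ⟨biproduct.uniqueUpToIso Y (isBilimitOfTotal b hs)⟩

theorem IsMonoidalGrading.mem_biproduct [MonoidalCategory C] [MonoidalPreadditive C]
    {Γ : Type w₂} [Group Γ] {gr : Γ → ObjectProperty C} (hg : IsMonoidalGrading gr) {s : Γ}
    {ι : Type} [Finite ι] {X : ι → C} (h : ∀ a, gr s (X a)) : gr s (⨁ X) := by
  obtain ⟨n, ⟨e⟩⟩ := Finite.exists_equiv_fin ι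
  exact hg.of_iso (biproduct.whiskerEquiv e.symm fun a => Iso.refl (X (e.symm a)))
    (hg.biproduct _ fun a => h _)

theorem IsMonoidalGrading.mem_of_isZero [MonoidalCategory C] [MonoidalPreadditive C]
    {Γ : Type w₂} [Group Γ] {gr : Γ → ObjectProperty C} (hg : IsMonoidalGrading gr) (s : Γ)
    {X : C} (h : IsZero X) : gr s X := by
  have h₄ : IsZero (⨁ (Fin.elim0 : Fin 0 → C)) := by
    rw [IsZero.iff_id_eq_zero]
    exact biproduct.hom_ext _ _ fun j => j.elim0
  exact hg.of_iso (h₄.iso h) (hg.biproduct _ fun j => j.elim0)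

/-- A direct summand of a homogeneous object is homogeneous. -/
theorem IsMonoidalGrading.mem_retract [MonoidalCategory C] [MonoidalPreadditive C]
    {Γ : Type w₂} [Group Γ] {gr : Γ → ObjectProperty C} (hg : IsMonoidalGrading gr) {s : Γ}
    {X Y : C} (i : X ⟶ Y) (r : Y ⟶ X) (h : i ≫ r = 𝟙 X) (hY : gr s Y) : gr s X := by
  obtain ⟨n, d, E, hE, ⟨e⟩⟩ := hg.decomposition X
  refine hg.of_iso e.symm (hg.biproduct E fun a => ?_)
  by_cases ha : d a = s
  · exact ha ▸ hE a
  -- A summand of a degree other than s is zero, as its identity factors through Y, and zero objects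
  -- belong to every degree.
  · refine hg.mem_of_isZero s ((IsZero.iff_id_eq_zero _).2 ?_)
    calc 𝟙 (E a) = ((biproduct.ι E a ≫ e.inv) ≫ i) ≫ r ≫ e.hom ≫ biproduct.π E a := by
          simp [reassoc_of% h]
      _ = 0 := by
          rw [hg.hom_eq_zero ha (hE a) hY ((biproduct.ι E a ≫ e.inv) ≫ i), zero_comp]

/-- The decomposition into homogeneous components of distinct degrees. -/
theorem IsMonoidalGrading.exists_components [MonoidalCategory C] [MonoidalPreadditive C]
    {Γ : Type w₂} [Group Γ] {gr : Γ → ObjectProperty C} (hg : IsMonoidalGrading gr) (X : C) :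
    ∃ (n : ℕ) (d : Fin n → Γ) (E : Fin n → C), Function.Injective d ∧ (∀ a, gr (d a) (E a)) ∧
      Nonempty (X ≅ ⨁ E) := by
  classical
  obtain ⟨n, d, Y, hY, ⟨e⟩⟩ := hg.decomposition X
  let D := Finset.univ.image d
  let f : Fin n → Fin D.card := fun a =>
    D.equivFin ⟨d a, Finset.mem_image_of_mem d (Finset.mem_univ a)⟩
  -- The summands are grouped by degree, one group for each element of the image of d, so that the
  -- degrees become distinct.
  refine ⟨D.card, fun b => (D.equivFin.symm b).1, fun b => ⨁ fun a : {a // f a = b} => Y a.1,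
    Subtype.val_injective.comp D.equivFin.symm.injective, fun b => ?_, ⟨?_⟩⟩
  · refine hg.mem_biproduct fun a => ?_
    have : (D.equivFin.symm b).1 = d a.1 := by
      obtain ⟨a, rfl⟩ := a
      simp [f]
    change gr (D.equivFin.symm b).1 _
    rw [this]
    exact hY a.1
  · exact e ≪≫ (biproduct.whiskerEquiv (Equiv.sigmaFiberEquiv f) fun _ => Iso.refl _).symm ≪≫
      (biproductBiproductIso (fun b => {a // f a = b}) (fun b a => Y a.1)).symm

end Biproducts

theorem nonempty_iso_embedding {D : Type u} [Category.{v} D] [Preadditive D] {n : ℕ}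
    {X : D} {Y : Fin n → D} (i : ∀ a, Y a ⟶ X)
    (p : ∀ a, X ⟶ Y a) (h : ∀ a, i a ≫ p a = 𝟙 _) (h' : ∀ a b, a ≠ b → i a ≫ p b = 0)
    (hs : ∑ a, p a ≫ i a = 𝟙 X) :
    Nonempty ((Mat_.embedding D).obj X ≅ ⨁ fun a => (Mat_.embedding D).obj (Y a)) := by
  let F := Mat_.embedding D
  refine nonempty_iso_biproduct (fun a => F.map (i a)) (fun a => F.map (p a))
    (fun a => ?_) (fun a b hab => ?_) ?_
  · rw [← F.map_comp, h, F.map_id]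
  · rw [← F.map_comp, h' a b hab, F.map_zero]
  · simp only [← F.map_comp]
    rw [← F.map_sum, hs, F.map_id]

variable {G : Type w₁} {Γ : Type w₂} [Group G] [Group Γ] {P : MatchedPair G Γ}
  {C : Type u} [Category.{v} C] [Preadditive C] [HasFiniteBiproducts C] [MonoidalCategory C]
  [MonoidalPreadditive C] {gr : Γ → ObjectProperty C}

namespace CrossedStructure

variable {S : CrossedStructure P gr}

namespace CenterObj

/-- The direct summand of an object of the crossed center given by a direct summand of the
underlying object that is compatible with the half-braiding. -/
def retract (X : S.CenterObj) {E : C} (i : E ⟶ X.obj) (p : X.obj ⟶ E) (h : i ≫ p = 𝟙 E)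
    (hβ : ∀ {g : G} (e : X.deg = g) {ν : C} (hν : gr 1 ν),
      (p ≫ i) ▷ ν ≫ (X.β e hν).hom = (X.β e hν).hom ≫ (S.act g).obj ν ◁ (p ≫ i)) :
    S.CenterObj where
  deg := X.deg
  obj := E
  β {g} e {ν} hν :=
    { hom := i ▷ ν ≫ (X.β e hν).hom ≫ _ ◁ p
      inv := _ ◁ i ≫ (X.β e hν).inv ≫ p ▷ ν
      hom_inv_id := by
        have h₁ := hβ e hν
        rw [comp_whiskerRight, whiskerLeft_comp] at h₁
        simp only [Category.assoc] at h₁ ⊢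
        rw [← reassoc_of% h₁, ← comp_whiskerRight_assoc, h, id_whiskerRight, Category.id_comp,
          Iso.hom_inv_id_assoc, ← comp_whiskerRight, h, id_whiskerRight]
      inv_hom_id := by
        have h₁ := hβ e hν
        rw [comp_whiskerRight, whiskerLeft_comp] at h₁
        simp only [Category.assoc] at h₁ ⊢
        rw [reassoc_of% h₁, Iso.inv_hom_id_assoc, ← whiskerLeft_comp_assoc, h, whiskerLeft_id,
          Category.id_comp, ← whiskerLeft_comp, h, whiskerLeft_id] }
  β_natural {g} e {ν ν'} hν hν' f := by
    simp only [Category.assoc]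
    rw [whisker_exchange_assoc, reassoc_of% (X.β_natural e hν hν' f), whisker_exchange]
  β_tensor {g} e {ν₁ ν₂} h₁ h₂ h₁₂ := by
    have k := hβ e h₁
    rw [comp_whiskerRight, whiskerLeft_comp] at k
    -- The projector that appears between the two half-braidings commutes with the first and is
    -- absorbed by the inclusion.
    have k' : i ▷ ν₁ ≫ (X.β e h₁).hom ≫ (S.act g).obj ν₁ ◁ p ≫ (S.act g).obj ν₁ ◁ i =
        i ▷ ν₁ ≫ (X.β e h₁).hom := by
      rw [← k, Category.assoc, ← comp_whiskerRight_assoc, h, id_whiskerRight, Category.id_comp]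
    change i ▷ (ν₁ ⊗ ν₂) ≫ (X.β e h₁₂).hom ≫ (S.act g).obj (ν₁ ⊗ ν₂) ◁ p =
      glue (i ▷ ν₁ ≫ (X.β e h₁).hom ≫ (S.act g).obj ν₁ ◁ p)
        (i ▷ ν₂ ≫ (X.β e h₂).hom ≫ (S.act g).obj ν₂ ◁ p) (S.J₁ g h₂ ν₁).hom
    rw [← glue_comp_mid]
    simp only [Category.assoc]
    rw [k', glue_comp_left, glue_comp_right]
    exact congrArg (fun c => i ▷ _ ≫ c ≫ _ ◁ p) (X.β_tensor e h₁ h₂ h₁₂)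

variable (X : S.CenterObj) {E : C} (i : E ⟶ X.obj) (p : X.obj ⟶ E) (h : i ≫ p = 𝟙 E)
    (hβ : ∀ {g : G} (e : X.deg = g) {ν : C} (hν : gr 1 ν),
      (p ≫ i) ▷ ν ≫ (X.β e hν).hom = (X.β e hν).hom ≫ (S.act g).obj ν ◁ (p ≫ i))

/-- The inclusion of a direct summand. -/
def retractι : X.retract i p h hβ ⟶ X where
  hom := i
  mem := ⟨fun h => (h rfl).elim, fun {g} e e' {ν} hν => by
    change _ = (i ▷ ν ≫ (X.β e' hν).hom ≫ _ ◁ p) ≫ _ ◁ i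
    rw [Category.assoc, Category.assoc, ← whiskerLeft_comp, ← hβ e' hν, ← comp_whiskerRight_assoc,
      reassoc_of% h]
    rfl⟩

/-- The projection to a direct summand. -/
def retractπ : X ⟶ X.retract i p h hβ where
  hom := p
  mem := ⟨fun h => (h rfl).elim, fun {g} e e' {ν} hν => by
    change p ▷ ν ≫ (i ▷ ν ≫ (X.β e hν).hom ≫ _ ◁ p) = _
    rw [← comp_whiskerRight_assoc, reassoc_of% (hβ e hν), ← whiskerLeft_comp, Category.assoc, h,
      Category.comp_id]
    rfl⟩

theorem sum_hom {ι : Type} (s : Finset ι) {X Y : S.CenterObj} (f : ι → (X ⟶ Y)) :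
    (∑ a ∈ s, f a).hom = ∑ a ∈ s, (f a).hom :=
  map_sum (⟨⟨Hom.hom, rfl⟩, fun _ _ => rfl⟩ : (X ⟶ Y) →+ (X.obj ⟶ Y.obj)) f s

/-- Every object of the crossed center is a direct sum of objects that are homogeneous in `C`. -/
theorem exists_components (X : S.CenterObj) : ∃ (n : ℕ) (d : Fin n → Γ)
    (Y : Fin n → S.CenterObj) (i : ∀ s, Y s ⟶ X) (p : ∀ s, X ⟶ Y s),
      (∀ s, (Y s).deg = X.deg) ∧ (∀ s, gr (d s) (Y s).obj) ∧
      (∀ s, i s ≫ p s = 𝟙 _) ∧ (∀ s t, s ≠ t → i s ≫ p t = 0) ∧ ∑ s, p s ≫ i s = 𝟙 X := by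
  classical
  obtain ⟨n, d, E, hd, hE, ⟨e⟩⟩ := S.grading.exists_components X.obj
  let i : ∀ s, E s ⟶ X.obj := fun s => biproduct.ι E s ≫ e.inv
  let p : ∀ s, X.obj ⟶ E s := fun s => e.hom ≫ biproduct.π E s
  have h : ∀ s, i s ≫ p s = 𝟙 _ := fun s => by simp [i, p]
  have h' : ∀ s t, s ≠ t → i s ≫ p t = 0 := fun s t hst => by
    simp [i, p, biproduct.ι_π_ne E hst]
  have hs : ∑ s, p s ≫ i s = 𝟙 X.obj := by
    simp only [i, p, Category.assoc]
    rw [← Preadditive.comp_sum]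
    simp only [← Category.assoc]
    rw [← Preadditive.sum_comp, biproduct.total]
    simp
  -- An object ν of degree 1 and its image change no Γ-degree, so this morphism goes between objects
  -- of distinct degrees `d s` and `d t`.
  have hz : ∀ {g : G} (eX : X.deg = g) {ν : C} (hν : gr 1 ν) (s t), s ≠ t →
      i s ▷ ν ≫ (X.β eX hν).hom ≫ (S.act g).obj ν ◁ p t = 0 := fun {g} eX {ν} hν s t hst =>
    S.grading.hom_eq_zero (fun e => hst (hd e))
      (S.grading.mem_tensor (mul_one (d s)) (hE s) hν)
      (S.grading.mem_tensor (one_mul (d t)) (S.mem_one g hν) (hE t)) _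
  have hβ : ∀ (s) {g : G} (eX : X.deg = g) {ν : C} (hν : gr 1 ν),
      (p s ≫ i s) ▷ ν ≫ (X.β eX hν).hom = (X.β eX hν).hom ≫ (S.act g).obj ν ◁ (p s ≫ i s) := by
    intro s g eX ν hν
    -- The identity of X is written as the sum of all projectors, after the half-braiding here and
    -- before it in `h₂`; by `hz` only the summand of index s survives.
    have h₁ : (p s ≫ i s) ▷ ν ≫ (X.β eX hν).hom = (p s ≫ i s) ▷ ν ≫ (X.β eX hν).hom ≫
        (S.act g).obj ν ◁ (p s ≫ i s) := by
      conv_lhs => rw [← Category.comp_id (X.β eX hν).hom, ← whiskerLeft_id, ← hs, whiskerLeft_sum,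
        Preadditive.comp_sum, Preadditive.comp_sum]
      refine Finset.sum_eq_single s (fun t _ hts => ?_) (by simp)
      have := hz eX hν s t (Ne.symm hts)
      rw [comp_whiskerRight, whiskerLeft_comp, Category.assoc, reassoc_of% this]
      simp
    have h₂ : (X.β eX hν).hom ≫ (S.act g).obj ν ◁ (p s ≫ i s) = (p s ≫ i s) ▷ ν ≫
        (X.β eX hν).hom ≫ (S.act g).obj ν ◁ (p s ≫ i s) := by
      conv_lhs => rw [← Category.id_comp (X.β eX hν).hom, ← id_whiskerRight, ← hs, sum_whiskerRight,
        Preadditive.sum_comp, Preadditive.sum_comp]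
      refine (Finset.sum_eq_single s (fun t _ hts => ?_) (by simp)).trans (Category.assoc _ _ _)
      have := hz eX hν t s hts
      rw [comp_whiskerRight, whiskerLeft_comp, Category.assoc, Category.assoc, reassoc_of% this]
      simp
    rw [h₁, ← h₂]
  refine ⟨n, d, fun s => X.retract (i s) (p s) (h s) (hβ s),
    fun s => X.retractι (i s) (p s) (h s) (hβ s), fun s => X.retractπ (i s) (p s) (h s) (hβ s),
    fun _ => rfl, hE, fun s => hom_ext (h s), fun s t hst => hom_ext (h' s t hst), hom_ext ?_⟩
  rw [sum_hom]
  exact hs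

theorem whiskerRight_biproduct_ext {ι : Type} [Finite ι] {X : ι → C} {W Z : C}
    {f f' : (⨁ X) ⊗ W ⟶ Z} (h : ∀ a, biproduct.ι X a ▷ W ≫ f = biproduct.ι X a ▷ W ≫ f') :
    f = f' := by
  classical
  have := Fintype.ofFinite ι
  rw [← Category.id_comp f, ← Category.id_comp f', ← id_whiskerRight, ← biproduct.total,
    sum_whiskerRight, Preadditive.sum_comp, Preadditive.sum_comp]
  exact Finset.sum_congr rfl fun a _ => by
    rw [comp_whiskerRight, Category.assoc, Category.assoc, h]

/-- The half-braiding of a direct sum. -/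
def sumβ {n : ℕ} (X : Fin n → S.CenterObj) {g : G} (h : ∀ a, (X a).deg = g) {ν : C}
    (hν : gr 1 ν) : (⨁ fun a => (X a).obj) ⊗ ν ≅ (S.act g).obj ν ⊗ (⨁ fun a => (X a).obj) :=
  rightDistributor _ ν ≪≫ biproduct.mapIso (fun a => (X a).β (h a) hν) ≪≫
    (leftDistributor _ _).symm

theorem ι_sumβ {n : ℕ} (X : Fin n → S.CenterObj) {g : G} (h : ∀ a, (X a).deg = g) {ν : C}
    (hν : gr 1 ν) (a : Fin n) :
    biproduct.ι (fun a => (X a).obj) a ▷ ν ≫ (sumβ X h hν).hom =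
      ((X a).β (h a) hν).hom ≫ _ ◁ biproduct.ι (fun a => (X a).obj) a := by
  simp [sumβ]

theorem sumβ_π {n : ℕ} (X : Fin n → S.CenterObj) {g : G} (h : ∀ a, (X a).deg = g) {ν : C}
    (hν : gr 1 ν) (a : Fin n) :
    (sumβ X h hν).hom ≫ _ ◁ biproduct.π (fun a => (X a).obj) a =
      biproduct.π (fun a => (X a).obj) a ▷ ν ≫ ((X a).β (h a) hν).hom := by
  simp [sumβ]

/-- The direct sum of objects of the same degree. -/
def sum {n : ℕ} (X : Fin n → S.CenterObj) (g : G) (h : ∀ a, (X a).deg = g) : S.CenterObj where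
  deg := g
  obj := ⨁ fun a => (X a).obj
  β e _ hν := sumβ X (fun a => (h a).trans e) hν
  β_natural {g'} e {ν ν'} hν hν' f := whiskerRight_biproduct_ext fun a => by
    rw [← whisker_exchange_assoc, ι_sumβ, reassoc_of% (ι_sumβ X (fun a => (h a).trans e) hν a),
      reassoc_of% ((X a).β_natural ((h a).trans e) hν hν' f), whisker_exchange]
  β_tensor {g'} e {ν₁ ν₂} h₁ h₂ h₁₂ := whiskerRight_biproduct_ext fun a => by
    rw [ι_sumβ]
    change _ = _ ≫ glue (sumβ X (fun a => (h a).trans e) h₁).hom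
      (sumβ X (fun a => (h a).trans e) h₂).hom (S.J₁ g' h₂ ν₁).hom
    rw [← glue_comp_left, ι_sumβ, glue_comp_mid, ι_sumβ, glue_comp_right]
    exact congrArg (· ≫ _) ((X a).β_tensor ((h a).trans e) h₁ h₂ h₁₂)

theorem nonempty_embedding_sum {n : ℕ} (X : Fin n → S.CenterObj) (g : G)
    (h : ∀ a, (X a).deg = g) : Nonempty ((Mat_.embedding S.CenterObj).obj (sum X g h) ≅
      ⨁ fun a => (Mat_.embedding S.CenterObj).obj (X a)) := by
  let i : ∀ a, X a ⟶ sum X g h := fun a => ⟨biproduct.ι (fun a => (X a).obj) a,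
    fun h' => (h' (h a)).elim, fun {g'} e e' {ν} hν => ι_sumβ X (fun a => (h a).trans e') hν a⟩
  let p : ∀ a, sum X g h ⟶ X a := fun a => ⟨biproduct.π (fun a => (X a).obj) a,
    fun h' => (h' (h a).symm).elim, fun {g'} e e' {ν} hν =>
      (sumβ_π X (fun a => (h a).trans e) hν a).symm⟩
  exact nonempty_iso_embedding i p (fun a => hom_ext (biproduct.ι_π_self _ a))
    (fun a b hab => hom_ext (biproduct.ι_π_ne _ hab)) (hom_ext (by
      rw [sum_hom]; exact biproduct.total))

end CenterObj

/-- The identity of an entry factors through the homogeneous object X, hence vanishes if the degrees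
differ. An entry that is zero may carry any degree label, which is why `weakGrading` admits zero
objects. -/
theorem weakGrading_of_centerGrading {x : G × Γ} {M : S.Center} (hM : S.centerGrading x M) (i : M.ι) :
    S.weakGrading x (M.X i) := by
  obtain ⟨X, hX, -, ⟨e⟩⟩ := hM
  by_cases h : (M.X i).deg = x.1
  · exact Or.inl h
  · refine Or.inr ((IsZero.iff_id_eq_zero _).2 ?_)
    rw [← FormalSum.entry_id_self i, ← e.hom_inv_id, FormalSum.entry_comp]
    refine Finset.sum_eq_zero fun j _ => ?_
    rw [Cleavage.hom_eq_zero (Y := X) (fun h' => h (h'.trans hX)) (FormalSum.entry e.hom i j)]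
    exact zero_comp

/-- The tensor product of one-term formal sums. -/
def embeddingTensorIso (X Y : S.CenterObj) :
    (Mat_.embedding S.CenterObj).obj X ⊗ (Mat_.embedding S.CenterObj).obj Y ≅
      (Mat_.embedding S.CenterObj).obj (CenterObj.tensor X Y) where
  hom := FormalSum.along (M := FormalSum.tObj ((Mat_.embedding _).obj X) ((Mat_.embedding _).obj Y))
    (N := (Mat_.embedding _).obj (CenterObj.tensor X Y)) (fun _ => PUnit.unit)
    (fun _ => 𝟙 (CenterObj.tensor X Y))
  inv := FormalSum.along (M := (Mat_.embedding _).obj (CenterObj.tensor X Y))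
    (N := FormalSum.tObj ((Mat_.embedding _).obj X) ((Mat_.embedding _).obj Y))
    (fun _ => (PUnit.unit, PUnit.unit)) (fun _ => 𝟙 (CenterObj.tensor X Y))
  hom_inv_id := (FormalSum.along_comp_along _ _ _ _).trans
    (FormalSum.along_id _ fun _ => Category.id_comp _)
  inv_hom_id := (FormalSum.along_comp_along _ _ _ _).trans
    (FormalSum.along_id _ fun _ => Category.id_comp _)

/-- If the G-degrees differ, morphisms vanish by the definition of the crossed center; if the
Γ-degrees differ, they vanish already in C. -/
theorem centerGrading_hom_eq_zero {x y : G × Γ} {M N : S.Center} (hxy : x ≠ y)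
    (hM : S.centerGrading x M) (hN : S.centerGrading y N) (f : M ⟶ N) : f = 0 := by
  obtain ⟨X, hX, hX', ⟨e⟩⟩ := hM
  obtain ⟨Y, hY, hY', ⟨e'⟩⟩ := hN
  have h : e.inv ≫ f ≫ e'.hom = 0 := by
    refine FormalSum.entry_ext fun i j => ?_
    have h₁ : ∀ c : X ⟶ Y, c = 0 := fun c => by
      by_cases h₂ : X.deg = Y.deg
      · refine CenterObj.hom_ext (S.grading.hom_eq_zero (fun h₃ => hxy ?_) hX' hY' _)
        exact Prod.ext (hX.symm.trans (h₂.trans hY)) h₃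
      · exact Cleavage.hom_eq_zero h₂ c
    exact h₁ _
  rw [← cancel_epi e.inv, ← cancel_mono e'.hom, Category.assoc, h, comp_zero, zero_comp]

/-- A formal sum is the direct sum of its entries, and each entry splits further into objects
homogeneous in C by `CenterObj.exists_components`. -/
theorem centerGrading_decomposition (M : S.Center) : ∃ (n : ℕ) (d : Fin n → G × Γ)
    (Y : Fin n → S.Center), (∀ i, S.centerGrading (d i) (Y i)) ∧ Nonempty (M ≅ ⨁ Y) := by
  choose n d Y i p h₁ h₂ h₃ h₄ h₅ using fun j : M.ι => (M.X j).exists_components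
  have e : ∀ j, Nonempty ((Mat_.embedding S.CenterObj).obj (M.X j) ≅
      ⨁ fun a => (Mat_.embedding S.CenterObj).obj (Y j a)) := fun j =>
    nonempty_iso_embedding (i j) (p j) (h₃ j) (h₄ j) (h₅ j)
  let ε := Fintype.equivFin (Σ j, Fin (n j))
  refine ⟨_, fun a => ((M.X (ε.symm a).1).deg, d (ε.symm a).1 (ε.symm a).2),
    fun a => (Mat_.embedding S.CenterObj).obj (Y (ε.symm a).1 (ε.symm a).2),
    fun a => ⟨_, h₁ _ _, h₂ _ _, ⟨Iso.refl _⟩⟩, ⟨?_⟩⟩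
  exact M.isoBiproductEmbedding ≪≫ biproduct.mapIso (fun j => (e j).some) ≪≫
    biproductBiproductIso (fun j => Fin (n j))
      (fun j a => (Mat_.embedding S.CenterObj).obj (Y j a)) ≪≫
    (biproduct.whiskerEquiv ε.symm fun _ => Iso.refl _).symm

variable (S) in
theorem isMonoidalGrading_centerGrading : IsMonoidalGrading S.centerGrading where
  of_iso := by
    rintro x M N e ⟨X, hX, hX', ⟨e'⟩⟩
    exact ⟨X, hX, hX', ⟨e.symm ≪≫ e'⟩⟩
  biproduct {x n} M hM := by
    choose X hX hX' e using hM
    obtain ⟨e'⟩ := CenterObj.nonempty_embedding_sum X x.1 hX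
    exact ⟨CenterObj.sum X x.1 hX, rfl, S.grading.biproduct _ hX',
      ⟨biproduct.mapIso (fun i => (e i).some) ≪≫ e'.symm⟩⟩
  hom_eq_zero h hM hN f := centerGrading_hom_eq_zero h hM hN f
  decomposition := centerGrading_decomposition
  tensor := by
    rintro x y M N ⟨X, hX, hX', ⟨e⟩⟩ ⟨Y, hY, hY', ⟨e'⟩⟩
    exact ⟨CenterObj.tensor X Y, congrArg₂ (· * ·) hX hY, S.grading.tensor hX' hY',
      ⟨(e ⊗ᵢ e') ≪≫ embeddingTensorIso X Y⟩⟩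
  unit := ⟨CenterObj.unit, rfl, S.grading.unit, ⟨Iso.refl _⟩⟩

namespace Cleavage

variable (T : S.Cleavage)

/-- The universal arrow at M is an isomorphism from E ⊗ M to ^h M ⊗ X, which has degree (h ▷₁ s) t.
Tensoring with M' multiplies the degree by s⁻¹, and E is a retract of E ⊗ M ⊗ M'. This explains the
second component of the action in `MatchedPair.center`. -/
theorem mem_obj (s : Γ) {t : Γ} {X : S.CenterObj} (hX : gr t X.obj) :
    gr (P.act₁ X.deg s * t * s⁻¹) (T.obj s X).obj := by
  have h₁ : gr (P.act₁ X.deg s * t) ((T.obj s X).obj ⊗ T.D.M s) := by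
    have := T.inv s X rfl (T.D.mem s)
    exact S.grading.of_iso (asIso ((T.arr s X).app rfl (T.D.mem s))).symm
      (S.grading.tensor (S.act_mem X.deg (T.D.mem s)) hX)
  have h₂ := S.grading.tensor h₁ (T.D.mem' s)
  refine S.grading.mem_retract ((ρ_ _).inv ≫ _ ◁ T.D.co s ≫ (α_ _ _ _).inv)
    ((α_ _ _ _).hom ≫ _ ◁ T.D.ev s ≫ (ρ_ _).hom) ?_ h₂
  simp only [Category.assoc, Iso.inv_hom_id_assoc]
  rw [← whiskerLeft_comp_assoc, T.D.co_ev]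
  simp

/-- The crossed structure on the crossed center. -/
def crossedStructure : CrossedStructure P.center S.centerGrading :=
  T.crossedData.mat weakGrading_of_centerGrading S.isMonoidalGrading_centerGrading fun s {x M} hM => by
    obtain ⟨X, hX, hX', ⟨e⟩⟩ := hM
    refine ⟨T.obj s X, ?_, ?_, ⟨(T.functor s).mapMat_.mapIso e⟩⟩
    · rw [deg_obj, hX]
      rfl
    · have := T.mem_obj s hX'
      rw [hX] at this
      exact this

theorem crossedStructure_linear {k : Type w₃} [Field k] [Linear k C] [MonoidalLinear k C] (s : Γ) :
    (T.crossedStructure.act s).Linear k where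
  map_smul f r := FormalSum.entry_ext fun i j => T.map_smul r (FormalSum.entry f i j)

end Cleavage
end CrossedStructure
end
-- The crossed structure built from objects of nonzero dimension.
noncomputable section

universe v u w₁ w₂ w₃

variable {G : Type w₁} {Γ : Type w₂} [Group G] [Group Γ] {P : MatchedPair G Γ}
  {C : Type u} [Category.{v} C] [Preadditive C] [HasFiniteBiproducts C] [MonoidalCategory C]
  [MonoidalPreadditive C] {gr : Γ → ObjectProperty C}

namespace CrossedStructure

variable {S : CrossedStructure P gr} [IsIdempotentComplete C]

/-- The cleavage given by a splitting of the unit. -/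
def cleavage (D : Splitting gr) : S.Cleavage where
  D := D
  obj s X := (conjSplit X rfl D s).obj
  arr s X := (conjSplit X rfl D s).arr
  inv s X := (conjSplit X rfl D s).arr_inv

variable [RightRigidCategory C] {p : PivotalStructure C} (hp : S.IsPivotal p)
  {k : Type w₃} [Field k] [Linear k C] [MonoidalLinear k C] (hlin : ∀ g, (S.act g).Linear k)
  {ζ : Γ → C} (hζ : ∀ s, gr s (ζ s)) {d : Γ → k}
  (hd : ∀ s, d s ≠ 0 ∧ p.dim (ζ s) = d s • 𝟙 (𝟙_ C))

/-- The cleavage given by objects of nonzero dimension. -/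
abbrev pivotalCleavage : S.Cleavage := cleavage (pivotalSplitting S.grading hζ hd)

/-- The image of an object under the action, as a retract. -/
def conjRetract (s : Γ) (X : S.CenterObj) {h : G} (eX : X.deg = h) :
    S.ConjRetract p (d s) X eX (hζ s) := by
  subst eX
  let K := conjSplit X rfl (pivotalSplitting S.grading hζ hd) s
  exact ⟨K.obj, rfl, K.i, K.r, K.i_r,
    K.r_i.trans (conjIdem_eq hp X rfl hlin hζ hd s), fun hν => braid_eq hp X rfl hlin hζ hd K rfl hν⟩

/-- The comparison of the image of an object under the action with the retract. -/
def conjRetractIso (s : Γ) (X : S.CenterObj) {h : G} (eX : X.deg = h) :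
    (pivotalCleavage hζ hd).obj s X ≅ (conjRetract hp hlin hζ hd s X eX).E := by
  subst eX
  exact Iso.refl _

/-- The inclusion is written through the universal arrow, because the functoriality of the action is
defined through that arrow. -/
theorem conjRetract_incl (s : Γ) (X : S.CenterObj) {h : G} (eX : X.deg = h) :
    (conjRetract hp hlin hζ hd s X eX).incl = (conjRetractIso hp hlin hζ hd s X eX).inv.hom ≫
      (ρ_ _).inv ≫ _ ◁ η_ (ζ s) (ζ s)ᘁ ≫ (α_ _ _ _).inv ≫
        ((pivotalCleavage hζ hd).arr s X).app eX (hζ s) ▷ (ζ s)ᘁ := by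
  subst eX
  exact (ConjSplit.i_eq _).trans (Category.id_comp _).symm

/-- The comparison of the functoriality with the inclusions and retractions. -/
theorem conjRetractIso_map (s : Γ) {X Y : S.CenterObj} {h : G} (eX : X.deg = h) (eY : Y.deg = h)
    (f : X ⟶ Y) : ((conjRetractIso hp hlin hζ hd s X eX).inv ≫ (pivotalCleavage hζ hd).map s f ≫
        (conjRetractIso hp hlin hζ hd s Y eY).hom).hom =
      (conjRetract hp hlin hζ hd s X eX).incl ≫ ((S.act h).obj (ζ s) ◁ f.hom) ▷ (ζ s)ᘁ ≫
        (conjRetract hp hlin hζ hd s Y eY).retr := by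
  have h₁ := (pivotalCleavage hζ hd).map_app (s := s) (eX.trans eY.symm) f eY (hζ s)
  have h₂ := conjRetract_incl hp hlin hζ hd s X eX
  have h₃ := conjRetract_incl hp hlin hζ hd s Y eY
  have h₄ : (conjRetractIso hp hlin hζ hd s Y eY).hom.hom ≫
      (conjRetractIso hp hlin hζ hd s Y eY).inv.hom = 𝟙 _ := by
    rw [← CenterObj.comp_hom, Iso.hom_inv_id, CenterObj.id_hom]
  have h₅ := (conjRetract hp hlin hζ hd s Y eY).incl_retr
  -- Inserting incl ≫ retr at the target makes the universal arrow of Y appear, through which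
  -- `map_app` moves f.
  rw [← Category.comp_id (CenterObj.Hom.hom _), ← h₅, h₂, CenterObj.comp_hom, CenterObj.comp_hom]
  simp only [Category.assoc]
  congr 1
  rw [h₃]
  simp only [Category.assoc]
  rw [reassoc_of% h₄, rightUnitor_inv_naturality_assoc, ← whisker_exchange_assoc,
    associator_inv_naturality_left_assoc, ← comp_whiskerRight_assoc, h₁, comp_whiskerRight_assoc]

/-- The crossed structure on the crossed center is the one described in terms of retracts. -/
def isBuiltFrom : S.IsBuiltFrom p hζ d (pivotalCleavage hζ hd).crossedStructure where
  R s X _ eX := conjRetract hp hlin hζ hd s X eX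
  θ s X _ eX := (Mat_.embedding S.CenterObj).mapIso (conjRetractIso hp hlin hζ hd s X eX)
  map s X Y h eX eY f := by
    refine ⟨_, conjRetractIso_map hp hlin hζ hd s eX eY f, ?_⟩
    have h₁ : (Mat_.embedding S.CenterObj).map ((pivotalCleavage hζ hd).map s f) ≫
        (Mat_.embedding S.CenterObj).map (conjRetractIso hp hlin hζ hd s Y eY).hom =
      (Mat_.embedding S.CenterObj).map (conjRetractIso hp hlin hζ hd s X eX).hom ≫
        (Mat_.embedding S.CenterObj).map ((conjRetractIso hp hlin hζ hd s X eX).inv ≫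
          (pivotalCleavage hζ hd).map s f ≫ (conjRetractIso hp hlin hζ hd s Y eY).hom) := by
      rw [← Functor.map_comp, ← Functor.map_comp, Iso.hom_inv_id_assoc]
    exact h₁

end CrossedStructure
end
end CrossedCat

theorem mainTheorem5 {G Γ : Type*} [Group G] [Group Γ] (P : CrossedCat.MatchedPair G Γ)
    {k : Type*} [Field k] {C : Type*} [Category* C] [Abelian C] [Linear k C] [MonoidalCategory C]
    [MonoidalPreadditive C] [MonoidalLinear k C] [RigidCategory C]
    [CrossedCat.IsTensorCategory k C] (gr : Γ → ObjectProperty C)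
    (S : CrossedCat.CrossedStructure P gr) (hlin : ∀ g, (S.act g).Linear k)
    (p : CrossedCat.PivotalStructure C) (hp : S.IsPivotal p)
    (hns : ∀ s, ∃ μ : C, gr s μ ∧ p.dim μ ≠ 0) :
    (∃ T : CrossedCat.CrossedStructure P.center S.centerGrading, ∀ s, (T.act s).Linear k) ∧
    ∀ (ζ : Γ → C) (hζ : ∀ s, gr s (ζ s)) (d : Γ → k),
      (∀ s, d s ≠ 0 ∧ p.dim (ζ s) = d s • 𝟙 (𝟙_ C)) →
      ∃ T : CrossedCat.CrossedStructure P.center S.centerGrading,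
        (∀ s, (T.act s).Linear k) ∧ Nonempty (S.IsBuiltFrom p hζ d T) := by
  have main : ∀ (ζ : Γ → C) (hζ : ∀ s, gr s (ζ s)) (d : Γ → k),
      (∀ s, d s ≠ 0 ∧ p.dim (ζ s) = d s • 𝟙 (𝟙_ C)) →
      ∃ T : CrossedCat.CrossedStructure P.center S.centerGrading,
        (∀ s, (T.act s).Linear k) ∧ Nonempty (S.IsBuiltFrom p hζ d T) :=
    fun ζ hζ d hd => ⟨_, (CrossedCat.CrossedStructure.pivotalCleavage hζ hd).crossedStructure_linear,
      ⟨CrossedCat.CrossedStructure.isBuiltFrom hp hlin hζ hd⟩⟩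
  refine ⟨?_, main⟩
  choose ζ hζ hdim using hns
  -- Otherwise all endomorphisms of the unit, and with them all dimensions, would vanish. The
  -- identity therefore spans the one-dimensional endomorphism space, and each dimension is a scalar
  -- multiple of it.
  have h₁ : (𝟙 (𝟙_ C) : 𝟙_ C ⟶ 𝟙_ C) ≠ 0 := fun h => hdim 1 (by
    rw [← Category.id_comp (p.dim (ζ 1)), h, zero_comp])
  have h₂ := (finrank_eq_one_iff_of_nonzero' (K := k) (𝟙 (𝟙_ C)) h₁).1
    (CrossedCat.IsTensorCategory.finrank_end_unit (C := C))
  choose d hd using fun s => h₂ (p.dim (ζ s))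
  obtain ⟨T, hT, -⟩ := main ζ hζ d fun s =>
    ⟨fun h => hdim s (by rw [← hd, h, zero_smul]), (hd s).symm⟩
  exact ⟨T, hT⟩
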